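/- Setting. Let $T>0$ and let $X=(X_t)_{t\in[0,T]}$ be a continuous zero-mean Gaussian process with $X_0=0$ on a probability space $(\Omega,\mathcal F,P)$, where $\mathcal F$ is generated by $X$ up to null sets; assume that the law of $X$ has full support in the space of continuous functions on $[0,T]$ vanishing at $0$, and that $X$ has a covariance measure $\mu$, i.e. there is a finite signed measure $\mu$ on $[0,T]^2$, not charging the axes, with $\mu(]a,b]\times]c,d])=R(b,d)+R(a,c)-R(a,d)-R(b,c)$, where $R(s,t)=\mathrm{Cov}(X_s,X_t)$. Let $\nu(B)=|\mu|([0,T]\times B)$. Processes are prolonged outside $[0,T]$ by their values at the end points. Let $L_\mu$ be the set of Borel $\varphi$ with $\|\varphi\|^2_{|\mathcal H|}=\int|\varphi(u)||\varphi(v)|\,d|\mu|(u,v)<\infty$, put $\langle\varphi,\psi\rangle_{\mathcal H}=\int\varphi(u)\psi(v)\,d\mu(u,v)$ and $\|\varphi\|_{\mathcal H}^2=\langle\varphi,\varphi\rangle_{\mathcal H}$, and let $\int\varphi\,dX$ be the Wiener integral, the extension, continuous from $\|\cdot\|_{\mathcal H}$ to $L^2(\Omega)$, of $1_{]a,b]}\mapsto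 X_b-X_a$. $Cyl$ is the set of $F=f(\int\varphi_1dX,\dots,\int\varphi_ndX)$ with $f\in C_b^\infty(\mathbb R^n)$, $\varphi_i\in L_\mu$, and $D_tF=\sum_i\partial_if(\dots)\varphi_i(t)$. The Malliavin derivative of $F\in L^2(\Omega)$ is $Z:\Omega\to L_\mu$ if $F_k\to F$ in $L^2(\Omega)$ and $E\|Z-DF_k\|_{\mathcal H}^2\to0$ for some $F_k\in Cyl$ (where $Z-DF_k\in L_\mu$ a.s.). $L_{\mu,2}$ is the set of Borel $\phi$ on $[0,T]^2$ with $\phi(t,\cdot)\in L_\mu$ for all $t$ and $\|\phi\|^2_{|\mathcal H|\otimes|\mathcal H|}=\int\|\phi(t_1,\cdot)\|_{|\mathcal H|}\|\phi(t_2,\cdot)\|_{|\mathcal H|}\,d|\mu|(t_1,t_2)<\infty$. A process $Y$ with paths a.s. in $L_\mu$ belongs to $|\mathbb D^{1,2}(L_\mu)|$, with derivative $DY:\Omega\to L_{\mu,2}$, $(t_1,t_2)\mapsto D_{t_1}Y_{t_2}$, if there are $u^k=\sum_\ell\psi^k_\ell G^k_\ell$ (finite sums, $\psi^k_\ell\in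 L_\mu$, $G^k_\ell\in Cyl$) with $E\|Y-u^k\|^2_{|\mathcal H|}\to0$ and $E\|DY-Du^k\|^2_{|\mathcal H|\otimes|\mathcal H|}\to0$, and if, for almost every $s\in[0,T]$, $t\mapsto D_tY_s$ is the Malliavin derivative of the random variable $Y_s$. A process $u$ with $E\|u\|^2_{|\mathcal H|}<\infty$ is in $Dom(\delta)$ if there is a zero-mean $S\in L^2(\Omega)$ with $E(FS)=E\langle DF,u\rangle_{\mathcal H}$ for all $F\in Cyl$ for which the right-hand side converges absolutely; $S=\int_0^Tu\,\delta X$ is its Skorohod integral, and $\int_0^tu\,\delta X=\int_0^Tu1_{[0,t]}\,\delta X$. Finally, $\int_0^tY\,d^\circ X$ and $[X,Y]_t$ are the limits in probability, as $\varepsilon\to0+$, of $\int_0^tY_s\frac{X_{s+\varepsilon}-X_{s-\varepsilon}}{2\varepsilon}ds$ and of $\frac1\varepsilon\int_0^t(X_{s+\varepsilon}-X_s)(Y_{s+\varepsilon}-Y_s)\,ds$. Statement. Let $Y=(Y_t)_{t\in[0,T]}$ be a measurable cadlag process such that: a) $\sup_{t\le T}|Y_t|$ is square integrable; b) $Y\in|\mathbb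 D^{1,2}(L_\mu)|$, with a jointly measurable derivative $DY$, and there is a square integrable $Z_2$ such that, for almost every $s\in[0,T]$, a.s., $|D_tY_s|\le Z_2$ for $\nu$-almost every $t$; c) for $|\mu|$-almost all $(t_1,t_2)$ the limit $D_{t_1}Y_{t_2-}=\lim_{\varepsilon\to0+}\frac1\varepsilon\int_{t_2-\varepsilon}^{t_2}D_{t_1}Y_s\,ds$ exists a.s.; moreover, for each $s\in]0,T]$, a.s., for $\nu$-almost every $t$, $D_tY_{s-}$ exists and equals $D_tY_s$; c') for $|\mu|$-almost all $(t_1,t_2)$ the limit $D_{t_1}Y_{t_2+}=\lim_{\varepsilon\to0+}\frac1\varepsilon\int_{t_2}^{t_2+\varepsilon}D_{t_1}Y_s\,ds$ exists a.s.; moreover, for each $s\in[0,T[$, a.s., for $\nu$-almost every $t$, $D_tY_{s+}$ exists and equals $D_tY_s$. Then, a.s., $D_{t_1}Y_{t_2-}$ and $D_{t_1}Y_{t_2+}$ are $|\mu|$-integrable, and for every $t\in[0,T]$ the process $Y1_{[0,t]}$ is in $Dom(\delta)$, the symmetric integral of $Y$ with respect to $X$ and the covariation $[X,Y]_t$ exist,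 and $$\int_0^tY\,d^\circ X=\int_0^tY\,\delta X+\frac12\int_{[0,T]\times[0,t]}\left(D_{t_1}Y_{t_2+}+D_{t_1}Y_{t_2-}\right)d\mu(t_1,t_2),$$ $$[X,Y]_t=\int_{[0,T]\times[0,t]}\left(D_{t_1}Y_{t_2+}-D_{t_1}Y_{t_2-}\right)d\mu(t_1,t_2).$$ -/

import Mathlib

open MeasureTheory ProbabilityTheory Set Filter Topology
open scoped ENNReal NNReal

noncomputable section

namespace CovMeasure

/-- Functions and processes indexed by `[0,T]` are prolonged to the real line by their values at the
end points. -/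
def prolong {Ω : Type*} (T : ℝ) (Y : ℝ → Ω → ℝ) (s : ℝ) (ω : Ω) : ℝ := Y (max 0 (min T s)) ω

/-- `y` is right-continuous with left limits on `[0,T]`. -/
def IsCadlag (T : ℝ) (y : ℝ → ℝ) : Prop :=
  (∀ t ∈ Ico 0 T, Tendsto y (𝓝[>] t) (𝓝 (y t))) ∧
  (∀ t ∈ Ioc 0 T, ∃ l, Tendsto y (𝓝[<] t) (𝓝 l))

/-- The signed measure `μ` is the covariance measure of the process `X` on `[0,T]` (with `X 0 = 0`):
on rectangles it is the planar increment of the covariance `R(s,t) = Cov(X_s, X_t)`. It is seen as a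
measure on the plane, carried by `(0,T]²`: since `R` vanishes on the axes, so does the measure. -/
structure IsCovarianceMeasure {Ω : Type*} [MeasurableSpace Ω] (T : ℝ) (P : Measure Ω)
    (X : ℝ → Ω → ℝ) (μ : SignedMeasure (ℝ × ℝ)) : Prop where
  rect : ∀ a b c d : ℝ, 0 ≤ a → a ≤ b → b ≤ T → 0 ≤ c → c ≤ d → d ≤ T →
    μ (Ioc a b ×ˢ Ioc c d) =
      cov[X b, X d; P] + cov[X a, X c; P] - cov[X a, X d; P] - cov[X b, X c; P]
  carried : ∀ s : Set (ℝ × ℝ), MeasurableSet s → Disjoint s (Ioc 0 T ×ˢ Ioc 0 T) → μ s = 0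

/-- The marginal `ν(B) = |μ|([0,T] × B)`. -/
def marginal (μ : SignedMeasure (ℝ × ℝ)) : Measure ℝ := μ.totalVariation.snd

/-- `‖φ‖²_{|H|} = ∫ |φ(u)| |φ(v)| d|μ|(u,v)`. -/
def absNormSq (μ : SignedMeasure (ℝ × ℝ)) (φ : ℝ → ℝ) : ℝ≥0∞ :=
  ∫⁻ p, ‖φ p.1‖ₑ * ‖φ p.2‖ₑ ∂μ.totalVariation

/-- `‖φ‖_{|H|}`. -/
def absNorm (μ : SignedMeasure (ℝ × ℝ)) (φ : ℝ → ℝ) : ℝ≥0∞ := absNormSq μ φ ^ (1 / 2 : ℝ)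

/-- Membership in `L_μ`. -/
def MemL (μ : SignedMeasure (ℝ × ℝ)) (φ : ℝ → ℝ) : Prop := Measurable φ ∧ absNormSq μ φ < ∞

/-- `⟨φ, ψ⟩_H = ∫ φ(u) ψ(v) dμ(u,v)`. -/
def innerH (μ : SignedMeasure (ℝ × ℝ)) (φ ψ : ℝ → ℝ) : ℝ := ∫ᵛ p, φ p.1 * ψ p.2 ∂•μ

/-- `‖φ‖²_{|H| ⊗ |H|} = ∫ ‖φ(t₁,·)‖_{|H|} ‖φ(t₂,·)‖_{|H|} d|μ|(t₁,t₂)`. -/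
def absTensorNormSq (μ : SignedMeasure (ℝ × ℝ)) (φ : ℝ → ℝ → ℝ) : ℝ≥0∞ :=
  ∫⁻ p, absNorm μ (φ p.1) * absNorm μ (φ p.2) ∂μ.totalVariation

/-- Membership in `L_{μ,2}`. -/
def MemL2 (T : ℝ) (μ : SignedMeasure (ℝ × ℝ)) (φ : ℝ → ℝ → ℝ) : Prop :=
  Measurable (fun p : ℝ × ℝ => φ p.1 p.2) ∧ (∀ t ∈ Icc 0 T, MemL μ (φ t)) ∧
    absTensorNormSq μ φ < ∞

/-- Step functions `∑ i, c i 1_{(a i, b i]}` on `[0,T]`. -/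
structure StepFun (T : ℝ) where
  n : ℕ
  c : Fin n → ℝ
  a : Fin n → ℝ
  b : Fin n → ℝ
  zero_le : ∀ i, 0 ≤ a i
  le : ∀ i, a i ≤ b i
  le_end : ∀ i, b i ≤ T

def StepFun.val {T : ℝ} (g : StepFun T) (t : ℝ) : ℝ :=
  ∑ i, (Ioc (g.a i) (g.b i)).indicator (fun _ => g.c i) t

/-- The integral of a step function with respect to `X`. -/
def StepFun.integral {Ω : Type*} {T : ℝ} (g : StepFun T) (X : ℝ → Ω → ℝ) (ω : Ω) : ℝ :=
  ∑ i, g.c i * (X (g.b i) ω - X (g.a i) ω)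

/-- `W` is (a version of) the Wiener integral `∫ φ dX`: the extension, continuous from `‖·‖_H` to
`L²(Ω)`, of the integral of step functions. -/
def IsWienerIntegral {Ω : Type*} [MeasurableSpace Ω] (T : ℝ) (P : Measure Ω) (X : ℝ → Ω → ℝ)
    (μ : SignedMeasure (ℝ × ℝ)) (φ : ℝ → ℝ) (W : Ω → ℝ) : Prop :=
  MemLp W 2 P ∧ ∃ g : ℕ → StepFun T,
    (∀ k, MemL μ (φ - (g k).val)) ∧
    Tendsto (fun k => innerH μ (φ - (g k).val) (φ - (g k).val)) atTop (𝓝 0) ∧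
    Tendsto (fun k => eLpNorm (W - (g k).integral X) 2 P) atTop (𝓝 0)

/-- `C_b^∞(ℝⁿ)`: smooth functions that are bounded together with all their derivatives. -/
def IsSmoothBounded {n : ℕ} (f : (Fin n → ℝ) → ℝ) : Prop :=
  ContDiff ℝ (⊤ : ℕ∞) f ∧ ∀ k : ℕ, ∃ C : ℝ, ∀ x, ‖iteratedFDeriv ℝ k f x‖ ≤ C

/-- Elements `F = f(∫ φ₁ dX, …, ∫ φₙ dX)` of `Cyl`, with their representation. -/
structure CylVar {Ω : Type*} [MeasurableSpace Ω] (T : ℝ) (P : Measure Ω) (X : ℝ → Ω → ℝ)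
    (μ : SignedMeasure (ℝ × ℝ)) where
  n : ℕ
  f : (Fin n → ℝ) → ℝ
  smooth : IsSmoothBounded f
  φ : Fin n → ℝ → ℝ
  memL : ∀ i, MemL μ (φ i)
  W : Fin n → Ω → ℝ
  wiener : ∀ i, IsWienerIntegral T P X μ (φ i) (W i)

section

variable {Ω : Type*} [MeasurableSpace Ω] {T : ℝ} {P : Measure Ω} {X : ℝ → Ω → ℝ}
  {μ : SignedMeasure (ℝ × ℝ)}

def CylVar.val (F : CylVar T P X μ) (ω : Ω) : ℝ := F.f (fun i => F.W i ω)

/-- The Malliavin derivative `D_t F = ∑ i, ∂ᵢ f(∫ φ₁ dX, …, ∫ φₙ dX) φᵢ(t)`. -/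
def CylVar.deriv (F : CylVar T P X μ) (ω : Ω) (t : ℝ) : ℝ :=
  ∑ i, fderiv ℝ F.f (fun j => F.W j ω) (Pi.single i 1) * F.φ i t

end

/-- Elements `u_t = ∑ ℓ, ψ_ℓ(t) G_ℓ` of `Cyl(L_μ)`, with their representation. -/
structure CylProc {Ω : Type*} [MeasurableSpace Ω] (T : ℝ) (P : Measure Ω) (X : ℝ → Ω → ℝ)
    (μ : SignedMeasure (ℝ × ℝ)) where
  n : ℕ
  ψ : Fin n → ℝ → ℝ
  memL : ∀ l, MemL μ (ψ l)
  G : Fin n → CylVar T P X μ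

section

variable {Ω : Type*} [MeasurableSpace Ω] {T : ℝ} {P : Measure Ω} {X : ℝ → Ω → ℝ}
  {μ : SignedMeasure (ℝ × ℝ)}

def CylProc.val (u : CylProc T P X μ) (t : ℝ) (ω : Ω) : ℝ := ∑ l, u.ψ l t * (u.G l).val ω

/-- `(t₁,t₂) ↦ D_{t₁} u_{t₂}`. -/
def CylProc.deriv (u : CylProc T P X μ) (ω : Ω) (t₁ t₂ : ℝ) : ℝ :=
  ∑ l, u.ψ l t₂ * (u.G l).deriv ω t₁

end

/-- `F ∈ 𝔻^{1,2}` and its Malliavin derivative is represented by the `L_μ`-valued `Z`: there are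
`F_k ∈ Cyl` with `F_k → F` in `L²(Ω)` and `E ‖Z - D F_k‖²_H → 0`. -/
structure IsMalliavinDeriv {Ω : Type*} [MeasurableSpace Ω] (T : ℝ) (P : Measure Ω)
    (X : ℝ → Ω → ℝ) (μ : SignedMeasure (ℝ × ℝ)) (F : Ω → ℝ) (Z : Ω → ℝ → ℝ) : Prop where
  memLp : MemLp F 2 P
  memL : ∀ᵐ ω ∂P, MemL μ (Z ω)
  approx : ∃ G : ℕ → CylVar T P X μ,
    (∀ k, ∀ᵐ ω ∂P, MemL μ (Z ω - (G k).deriv ω)) ∧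
    Tendsto (fun k => eLpNorm (F - (G k).val) 2 P) atTop (𝓝 0) ∧
    Tendsto (fun k => ∫⁻ ω, ENNReal.ofReal
      (innerH μ (Z ω - (G k).deriv ω) (Z ω - (G k).deriv ω)) ∂P) atTop (𝓝 0)

/-- `Y ∈ |𝔻^{1,2}(L_μ)|` and `DY ω t₁ t₂ = D_{t₁} Y_{t₂}(ω)` is a version of its Malliavin
derivative. The last field says that `D_{t₁} Y_s` is indeed the derivative of the random
variable `Y_s`, for almost every `s`. -/
structure IsMalliavinDerivProc {Ω : Type*} [MeasurableSpace Ω] (T : ℝ) (P : Measure Ω)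
    (X : ℝ → Ω → ℝ) (μ : SignedMeasure (ℝ × ℝ)) (Y : ℝ → Ω → ℝ) (DY : Ω → ℝ → ℝ → ℝ) :
    Prop where
  measurable : Measurable (fun q : Ω × ℝ × ℝ => DY q.1 q.2.1 q.2.2)
  memL : ∀ᵐ ω ∂P, MemL μ (fun t => Y t ω)
  memL2 : ∀ᵐ ω ∂P, MemL2 T μ (DY ω)
  approx : ∃ u : ℕ → CylProc T P X μ,
    Tendsto (fun k => ∫⁻ ω, absNormSq μ (fun t => Y t ω - (u k).val t ω) ∂P) atTop (𝓝 0) ∧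
    Tendsto (fun k => ∫⁻ ω, absTensorNormSq μ (DY ω - (u k).deriv ω) ∂P) atTop (𝓝 0)
  slice : ∀ᵐ s ∂(volume.restrict (Icc 0 T)),
    IsMalliavinDeriv T P X μ (Y s) (fun ω t => DY ω t s)

/-- `u ∈ Dom δ` and `S` is (a version of) its Skorohod integral `∫_0^T u δX`: duality with the
Malliavin derivative, `E(F S) = E ⟨DF, u⟩_H` for every `F ∈ Cyl` for which the right-hand side is
meaningful, that is, absolutely convergent. (The set `L_μ` need not be stable under sums, so that
`⟨φ, ψ⟩_H` may be undefined for some `φ, ψ` in `L_μ`.) -/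
structure IsSkorohodIntegral {Ω : Type*} [MeasurableSpace Ω] (T : ℝ) (P : Measure Ω)
    (X : ℝ → Ω → ℝ) (μ : SignedMeasure (ℝ × ℝ)) (u : ℝ → Ω → ℝ) (S : Ω → ℝ) : Prop where
  measurable : Measurable (fun q : ℝ × Ω => u q.1 q.2)
  sq_lt_top : ∫⁻ ω, absNormSq μ (fun t => u t ω) ∂P < ∞
  memLp : MemLp S 2 P
  zero_mean : ∫ ω, S ω ∂P = 0
  duality : ∀ F : CylVar T P X μ,
    Integrable (fun q : Ω × ℝ × ℝ => F.deriv q.1 q.2.1 * u q.2.2 q.1)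
      (P.prod μ.totalVariation) →
    ∫ ω, F.val ω * S ω ∂P = ∫ ω, innerH μ (F.deriv ω) (fun t => u t ω) ∂P

/-- `J` is (a version of) the symmetric integral `∫_0^t Y d°X`: the limit in probability of
`∫_0^t Y_s (X_{s+ε} - X_{s-ε}) / (2 ε) ds` as `ε → 0+`. -/
def IsSymmetricIntegral {Ω : Type*} [MeasurableSpace Ω] (T : ℝ) (P : Measure Ω)
    (Y X : ℝ → Ω → ℝ) (t : ℝ) (J : Ω → ℝ) : Prop :=
  TendstoInMeasure P
    (fun (ε : ℝ) ω => ∫ s in (0 : ℝ)..t,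
      Y s ω * ((prolong T X (s + ε) ω - prolong T X (s - ε) ω) / (2 * ε)))
    (𝓝[>] 0) J

/-- `C` is (a version of) the covariation `[X,Y]_t`: the limit in probability of
`ε⁻¹ ∫_0^t (X_{s+ε} - X_s) (Y_{s+ε} - Y_s) ds` as `ε → 0+`. -/
def IsCovariation {Ω : Type*} [MeasurableSpace Ω] (T : ℝ) (P : Measure Ω)
    (X Y : ℝ → Ω → ℝ) (t : ℝ) (C : Ω → ℝ) : Prop :=
  TendstoInMeasure P
    (fun (ε : ℝ) ω => ε⁻¹ * ∫ s in (0 : ℝ)..t,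
      (prolong T X (s + ε) ω - X s ω) * (prolong T Y (s + ε) ω - Y s ω))
    (𝓝[>] 0) C

/-- `ε⁻¹ ∫_{s-ε}^s g(r) dr`. -/
def leftAvg (g : ℝ → ℝ) (s ε : ℝ) : ℝ := ε⁻¹ * ∫ r in (s - ε)..s, g r

/-- `ε⁻¹ ∫_s^{s+ε} g(r) dr`. -/
def rightAvg (g : ℝ → ℝ) (s ε : ℝ) : ℝ := ε⁻¹ * ∫ r in s..(s + ε), g r

/-- `g(s-)`, the limit of the left averages; used only where this limit exists. -/
def leftTrace (g : ℝ → ℝ) (s : ℝ) : ℝ := limUnder (𝓝[>] 0) (leftAvg g s)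

/-- `g(s+)`, the limit of the right averages; used only where this limit exists. -/
def rightTrace (g : ℝ → ℝ) (s : ℝ) : ℝ := limUnder (𝓝[>] 0) (rightAvg g s)

end CovMeasure

end

/-! For a variable V with Malliavin derivative DV, the divergence of V 1_{]p,q]} is V (X_q - X_p) -
⟨DV, 1_{]p,q]}⟩. Gaussian integration by parts gives the isometry E[δ(V 1_I) δ(V' 1_J)] = E[V V']
⟨1_I, 1_J⟩ + E[⟨DV, 1_J⟩ ⟨DV', 1_I⟩] (`HasDirDeriv.isometry`). Take V = U_s with U = Y 1_{[0,t]},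
take the interval from s to s + ε, integrate over s and divide by ε; call the result `approxDiv`.
Then ε⁻¹ ∫ U_s (X_{s+ε} - X_s) ds is `approxDiv` plus the integral against μ of the averages of
D_{t₁}U over the interval from t₂ - ε to t₂ (`IsRegularProc.regularized_eq`). The scale ε may have
either sign: positive scales give the forward integral and left averages, negative scales the
backward integral and right averages.

By the isometry and Fubini, the mutual covariances of the variables `approxDiv` are integrals,
against μ and against μ ⊗ μ, of averages of U and DU (`IsRegularProc.integral_approxDiv_mul`). These
averages are dominated by a square integrable variable. They converge almost everywhere: the
marginals of |μ| have no atoms, so the jumps of a path are negligible, and the conditions on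
one-sided averages at a fixed time take care of DU. The covariances therefore converge to one
number, whatever the signs of the two scales, so the family is Cauchy in L² with a single limit S.
The duality formula passes to the limit and identifies S as the Skorohod integral.

The trace terms converge to the integrals of the left or right trace of DY. So the forward integral
tends to S plus the left trace term and the backward one to S plus the right trace term. Half the
sum is the symmetric integral; backward minus forward is the covariation, up to two boundary terms
that vanish.

The delicate point is that functions in L_μ may be unbounded and L_μ need not be stable under sums.
The form of μ is treated as an inner product on bounded measurable functions only, where symmetry
and positivity come from the covariances by approximation (`IsCovProcess.isGood`); unbounded
directions are reached by cutting them to sets where they are bounded. Since the symmetric integral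
is compared with an arbitrary version of the Skorohod integral, uniqueness is also needed. It
follows from the totality of trigonometric functions of the process (`ae_eq_zero_of_integral_trig`).
-/

noncomputable section

namespace CovMeasure

/-! ### Integration against a signed measure through its sign density -/

section SignedMeasure

variable {E : Type*} [MeasurableSpace E] (μ : SignedMeasure E)

/-- The positive set of a Hahn decomposition of `μ`. -/
def hahnSet : Set E := (SignedMeasure.toJordanDecomposition_spec μ).choose

/-- The sign density of a signed measure with respect to its total variation. -/
def sgn (x : E) : ℝ := (hahnSet μ).indicator 1 x - (hahnSet μ)ᶜ.indicator 1 x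

lemma measurableSet_hahnSet : MeasurableSet (hahnSet μ) :=
  (SignedMeasure.toJordanDecomposition_spec μ).choose_spec.choose

lemma posPart_compl_hahnSet : μ.toJordanDecomposition.posPart (hahnSet μ)ᶜ = 0 := by
  obtain ⟨h1, h2, h3, h4, h5⟩ := (SignedMeasure.toJordanDecomposition_spec μ).choose_spec
  rw [h4, SignedMeasure.toMeasureOfZeroLE_apply _ h2 h1 (measurableSet_hahnSet μ).compl]
  simp [hahnSet]

lemma negPart_hahnSet : μ.toJordanDecomposition.negPart (hahnSet μ) = 0 := by
  obtain ⟨h1, h2, h3, h4, h5⟩ := (SignedMeasure.toJordanDecomposition_spec μ).choose_spec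
  rw [h5, SignedMeasure.toMeasureOfLEZero_apply _ h3 h1.compl (measurableSet_hahnSet μ)]
  simp [hahnSet]

lemma measurable_sgn : Measurable (sgn μ) :=
  (measurable_one.indicator (measurableSet_hahnSet μ)).sub
    (measurable_one.indicator (measurableSet_hahnSet μ).compl)

lemma abs_sgn (x : E) : |sgn μ x| = 1 := by
  by_cases h : x ∈ hahnSet μ <;> simp [sgn, h]

lemma sgn_ae_posPart : ∀ᵐ x ∂μ.toJordanDecomposition.posPart, sgn μ x = 1 := by
  have := posPart_compl_hahnSet μ
  filter_upwards [measure_eq_zero_iff_ae_notMem.1 this] with x hx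
  simp only [mem_compl_iff, not_not] at hx
  simp [sgn, hx]

lemma sgn_ae_negPart : ∀ᵐ x ∂μ.toJordanDecomposition.negPart, sgn μ x = -1 := by
  filter_upwards [measure_eq_zero_iff_ae_notMem.1 (negPart_hahnSet μ)] with x hx
  simp [sgn, hx]

/-- The density is almost everywhere 1 for the positive and -1 for the negative Jordan part. -/
lemma integral_sgn_eq {f : E → ℝ} (hf : Integrable f μ.totalVariation) :
    ∫ x, f x * sgn μ x ∂μ.totalVariation =
      ∫ x, f x ∂μ.toJordanDecomposition.posPart - ∫ x, f x ∂μ.toJordanDecomposition.negPart := by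
  have hg : Integrable (fun x => f x * sgn μ x) μ.totalVariation :=
    hf.mul_bdd (c := 1) (measurable_sgn μ).aestronglyMeasurable
      (ae_of_all _ fun x => by simp [abs_sgn])
  unfold SignedMeasure.totalVariation at hg ⊢
  rw [integral_add_measure (integrable_add_measure.1 hg).1 (integrable_add_measure.1 hg).2]
  have h1 : ∫ x, f x * sgn μ x ∂μ.toJordanDecomposition.posPart
      = ∫ x, f x ∂μ.toJordanDecomposition.posPart :=
    integral_congr_ae ((sgn_ae_posPart μ).mono fun x hx => by simp [hx])
  have h2 : ∫ x, f x * sgn μ x ∂μ.toJordanDecomposition.negPart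
      = ∫ x, - f x ∂μ.toJordanDecomposition.negPart :=
    integral_congr_ae ((sgn_ae_negPart μ).mono fun x hx => by simp [hx])
  rw [h1, h2, integral_neg, sub_eq_add_neg]

/-- Trades the vector-measure integral of the statement for a Bochner integral against the finite
measure |μ|, where Fubini and dominated convergence apply. -/
lemma vectorIntegral_eq {f : E → ℝ} (hf : Integrable f μ.totalVariation) :
    ∫ᵛ x, f x ∂•μ = ∫ x, f x * sgn μ x ∂μ.totalVariation := by
  rw [integral_sgn_eq μ hf]
  -- Scalar multiplication of reals is its own flip, which reconciles the two orders of arguments in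
  -- the pairing.
  have hflip : (ContinuousLinearMap.lsmul ℝ ℝ : ℝ →L[ℝ] ℝ →L[ℝ] ℝ)
      = (ContinuousLinearMap.lsmul ℝ ℝ).flip := by
    ext; simp
  have hp : ∀ (ρ : Measure E) [IsFiniteMeasure ρ], ρ ≤ μ.totalVariation →
      VectorMeasure.Integrable ρ.toSignedMeasure f := by
    intro ρ _ hρ
    have : ρ.toSignedMeasure.variation = ρ := by simp
    rw [VectorMeasure.Integrable, this]
    exact hf.mono_measure hρ
  conv_lhs => rw [← SignedMeasure.toSignedMeasure_toJordanDecomposition μ]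
  rw [JordanDecomposition.toSignedMeasure, VectorMeasure.integral_sub_vectorMeasure, hflip,
    VectorMeasure.integral_toSignedMeasure, VectorMeasure.integral_toSignedMeasure]
  · exact hp _ (Measure.le_add_right le_rfl)
  · exact hp _ (Measure.le_add_left le_rfl)

lemma apply_eq_integral_sgn {s : Set E} (hs : MeasurableSet s) :
    μ s = ∫ x in s, sgn μ x ∂μ.totalVariation := by
  have := integral_sgn_eq μ ((integrable_const (1 : ℝ)).indicator hs)
  rw [μ.apply_eq_posPart_real_sub_negPart_real hs, ← integral_indicator hs]
  simp only [integral_indicator_const, hs, smul_eq_mul, mul_one] at this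
  rw [← this]
  congr with x
  by_cases hx : x ∈ s <;> simp [hx]

/-- The restricted measure is the difference of the restricted Jordan parts; that this is again a
Jordan decomposition is not needed. -/
lemma setVectorIntegral_eq {f : E → ℝ} (hf : Integrable f μ.totalVariation) {s : Set E}
    (hs : MeasurableSet s) :
    ∫ᵛ x in s, f x ∂•μ = ∫ x in s, f x * sgn μ x ∂μ.totalVariation := by
  have hv : (μ.restrict s).variation = μ.totalVariation.restrict s := by
    rw [VectorMeasure.variation_restrict hs, SignedMeasure.totalVariation_eq_variation]
  have hsplit : μ.restrict s = (μ.toJordanDecomposition.posPart.restrict s).toSignedMeasure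
      - (μ.toJordanDecomposition.negPart.restrict s).toSignedMeasure := by
    ext t ht
    rw [VectorMeasure.restrict_apply _ hs ht, μ.apply_eq_posPart_real_sub_negPart_real (ht.inter hs),
      Measure.toSignedMeasure_sub_apply ht]
    simp [measureReal_def, Measure.restrict_apply ht]
  have hflip : (ContinuousLinearMap.lsmul ℝ ℝ : ℝ →L[ℝ] ℝ →L[ℝ] ℝ)
      = (ContinuousLinearMap.lsmul ℝ ℝ).flip := by
    ext; simp
  have hp : ∀ (ρ : Measure E) [IsFiniteMeasure ρ], ρ ≤ μ.totalVariation →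
      VectorMeasure.Integrable (ρ.restrict s).toSignedMeasure f := by
    intro ρ _ hρ
    have : (ρ.restrict s).toSignedMeasure.variation = ρ.restrict s := by simp
    rw [VectorMeasure.Integrable, this]
    exact (hf.mono_measure hρ).restrict
  rw [hsplit, VectorMeasure.integral_sub_vectorMeasure, hflip,
    VectorMeasure.integral_toSignedMeasure, VectorMeasure.integral_toSignedMeasure]
  · have := integral_sgn_eq μ (hf.indicator hs)
    rw [integral_indicator hs, integral_indicator hs] at this
    rw [← this, ← integral_indicator hs]
    congr with x
    by_cases hx : x ∈ s <;> simp [hx]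
  · exact hp _ (Measure.le_add_right le_rfl)
  · exact hp _ (Measure.le_add_left le_rfl)

end SignedMeasure

/-! ### Stein's identity -/

section Stein

lemma hasDerivAt_gaussianPDFReal (v : ℝ≥0) (hv : v ≠ 0) (x : ℝ) :
    HasDerivAt (gaussianPDFReal 0 v) (-(x / v) * gaussianPDFReal 0 v x) x := by
  have hv' : (v : ℝ) ≠ 0 := by exact_mod_cast hv
  rw [gaussianPDFReal_def]
  have h1 : HasDerivAt (fun x : ℝ => -(x - 0) ^ 2 / (2 * (v : ℝ))) (-(x / v)) x := by
    have := ((((hasDerivAt_id x).sub_const 0).pow 2).neg).div_const (2 * (v : ℝ))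
    convert! this using 1
    simp; field_simp
  convert! (h1.exp.const_mul (√(2 * Real.pi * v))⁻¹) using 1
  ring

/-- Stein's identity for a centred real Gaussian variable. -/
lemma integral_mul_gaussianReal (v : ℝ≥0) (hv : v ≠ 0) {h h' : ℝ → ℝ}
    (hd : ∀ x, HasDerivAt h (h' x) x)
    (h1 : Integrable h (gaussianReal 0 v))
    (h2 : Integrable (fun x => h x * x) (gaussianReal 0 v))
    (h3 : Integrable h' (gaussianReal 0 v)) :
    ∫ x, h x * x ∂gaussianReal 0 v = v * ∫ x, h' x ∂gaussianReal 0 v := by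
  have hv' : (v : ℝ) ≠ 0 := by exact_mod_cast hv
  have key : ∀ f : ℝ → ℝ, Integrable f (gaussianReal 0 v) →
      Integrable (fun x => f x * gaussianPDFReal 0 v x) := by
    intro f hf
    rw [gaussianReal_of_var_ne_zero 0 hv, integrable_withDensity_iff_integrable_smul'
      (measurable_gaussianPDF 0 v) (ae_of_all _ fun _ => gaussianPDF_lt_top)] at hf
    refine hf.congr (ae_of_all _ fun x => ?_)
    simp [toReal_gaussianPDF, mul_comm]
  rw [integral_gaussianReal_eq_integral_smul hv, integral_gaussianReal_eq_integral_smul hv]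
  -- Integration by parts on the line: x times the density is -v times its derivative. Integrability
  -- of the products removes the boundary terms.
  have := integral_mul_deriv_eq_deriv_mul_of_integrable (u := h) (u' := h')
    (v := gaussianPDFReal 0 v) (v' := fun x => -(x / v) * gaussianPDFReal 0 v x)
    (fun x _ => hd x) (fun x _ => hasDerivAt_gaussianPDFReal v hv x) ?_ (key _ h3) (key _ h1)
  · simp only [smul_eq_mul]
    calc ∫ x, gaussianPDFReal 0 v x * (h x * x)
        = ∫ x, -v * (h x * (-(x / v) * gaussianPDFReal 0 v x)) := by
          congr with x; field_simp
      _ = v * ∫ x, h' x * gaussianPDFReal 0 v x := by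
          rw [integral_const_mul, this]; ring
      _ = _ := by simp_rw [mul_comm (gaussianPDFReal 0 v _)]
  · refine ((key _ h2).const_mul (-(v : ℝ)⁻¹)).congr (ae_of_all _ fun x => ?_)
    simp; field_simp

end Stein

/-! ### Gaussian integration by parts on path space -/

section PathIBP

variable {Ω : Type*} [MeasurableSpace Ω] {P : Measure Ω}

/-- Gaussian integration by parts on path space, in the direction of the covariances with the
increment `X q - X p`. -/
lemma integral_path_mul_incr {X : ℝ → Ω → ℝ} (hm : ∀ t, Measurable (X t))
    (hG : IsGaussianProcess X P) (h0 : ∀ t, ∫ ω, X t ω ∂P = 0) (p q : ℝ)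
    {c : ℝ → ℝ} (hc : ∀ t, c t = ∫ ω, X t ω * (X q ω - X p ω) ∂P)
    {a b : (ℝ → ℝ) → ℝ} (ham : Measurable a) (hbm : Measurable b)
    (hd : ∀ x, HasDerivAt (fun l : ℝ => a (x + l • c)) (b x) 0)
    (ha : Integrable (fun ω => a (fun t => X t ω)) P)
    (haξ : Integrable (fun ω => a (fun t => X t ω) * (X q ω - X p ω)) P)
    (hb : Integrable (fun ω => b (fun t => X t ω)) P) :
    ∫ ω, a (fun t => X t ω) * (X q ω - X p ω) ∂P = ∫ ω, b (fun t => X t ω) ∂P := by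
  have := hG.isProbabilityMeasure
  set ξ : Ω → ℝ := X q - X p with hξ
  have hξm : Measurable ξ := (hm q).sub (hm p)
  have hX2 : ∀ t, MemLp (X t) 2 P := fun t => (hG.hasGaussianLaw_eval t).memLp_two
  have hξG : HasGaussianLaw ξ P := hG.hasGaussianLaw_sub
  have hξ2 : MemLp ξ 2 P := hξG.memLp_two
  have hξ0 : ∫ ω, ξ ω ∂P = 0 := by
    rw [hξ]
    simp only [Pi.sub_apply]
    rw [integral_sub ((hX2 q).integrable one_le_two) ((hX2 p).integrable one_le_two), h0, h0, sub_zero]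
  set v : ℝ := Var[ξ; P] with hv
  have hvE : v = ∫ ω, ξ ω * ξ ω ∂P := by
    rw [hv, variance_eq_sub hξ2, hξ0]
    simp [pow_two]
  -- Differentiability is assumed only at 0 but from every base point, so it holds all along the
  -- line.
  have hd' : ∀ (x : ℝ → ℝ) (l : ℝ),
      HasDerivAt (fun l : ℝ => a (x + l • c)) (b (x + l • c)) l := by
    intro x l
    have h := hd (x + l • c)
    have h2 : HasDerivAt (fun l' : ℝ => l' - l) 1 l := (hasDerivAt_id l).sub_const l
    have h3 : HasDerivAt (fun l : ℝ => a (x + l • c)) (b (x + l • c) * 1) l := by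
      have h4 := HasDerivAt.comp l (h₂ := fun l' : ℝ => a (x + l • c + l' • c))
        (h := fun l' : ℝ => l' - l) (by simpa only [sub_self] using h) h2
      convert! h4 using 1
      ext l'
      simp only [Function.comp]
      congr 1
      ext t; simp; ring
    simpa using h3
  -- In the degenerate case the increment vanishes almost surely, so `c = 0`, and `b` vanishes as
  -- the derivative of a constant.
  by_cases hv0 : v = 0
  · have hξz : ξ =ᵐ[P] 0 := by
      have : ∀ᵐ ω ∂P, ξ ω * ξ ω = 0 := by
        rw [hvE] at hv0
        exact (integral_eq_zero_iff_of_nonneg (fun ω => mul_self_nonneg _)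
          (hξ2.integrable_mul hξ2)).1 hv0
      filter_upwards [this] with ω hω
      simpa using hω
    have hcz : c = 0 := by
      ext t
      rw [hc, Pi.zero_apply]
      refine integral_eq_zero_of_ae ?_
      filter_upwards [hξz] with ω hω
      have : X q ω - X p ω = 0 := hω
      simp [this]
    have hbz : ∀ x, b x = 0 := fun x => by
      have := (hd x)
      simp only [hcz, smul_zero, add_zero] at this
      exact this.unique (hasDerivAt_const _ _)
    simp only [hbz, integral_zero]
    refine integral_eq_zero_of_ae ?_
    filter_upwards [hξz] with ω hω
    have : X q ω - X p ω = 0 := hω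
    simp [this]
  have hvpos : 0 < v := lt_of_le_of_ne (variance_nonneg _ _) (Ne.symm hv0)
  -- The residual of the regression of the path on ξ: uncorrelated with ξ and jointly Gaussian with
  -- it, hence independent of it.
  set U : ℝ → Ω → ℝ := fun t ω => X t ω - c t / v * ξ ω with hU
  have hUm : ∀ t, Measurable (U t) := fun t => (hm t).sub (hξm.const_mul _)
  have hjoint : IsGaussianProcess (Sum.elim U (fun _ : Unit => ξ)) P := by
    classical
    refine hG.of_isGaussianProcess fun s => ?_
    rcases s with t | _
    · refine ⟨{t, p, q}, ContinuousLinearMap.proj ⟨t, by simp⟩ - (c t / v) •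
        (ContinuousLinearMap.proj ⟨q, by simp⟩ - ContinuousLinearMap.proj ⟨p, by simp⟩),
        fun ω => ?_⟩
      simp [hU, hξ]
    · refine ⟨{p, q},
        (ContinuousLinearMap.proj ⟨q, by simp⟩ - ContinuousLinearMap.proj ⟨p, by simp⟩),
        fun ω => ?_⟩
      simp [hξ]
  have hcovX : ∀ t, cov[X t, ξ; P] = c t := fun t => by
    rw [covariance_eq_sub (hX2 t) hξ2, h0, zero_mul, sub_zero, hc]
    rfl
  have hind : IndepFun (fun ω t => U t ω) (fun ω (_ : Unit) => ξ ω) P := by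
    refine hjoint.indepFun_of_covariance_eq_zero (fun s => (hUm s).aemeasurable)
      (fun _ => hξm.aemeasurable) fun s _ => ?_
    have : U s = X s - (c s / v) • ξ := by ext; simp [hU]
    rw [this, covariance_sub_left (hX2 s) (hξ2.const_smul _) hξ2, covariance_smul_left,
      covariance_self hξm.aemeasurable, hcovX, ← hv]
    field_simp
    simp
  have hind' : IndepFun (fun ω t => U t ω) ξ P :=
    hind.comp (φ := id) (ψ := fun f : Unit → ℝ => f ()) measurable_id (measurable_pi_apply _)
  have hUpm : Measurable (fun ω t => U t ω) := measurable_pi_lambda _ hUm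
  have hlaw : P.map (fun ω => (fun t => U t ω, ξ ω)) =
      (P.map (fun ω t => U t ω)).prod (gaussianReal 0 v.toNNReal) := by
    rw [(indepFun_iff_map_prod_eq_prod_map_map hUpm.aemeasurable hξm.aemeasurable).1 hind',
      hξG.map_eq_gaussianReal, hξ0]
  set ρ := P.map (fun ω t => U t ω) with hρ
  have : IsProbabilityMeasure ρ := Measure.isProbabilityMeasure_map hUpm.aemeasurable
  have hpair : Measurable (fun ω => ((fun t => U t ω : ℝ → ℝ), ξ ω)) := hUpm.prodMk hξm
  -- Inverts the regression: for a fixed residual, a function of the path becomes a function of the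
  -- real Gaussian variable ξ.
  set Φ : (ℝ → ℝ) × ℝ → (ℝ → ℝ) := fun z => z.1 + (z.2 / v) • c with hΦ
  have hΦm : Measurable Φ := by
    refine measurable_pi_lambda _ fun t => ?_
    simp only [hΦ, Pi.add_apply, Pi.smul_apply, smul_eq_mul]
    exact ((measurable_pi_apply t).comp measurable_fst).add
      ((measurable_snd.div_const _).mul_const _)
  have hΦX : ∀ ω, Φ (fun t => U t ω, ξ ω) = fun t => X t ω := by
    intro ω
    ext t
    simp only [hΦ, hU, Pi.add_apply, Pi.smul_apply, smul_eq_mul]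
    ring
  have hint : ∀ g : (ℝ → ℝ) × ℝ → ℝ, Measurable g →
      Integrable (fun ω => g (fun t => U t ω, ξ ω)) P →
      Integrable g (ρ.prod (gaussianReal 0 v.toNNReal)) := by
    intro g hg hgi
    rw [← hlaw, integrable_map_measure hg.aestronglyMeasurable hpair.aemeasurable]
    exact hgi
  have hval : ∀ g : (ℝ → ℝ) × ℝ → ℝ, Measurable g →
      ∫ ω, g (fun t => U t ω, ξ ω) ∂P = ∫ z, g z ∂(ρ.prod (gaussianReal 0 v.toNNReal)) := by
    intro g hg
    rw [← hlaw, integral_map hpair.aemeasurable hg.aestronglyMeasurable]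
  have i1 := hint (fun z => a (Φ z)) (ham.comp hΦm) (by simpa only [hΦX] using ha)
  have i2 := hint (fun z => a (Φ z) * z.2) ((ham.comp hΦm).mul measurable_snd)
    (by simp only [hΦX]; exact haξ)
  have i3 := hint (fun z => b (Φ z)) (hbm.comp hΦm) (by simpa only [hΦX] using hb)
  have e2 := hval (fun z => a (Φ z) * z.2) ((ham.comp hΦm).mul measurable_snd)
  have e3 := hval (fun z => b (Φ z)) (hbm.comp hΦm)
  simp only [hΦX] at e2 e3
  change ∫ ω, a (fun t => X t ω) * ξ ω ∂P = _
  rw [e2, e3, integral_prod _ i2, integral_prod _ i3]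
  refine integral_congr_ae ?_
  filter_upwards [i1.prod_right_ae, i2.prod_right_ae, i3.prod_right_ae] with u j1 j2 j3
  have hvn : v.toNNReal ≠ 0 := by simpa using hvpos
  -- Stein's identity for a fixed residual; the chain-rule factor 1 / v cancels the variance.
  have hs := integral_mul_gaussianReal v.toNNReal hvn (h := fun x => a (Φ (u, x)))
    (h' := fun x => b (Φ (u, x)) * (1 / v)) (fun x => ?_) j1 j2 (j3.mul_const _)
  · rw [hs, integral_mul_const, Real.coe_toNNReal _ hvpos.le]
    field_simp
  · have h2 : HasDerivAt (fun x : ℝ => x / v) (1 / v) x := (hasDerivAt_id x).div_const v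
    exact HasDerivAt.comp x (hd' u (x / v)) h2

end PathIBP

/-! ### The bilinear form, covariance processes, smooth bounded functions -/

/-- `∫ ψ(u) χ(v) dμ(u,v)`, written with the sign density of `μ`. -/
def bil (μ : SignedMeasure (ℝ × ℝ)) (ψ χ : ℝ → ℝ) : ℝ :=
  ∫ p, ψ p.1 * χ p.2 * sgn μ p ∂μ.totalVariation

/-- The indicator of `(-∞, b]`. -/
def halfLine (b : ℝ) (x : ℝ) : ℝ := (Iic b).indicator 1 x

/-- The function whose integral is the increment from `p` to `q`. -/
def incrFun (p q x : ℝ) : ℝ := halfLine q x - halfLine p x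

/-- A continuous centred Gaussian process on the line with covariance measure `μ`. -/
structure IsCovProcess {Ω : Type*} [MeasurableSpace Ω] (P : Measure Ω) (X : ℝ → Ω → ℝ)
    (μ : SignedMeasure (ℝ × ℝ)) : Prop where
  meas : ∀ t, Measurable (X t)
  cont : ∀ ω, Continuous fun t => X t ω
  gauss : IsGaussianProcess X P
  zero_mean : ∀ t, ∫ ω, X t ω ∂P = 0
  cov : ∀ a b, ∫ ω, X a ω * X b ω ∂P = bil μ (halfLine a) (halfLine b)

namespace IsSmoothBounded

variable {n : ℕ} {f : (Fin n → ℝ) → ℝ}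

lemma exists_bound (hf : IsSmoothBounded f) : ∃ C, 0 ≤ C ∧ ∀ x, |f x| ≤ C := by
  obtain ⟨C, hC⟩ := hf.2 0
  refine ⟨C, (norm_nonneg _).trans (hC 0), fun x => ?_⟩
  simpa using hC x

lemma exists_bound_fderiv (hf : IsSmoothBounded f) : ∃ C, 0 ≤ C ∧ ∀ x, ‖fderiv ℝ f x‖ ≤ C := by
  obtain ⟨C, hC⟩ := hf.2 1
  refine ⟨C, (norm_nonneg _).trans (hC 0), fun x => ?_⟩
  simpa [norm_iteratedFDeriv_one] using hC x

lemma exists_bound_fderiv_fderiv (hf : IsSmoothBounded f) :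
    ∃ C, 0 ≤ C ∧ ∀ x, ‖fderiv ℝ (fderiv ℝ f) x‖ ≤ C := by
  obtain ⟨C, hC⟩ := hf.2 2
  refine ⟨C, (norm_nonneg _).trans (hC 0), fun x => ?_⟩
  have := hC x
  rwa [← norm_iteratedFDeriv_fderiv, norm_iteratedFDeriv_one] at this

lemma continuous (hf : IsSmoothBounded f) : Continuous f := hf.1.continuous

lemma continuous_fderiv (hf : IsSmoothBounded f) : Continuous (fderiv ℝ f) :=
  hf.1.continuous_fderiv (by simp)

lemma contDiff_fderiv (hf : IsSmoothBounded f) : ContDiff ℝ (⊤ : ℕ∞) (fderiv ℝ f) :=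
  hf.1.fderiv_right (by simp)

lemma continuous_fderiv_fderiv (hf : IsSmoothBounded f) : Continuous (fderiv ℝ (fderiv ℝ f)) :=
  hf.contDiff_fderiv.continuous_fderiv (by simp)

lemma symm (hf : IsSmoothBounded f) (x u v : Fin n → ℝ) :
    fderiv ℝ (fderiv ℝ f) x u v = fderiv ℝ (fderiv ℝ f) x v u := by
  have := hf.1.contDiffAt (x := x) |>.isSymmSndFDerivAt
    (by simp only [minSmoothness_of_isRCLikeNormedField]; exact WithTop.coe_le_coe.2 (le_top : ((2 : ℕ∞) ≤ ⊤)))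
  exact this u v

lemma hasDerivAt_line (hf : IsSmoothBounded f) (x k : Fin n → ℝ) :
    HasDerivAt (fun l : ℝ => f (x + l • k)) (fderiv ℝ f x k) 0 := by
  have h1 : HasFDerivAt f (fderiv ℝ f x) (x + (0 : ℝ) • k) := by
    simpa using (hf.1.differentiable (by simp) x).hasFDerivAt
  have h2 : HasDerivAt (fun l : ℝ => x + l • k) k 0 := by
    simpa using ((hasDerivAt_id (0 : ℝ)).smul_const k).const_add x
  exact h1.comp_hasDerivAt (0 : ℝ) h2

lemma hasDerivAt_line_fderiv (hf : IsSmoothBounded f) (x k j : Fin n → ℝ) :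
    HasDerivAt (fun l : ℝ => fderiv ℝ f (x + l • k) j) (fderiv ℝ (fderiv ℝ f) x k j) 0 := by
  have h1 : HasFDerivAt (fderiv ℝ f) (fderiv ℝ (fderiv ℝ f) x) (x + (0 : ℝ) • k) := by
    simpa using (hf.contDiff_fderiv.differentiable (by simp) x).hasFDerivAt
  have h2 : HasDerivAt (fun l : ℝ => x + l • k) k 0 := by
    simpa using ((hasDerivAt_id (0 : ℝ)).smul_const k).const_add x
  have h3 := h1.comp_hasDerivAt (0 : ℝ) h2
  exact (ContinuousLinearMap.apply ℝ ℝ j).hasFDerivAt.comp_hasDerivAt (0 : ℝ) h3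

end IsSmoothBounded

/-! ### Isometry and duality for functions of finitely many coordinates -/

section StepLevel

variable {Ω : Type*} [MeasurableSpace Ω] {P : Measure Ω} {X : ℝ → Ω → ℝ} {n₁ n₂ : ℕ}

lemma _root_.MeasureTheory.MemLp.integrable_mul_two {f g : Ω → ℝ} (hf : MemLp f 2 P)
    (hg : MemLp g 2 P) : Integrable (fun ω => f ω * g ω) P :=
  hf.integrable_mul hg

/-- A bounded measurable variable times a square integrable one. -/
lemma memLp_bdd_mul {g ξ : Ω → ℝ} (hg : Measurable g) {C : ℝ} (hC : ∀ ω, |g ω| ≤ C)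
    (hξ : MemLp ξ 2 P) : MemLp (fun ω => g ω * ξ ω) 2 P := by
  refine (hξ.const_mul C).mono (hg.aestronglyMeasurable.mul hξ.1) (ae_of_all _ fun ω => ?_)
  simp only [norm_mul, Real.norm_eq_abs]
  exact mul_le_mul_of_nonneg_right ((hC ω).trans (le_abs_self _)) (abs_nonneg _)

lemma memLp_two_of_bdd [IsFiniteMeasure P] {g : Ω → ℝ} (hg : Measurable g) {C : ℝ} (hC : ∀ ω, |g ω| ≤ C) :
    MemLp g 2 P :=
  MemLp.of_bound hg.aestronglyMeasurable C (ae_of_all _ hC)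

/-- The isometry formula for divergences of smooth functions of finitely many coordinates. -/
lemma isometry_step [IsFiniteMeasure P] (hm : ∀ t, Measurable (X t))
    (hG : IsGaussianProcess X P) (h0 : ∀ t, ∫ ω, X t ω ∂P = 0)
    (L₁ : (ℝ → ℝ) →ₗ[ℝ] (Fin n₁ → ℝ)) (L₂ : (ℝ → ℝ) →ₗ[ℝ] (Fin n₂ → ℝ))
    (hL₁ : Measurable L₁) (hL₂ : Measurable L₂)
    {f₁ : (Fin n₁ → ℝ) → ℝ} {f₂ : (Fin n₂ → ℝ) → ℝ}
    (hf₁ : IsSmoothBounded f₁) (hf₂ : IsSmoothBounded f₂) (p₁ q₁ p₂ q₂ : ℝ)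
    {c₁ c₂ : ℝ → ℝ} (hc₁ : ∀ t, c₁ t = ∫ ω, X t ω * (X q₁ ω - X p₁ ω) ∂P)
    (hc₂ : ∀ t, c₂ t = ∫ ω, X t ω * (X q₂ ω - X p₂ ω) ∂P) :
    ∫ ω, (f₁ (L₁ fun t => X t ω) * (X q₁ ω - X p₁ ω) - fderiv ℝ f₁ (L₁ fun t => X t ω) (L₁ c₁)) *
      (f₂ (L₂ fun t => X t ω) * (X q₂ ω - X p₂ ω) - fderiv ℝ f₂ (L₂ fun t => X t ω) (L₂ c₂)) ∂P =
    (∫ ω, f₁ (L₁ fun t => X t ω) * f₂ (L₂ fun t => X t ω) ∂P) * (c₁ q₂ - c₁ p₂) +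
    ∫ ω, fderiv ℝ f₁ (L₁ fun t => X t ω) (L₁ c₂) * fderiv ℝ f₂ (L₂ fun t => X t ω) (L₂ c₁) ∂P := by
  obtain ⟨A₁, hA₁0, hA₁⟩ := hf₁.exists_bound
  obtain ⟨A₂, hA₂0, hA₂⟩ := hf₂.exists_bound
  obtain ⟨B₁, hB₁0, hB₁⟩ := hf₁.exists_bound_fderiv
  obtain ⟨B₂, hB₂0, hB₂⟩ := hf₂.exists_bound_fderiv
  obtain ⟨D₂, hD₂0, hD₂⟩ := hf₂.exists_bound_fderiv_fderiv
  have hXp : Measurable (fun ω t => X t ω) := measurable_pi_lambda _ hm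
  have hX2 : ∀ t, MemLp (X t) 2 P := fun t => (hG.hasGaussianLaw_eval t).memLp_two
  have hξ : ∀ p q, MemLp (fun ω => X q ω - X p ω) 2 P := fun p q => (hX2 q).sub (hX2 p)
  -- measurability on path space
  have mf₁ : Measurable (fun x => f₁ (L₁ x)) := hf₁.continuous.measurable.comp hL₁
  have mf₂ : Measurable (fun x => f₂ (L₂ x)) := hf₂.continuous.measurable.comp hL₂
  have md₁ : ∀ k, Measurable (fun x => fderiv ℝ f₁ (L₁ x) k) := fun k =>
    (hf₁.continuous_fderiv.clm_apply continuous_const).measurable.comp hL₁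
  have md₂ : ∀ k, Measurable (fun x => fderiv ℝ f₂ (L₂ x) k) := fun k =>
    (hf₂.continuous_fderiv.clm_apply continuous_const).measurable.comp hL₂
  have mdd₂ : ∀ k j, Measurable (fun x => fderiv ℝ (fderiv ℝ f₂) (L₂ x) k j) := fun k j =>
    ((hf₂.continuous_fderiv_fderiv.clm_apply continuous_const).clm_apply
      continuous_const).measurable.comp hL₂
  have mξ : ∀ p q, Measurable (fun x : ℝ → ℝ => x q - x p) := fun p q =>
    (measurable_pi_apply q).sub (measurable_pi_apply p)
  have bd₁ : ∀ k x, |fderiv ℝ f₁ (L₁ x) k| ≤ B₁ * ‖k‖ := fun k x =>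
    (ContinuousLinearMap.le_opNorm _ _).trans (mul_le_mul_of_nonneg_right (hB₁ _) (norm_nonneg _))
  have bd₂ : ∀ k x, |fderiv ℝ f₂ (L₂ x) k| ≤ B₂ * ‖k‖ := fun k x =>
    (ContinuousLinearMap.le_opNorm _ _).trans (mul_le_mul_of_nonneg_right (hB₂ _) (norm_nonneg _))
  have bdd₂ : ∀ k j x, |fderiv ℝ (fderiv ℝ f₂) (L₂ x) k j| ≤ D₂ * ‖k‖ * ‖j‖ := fun k j x =>
    (ContinuousLinearMap.le_opNorm₂ _ _ _).trans (mul_le_mul_of_nonneg_right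
      (mul_le_mul_of_nonneg_right (hD₂ _) (norm_nonneg _)) (norm_nonneg _))
  -- square integrability
  have lf₁ : MemLp (fun ω => f₁ (L₁ fun t => X t ω)) 2 P :=
    memLp_two_of_bdd (mf₁.comp hXp) fun ω => hA₁ _
  have ld₁ : ∀ k, MemLp (fun ω => fderiv ℝ f₁ (L₁ fun t => X t ω) k) 2 P := fun k =>
    memLp_two_of_bdd ((md₁ k).comp hXp) fun ω => bd₁ k _
  have ld₂ : ∀ k, MemLp (fun ω => fderiv ℝ f₂ (L₂ fun t => X t ω) k) 2 P := fun k =>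
    memLp_two_of_bdd ((md₂ k).comp hXp) fun ω => bd₂ k _
  have ldd₂ : ∀ k j, MemLp (fun ω => fderiv ℝ (fderiv ℝ f₂) (L₂ fun t => X t ω) k j) 2 P :=
    fun k j => memLp_two_of_bdd ((mdd₂ k j).comp hXp) fun ω => bdd₂ k j _
  have lf₂ : MemLp (fun ω => f₂ (L₂ fun t => X t ω)) 2 P :=
    memLp_two_of_bdd (mf₂.comp hXp) fun ω => hA₂ _
  have lf₁ξ : ∀ p q, MemLp (fun ω => f₁ (L₁ fun t => X t ω) * (X q ω - X p ω)) 2 P :=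
    fun p q => memLp_bdd_mul (mf₁.comp hXp) (fun ω => hA₁ _) (hξ p q)
  have lf₂ξ : ∀ p q, MemLp (fun ω => f₂ (L₂ fun t => X t ω) * (X q ω - X p ω)) 2 P :=
    fun p q => memLp_bdd_mul (mf₂.comp hXp) (fun ω => hA₂ _) (hξ p q)
  have ldδ₂ : ∀ k, MemLp (fun ω => fderiv ℝ f₂ (L₂ fun t => X t ω) k * (X q₂ ω - X p₂ ω)) 2 P :=
    fun k => memLp_bdd_mul ((md₂ k).comp hXp) (fun ω => bd₂ k _) (hξ p₂ q₂)
  have lδ₂ : MemLp (fun ω => f₂ (L₂ fun t => X t ω) * (X q₂ ω - X p₂ ω) -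
      fderiv ℝ f₂ (L₂ fun t => X t ω) (L₂ c₂)) 2 P := (lf₂ξ p₂ q₂).sub (ld₂ _)
  have ldd : MemLp (fun ω => fderiv ℝ f₂ (L₂ fun t => X t ω) (L₂ c₁) * (X q₂ ω - X p₂ ω) +
        f₂ (L₂ fun t => X t ω) * (c₁ q₂ - c₁ p₂) -
        fderiv ℝ (fderiv ℝ f₂) (L₂ fun t => X t ω) (L₂ c₁) (L₂ c₂)) 2 P :=
    ((ldδ₂ _).add (lf₂.mul_const _)).sub (ldd₂ _ _)
  -- first integration by parts
  have I₁ := integral_path_mul_incr hm hG h0 p₁ q₁ hc₁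
    (a := fun x => f₁ (L₁ x) * (f₂ (L₂ x) * (x q₂ - x p₂) - fderiv ℝ f₂ (L₂ x) (L₂ c₂)))
    (b := fun x => fderiv ℝ f₁ (L₁ x) (L₁ c₁) *
        (f₂ (L₂ x) * (x q₂ - x p₂) - fderiv ℝ f₂ (L₂ x) (L₂ c₂)) +
      f₁ (L₁ x) * (fderiv ℝ f₂ (L₂ x) (L₂ c₁) * (x q₂ - x p₂) + f₂ (L₂ x) * (c₁ q₂ - c₁ p₂) -
        fderiv ℝ (fderiv ℝ f₂) (L₂ x) (L₂ c₁) (L₂ c₂)))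
    (mf₁.mul ((mf₂.mul (mξ _ _)).sub (md₂ _)))
    (((md₁ _).mul ((mf₂.mul (mξ _ _)).sub (md₂ _))).add
      (mf₁.mul ((((md₂ _).mul (mξ _ _)).add (mf₂.mul_const _)).sub (mdd₂ _ _))))
    (fun x => by
      have e1 := hf₁.hasDerivAt_line (L₁ x) (L₁ c₁)
      have e2 := hf₂.hasDerivAt_line (L₂ x) (L₂ c₁)
      have e3 := hf₂.hasDerivAt_line_fderiv (L₂ x) (L₂ c₁) (L₂ c₂)
      have e4 : HasDerivAt (fun l : ℝ => (x q₂ + l * c₁ q₂) - (x p₂ + l * c₁ p₂))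
          (c₁ q₂ - c₁ p₂) 0 := by
        have e := ((((hasDerivAt_id (0 : ℝ)).mul_const (c₁ q₂)).const_add (x q₂))).sub
          (((hasDerivAt_id (0 : ℝ)).mul_const (c₁ p₂)).const_add (x p₂))
        rw [one_mul, one_mul] at e
        exact e
      have e5 := e1.mul ((e2.mul e4).sub e3)
      simp only [map_add, map_smul, Pi.add_apply, Pi.smul_apply, smul_eq_mul]
      convert! e5 using 1
      simp)
    (lf₁.integrable_mul_two lδ₂)
    (by
      have := (lf₁ξ p₁ q₁).integrable_mul_two lδ₂
      refine this.congr (ae_of_all _ fun ω => ?_)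
      ring)
    (((ld₁ _).integrable_mul_two lδ₂).add (lf₁.integrable_mul_two ldd))
  -- second integration by parts
  have I₂ := integral_path_mul_incr hm hG h0 p₂ q₂ hc₂
    (a := fun x => f₁ (L₁ x) * fderiv ℝ f₂ (L₂ x) (L₂ c₁))
    (b := fun x => fderiv ℝ f₁ (L₁ x) (L₁ c₂) * fderiv ℝ f₂ (L₂ x) (L₂ c₁) +
      f₁ (L₁ x) * fderiv ℝ (fderiv ℝ f₂) (L₂ x) (L₂ c₂) (L₂ c₁))
    (mf₁.mul (md₂ _)) (((md₁ _).mul (md₂ _)).add (mf₁.mul (mdd₂ _ _)))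
    (fun x => by
      have e1 := hf₁.hasDerivAt_line (L₁ x) (L₁ c₂)
      have e3 := hf₂.hasDerivAt_line_fderiv (L₂ x) (L₂ c₂) (L₂ c₁)
      have e5 := e1.mul e3
      simp only [map_add, map_smul]
      convert! e5 using 1
      simp)
    (lf₁.integrable_mul_two (ld₂ _))
    (by
      have := (lf₁ξ p₂ q₂).integrable_mul_two (ld₂ (L₂ c₁))
      refine this.congr (ae_of_all _ fun ω => ?_)
      ring)
    (((ld₁ _).integrable_mul_two (ld₂ _)).add (lf₁.integrable_mul_two (ldd₂ _ _)))
  rw [integral_add ((ld₁ _).integrable_mul_two lδ₂) (lf₁.integrable_mul_two ldd)] at I₁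
  rw [integral_add ((ld₁ _).integrable_mul_two (ld₂ _)) (lf₁.integrable_mul_two (ldd₂ _ _))] at I₂
  -- The term with the derivative of `f₁` is exactly what the first divergence subtracts. There
  -- remains `f₁` times the derivative of the second divergence in the direction `c₁`.
  have s1 : ∫ ω, (f₁ (L₁ fun t => X t ω) * (X q₁ ω - X p₁ ω) -
        fderiv ℝ f₁ (L₁ fun t => X t ω) (L₁ c₁)) *
      (f₂ (L₂ fun t => X t ω) * (X q₂ ω - X p₂ ω) - fderiv ℝ f₂ (L₂ fun t => X t ω) (L₂ c₂)) ∂P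
      = ∫ ω, f₁ (L₁ fun t => X t ω) *
        (fderiv ℝ f₂ (L₂ fun t => X t ω) (L₂ c₁) * (X q₂ ω - X p₂ ω) +
        f₂ (L₂ fun t => X t ω) * (c₁ q₂ - c₁ p₂) -
        fderiv ℝ (fderiv ℝ f₂) (L₂ fun t => X t ω) (L₂ c₁) (L₂ c₂)) ∂P := by
    rw [← sub_eq_iff_eq_add'] at I₁
    rw [← I₁, ← integral_sub]
    · congr with ω; ring
    · refine ((lf₁ξ p₁ q₁).integrable_mul_two lδ₂).congr (ae_of_all _ fun ω => ?_)
      ring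
    · exact (ld₁ _).integrable_mul_two lδ₂
  have s2 : ∫ ω, f₁ (L₁ fun t => X t ω) *
        (fderiv ℝ f₂ (L₂ fun t => X t ω) (L₂ c₁) * (X q₂ ω - X p₂ ω) +
        f₂ (L₂ fun t => X t ω) * (c₁ q₂ - c₁ p₂) -
        fderiv ℝ (fderiv ℝ f₂) (L₂ fun t => X t ω) (L₂ c₁) (L₂ c₂)) ∂P
      = ∫ ω, f₁ (L₁ fun t => X t ω) * fderiv ℝ f₂ (L₂ fun t => X t ω) (L₂ c₁) *
          (X q₂ ω - X p₂ ω) ∂P +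
        (∫ ω, f₁ (L₁ fun t => X t ω) * f₂ (L₂ fun t => X t ω) ∂P) * (c₁ q₂ - c₁ p₂) -
        ∫ ω, f₁ (L₁ fun t => X t ω) *
          fderiv ℝ (fderiv ℝ f₂) (L₂ fun t => X t ω) (L₂ c₁) (L₂ c₂) ∂P := by
    rw [← integral_mul_const, ← integral_add, ← integral_sub]
    · congr with ω; ring
    · refine Integrable.add ?_ ((lf₁.integrable_mul_two lf₂).mul_const _)
      refine (lf₁.integrable_mul_two (ldδ₂ (L₂ c₁))).congr (ae_of_all _ fun ω => ?_)
      ring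
    · exact lf₁.integrable_mul_two (ldd₂ _ _)
    · refine (lf₁.integrable_mul_two (ldδ₂ (L₂ c₁))).congr (ae_of_all _ fun ω => ?_)
      ring
    · exact (lf₁.integrable_mul_two lf₂).mul_const _
  rw [s1, s2, I₂]
  -- The two second-order terms cancel because the Hessian of `f₂` is symmetric.
  simp only [hf₂.symm _ (L₂ c₁) (L₂ c₂)]
  ring

/-- The duality formula for smooth functions of finitely many coordinates. -/
lemma duality_step [IsFiniteMeasure P] (hm : ∀ t, Measurable (X t))
    (hG : IsGaussianProcess X P) (h0 : ∀ t, ∫ ω, X t ω ∂P = 0)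
    (L₁ : (ℝ → ℝ) →ₗ[ℝ] (Fin n₁ → ℝ)) (L₂ : (ℝ → ℝ) →ₗ[ℝ] (Fin n₂ → ℝ))
    (hL₁ : Measurable L₁) (hL₂ : Measurable L₂)
    {f₁ : (Fin n₁ → ℝ) → ℝ} {f₂ : (Fin n₂ → ℝ) → ℝ}
    (hf₁ : IsSmoothBounded f₁) (hf₂ : IsSmoothBounded f₂) (p q : ℝ)
    {c : ℝ → ℝ} (hc : ∀ t, c t = ∫ ω, X t ω * (X q ω - X p ω) ∂P) :
    ∫ ω, f₁ (L₁ fun t => X t ω) *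
      (f₂ (L₂ fun t => X t ω) * (X q ω - X p ω) - fderiv ℝ f₂ (L₂ fun t => X t ω) (L₂ c)) ∂P =
    ∫ ω, f₂ (L₂ fun t => X t ω) * fderiv ℝ f₁ (L₁ fun t => X t ω) (L₁ c) ∂P := by
  obtain ⟨A₁, hA₁0, hA₁⟩ := hf₁.exists_bound
  obtain ⟨A₂, hA₂0, hA₂⟩ := hf₂.exists_bound
  obtain ⟨B₁, hB₁0, hB₁⟩ := hf₁.exists_bound_fderiv
  obtain ⟨B₂, hB₂0, hB₂⟩ := hf₂.exists_bound_fderiv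
  have hXp : Measurable (fun ω t => X t ω) := measurable_pi_lambda _ hm
  have hX2 : ∀ t, MemLp (X t) 2 P := fun t => (hG.hasGaussianLaw_eval t).memLp_two
  have hξ : MemLp (fun ω => X q ω - X p ω) 2 P := (hX2 q).sub (hX2 p)
  have mf₁ : Measurable (fun x => f₁ (L₁ x)) := hf₁.continuous.measurable.comp hL₁
  have mf₂ : Measurable (fun x => f₂ (L₂ x)) := hf₂.continuous.measurable.comp hL₂
  have md₁ : ∀ k, Measurable (fun x => fderiv ℝ f₁ (L₁ x) k) := fun k =>
    (hf₁.continuous_fderiv.clm_apply continuous_const).measurable.comp hL₁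
  have md₂ : ∀ k, Measurable (fun x => fderiv ℝ f₂ (L₂ x) k) := fun k =>
    (hf₂.continuous_fderiv.clm_apply continuous_const).measurable.comp hL₂
  have bd₁ : ∀ k x, |fderiv ℝ f₁ (L₁ x) k| ≤ B₁ * ‖k‖ := fun k x =>
    (ContinuousLinearMap.le_opNorm _ _).trans (mul_le_mul_of_nonneg_right (hB₁ _) (norm_nonneg _))
  have bd₂ : ∀ k x, |fderiv ℝ f₂ (L₂ x) k| ≤ B₂ * ‖k‖ := fun k x =>
    (ContinuousLinearMap.le_opNorm _ _).trans (mul_le_mul_of_nonneg_right (hB₂ _) (norm_nonneg _))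
  have lf₁ : MemLp (fun ω => f₁ (L₁ fun t => X t ω)) 2 P :=
    memLp_two_of_bdd (mf₁.comp hXp) fun ω => hA₁ _
  have lf₂ : MemLp (fun ω => f₂ (L₂ fun t => X t ω)) 2 P :=
    memLp_two_of_bdd (mf₂.comp hXp) fun ω => hA₂ _
  have ld₁ : ∀ k, MemLp (fun ω => fderiv ℝ f₁ (L₁ fun t => X t ω) k) 2 P := fun k =>
    memLp_two_of_bdd ((md₁ k).comp hXp) fun ω => bd₁ k _
  have ld₂ : ∀ k, MemLp (fun ω => fderiv ℝ f₂ (L₂ fun t => X t ω) k) 2 P := fun k =>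
    memLp_two_of_bdd ((md₂ k).comp hXp) fun ω => bd₂ k _
  have lf₂ξ : MemLp (fun ω => f₂ (L₂ fun t => X t ω) * (X q ω - X p ω)) 2 P :=
    memLp_bdd_mul (mf₂.comp hXp) (fun ω => hA₂ _) hξ
  have I₂ := integral_path_mul_incr hm hG h0 p q hc
    (a := fun x => f₁ (L₁ x) * f₂ (L₂ x))
    (b := fun x => fderiv ℝ f₁ (L₁ x) (L₁ c) * f₂ (L₂ x) + f₁ (L₁ x) * fderiv ℝ f₂ (L₂ x) (L₂ c))
    (mf₁.mul mf₂) (((md₁ _).mul mf₂).add (mf₁.mul (md₂ _)))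
    (fun x => by
      have e5 := (hf₁.hasDerivAt_line (L₁ x) (L₁ c)).mul (hf₂.hasDerivAt_line (L₂ x) (L₂ c))
      simp only [map_add, map_smul]
      convert! e5 using 1
      simp)
    (lf₁.integrable_mul_two lf₂)
    (by
      refine (lf₁.integrable_mul_two lf₂ξ).congr (ae_of_all _ fun ω => ?_)
      ring)
    (((ld₁ _).integrable_mul_two lf₂).add (lf₁.integrable_mul_two (ld₂ _)))
  rw [integral_add ((ld₁ _).integrable_mul_two lf₂) (lf₁.integrable_mul_two (ld₂ _)),
    ← sub_eq_iff_eq_add] at I₂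
  simp only [mul_comm (f₂ _) (fderiv ℝ f₁ _ _)]
  rw [← I₂, ← integral_sub]
  · congr with ω; ring
  · refine (lf₁.integrable_mul_two lf₂ξ).congr (ae_of_all _ fun ω => ?_)
    ring
  · exact lf₁.integrable_mul_two (ld₂ _)

end StepLevel

/-! ### Step functions, Wiener integrals, divergences of cylindrical variables -/

variable {Ω : Type*} [MeasurableSpace Ω] {P : Measure Ω} {T : ℝ} {X B : ℝ → Ω → ℝ}
  {μ : SignedMeasure (ℝ × ℝ)}

/-- The integral of a step function as a linear functional on paths. -/
def StepFun.path (g : StepFun T) : (ℝ → ℝ) →ₗ[ℝ] ℝ where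
  toFun x := ∑ i, g.c i * (x (g.b i) - x (g.a i))
  map_add' x y := by
    rw [← Finset.sum_add_distrib]
    exact Finset.sum_congr rfl fun i _ => by simp; ring
  map_smul' r x := by
    simp only [Pi.smul_apply, smul_eq_mul, RingHom.id_apply, Finset.mul_sum]
    exact Finset.sum_congr rfl fun i _ => by ring

lemma StepFun.path_apply (g : StepFun T) (x : ℝ → ℝ) :
    g.path x = ∑ i, g.c i * (x (g.b i) - x (g.a i)) := rfl

lemma StepFun.measurable_path (g : StepFun T) : Measurable g.path := by
  change Measurable fun x : ℝ → ℝ => ∑ i, g.c i * (x (g.b i) - x (g.a i))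
  fun_prop

lemma StepFun.integral_ae_eq (g : StepFun T) (hBX : ∀ t ∈ Icc 0 T, B t =ᵐ[P] X t) :
    g.integral X =ᵐ[P] fun ω => g.path fun t => B t ω := by
  have h : ∀ᵐ ω ∂P, ∀ i, B (g.a i) ω = X (g.a i) ω ∧ B (g.b i) ω = X (g.b i) ω := by
    rw [ae_all_iff]
    intro i
    filter_upwards [hBX (g.a i) ⟨g.zero_le i, (g.le i).trans (g.le_end i)⟩,
      hBX (g.b i) ⟨(g.zero_le i).trans (g.le i), g.le_end i⟩] with ω h1 h2 using ⟨h1, h2⟩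
  filter_upwards [h] with ω hω
  simp only [StepFun.integral, StepFun.path_apply, hω]

namespace IsCovProcess

variable (hB : IsCovProcess P B μ)

include hB

lemma memLp (t : ℝ) : MemLp (B t) 2 P := (hB.gauss.hasGaussianLaw_eval t).memLp_two

lemma memLp_incr (p q : ℝ) : MemLp (fun ω => B q ω - B p ω) 2 P := (hB.memLp q).sub (hB.memLp p)

lemma memLp_path (g : StepFun T) : MemLp (fun ω => g.path fun t => B t ω) 2 P := by
  simp only [StepFun.path_apply]
  exact memLp_finsetSum _ fun i _ => (hB.memLp_incr _ _).const_mul _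

lemma path_cov (g : StepFun T) (p q : ℝ) {c : ℝ → ℝ}
    (hc : ∀ t, c t = ∫ ω, B t ω * (B q ω - B p ω) ∂P) :
    g.path c = ∫ ω, g.path (fun t => B t ω) * (B q ω - B p ω) ∂P := by
  simp only [StepFun.path_apply, Finset.sum_mul]
  rw [integral_finsetSum]
  · refine Finset.sum_congr rfl fun i _ => ?_
    rw [hc, hc, ← integral_sub, ← integral_const_mul]
    · congr with ω; ring
    · exact (hB.memLp _).integrable_mul_two (hB.memLp_incr _ _)
    · exact (hB.memLp _).integrable_mul_two (hB.memLp_incr _ _)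
  · intro i _
    exact ((hB.memLp_incr _ _).const_mul _).integrable_mul_two (hB.memLp_incr _ _)

end IsCovProcess

/-- Convergence of `E[f_k g]` when `f_k → f` in `L²`. -/
lemma tendsto_integral_mul_of_tendsto_eLpNorm {ι : Type*} {l : Filter ι} {f : ι → Ω → ℝ}
    {f' g : Ω → ℝ}
    (hf : ∀ k, MemLp (f k) 2 P) (hf' : MemLp f' 2 P) (hg : MemLp g 2 P)
    (h : Tendsto (fun k => eLpNorm (f' - f k) 2 P) l (𝓝 0)) :
    Tendsto (fun k => ∫ ω, f k ω * g ω ∂P) l (𝓝 (∫ ω, f' ω * g ω ∂P)) := by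
  refine tendsto_integral_of_L1' _ (hf'.integrable_mul_two hg).1
    (Eventually.of_forall fun k => (hf k).integrable_mul_two hg) ?_
  have hle : ∀ k, eLpNorm ((fun ω => f k ω * g ω) - fun ω => f' ω * g ω) 1 P ≤
      eLpNorm (f' - f k) 2 P * eLpNorm g 2 P := by
    intro k
    have h1 : ((fun ω => f k ω * g ω) - fun ω => f' ω * g ω) = (f k - f') • g := by
      ext ω; simp; ring
    rw [h1, eLpNorm_sub_comm f' (f k)]
    exact eLpNorm_smul_le_mul_eLpNorm hg.1 ((hf k).sub hf').1
  refine tendsto_of_tendsto_of_tendsto_of_le_of_le tendsto_const_nhds ?_ (fun _ => bot_le) hle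
  have := ENNReal.Tendsto.mul_const h (Or.inr hg.2.ne)
  simpa using this

/-- Mean square convergence gives almost sure convergence along a subsequence, which keeps the other
properties. `B` may replace `X`, since a step integral involves finitely many times only. -/
lemma IsWienerIntegral.exists_seq [IsFiniteMeasure P] (hB : IsCovProcess P B μ)
    (hBX : ∀ t ∈ Icc 0 T, B t =ᵐ[P] X t) {φ : ℝ → ℝ} {W : Ω → ℝ}
    (hW : IsWienerIntegral T P X μ φ W) : ∃ g : ℕ → StepFun T,
    (∀ k, MemL μ (φ - (g k).val)) ∧
    Tendsto (fun k => innerH μ (φ - (g k).val) (φ - (g k).val)) atTop (𝓝 0) ∧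
    Tendsto (fun k => eLpNorm (W - fun ω => (g k).path fun t => B t ω) 2 P) atTop (𝓝 0) ∧
    ∀ᵐ ω ∂P, Tendsto (fun k => (g k).path fun t => B t ω) atTop (𝓝 (W ω)) := by
  obtain ⟨hW2, g, h1, h2, h3⟩ := hW
  have h3' : Tendsto (fun k => eLpNorm (W - fun ω => (g k).path fun t => B t ω) 2 P)
      atTop (𝓝 0) := by
    refine h3.congr fun k => eLpNorm_congr_ae ?_
    filter_upwards [(g k).integral_ae_eq hBX] with ω hω
    simp [hω]
  have h4 : TendstoInMeasure P (fun k ω => (g k).path fun t => B t ω) atTop W := by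
    refine tendstoInMeasure_of_tendsto_eLpNorm (p := 2) (by norm_num)
      (fun k => (hB.memLp_path (g k)).1) hW2.1 ?_
    refine h3'.congr fun k => ?_
    rw [eLpNorm_sub_comm]
  obtain ⟨ns, hns, hae⟩ := h4.exists_seq_tendsto_ae
  exact ⟨fun k => g (ns k), fun k => h1 _, h2.comp hns.tendsto_atTop, h3'.comp hns.tendsto_atTop,
    hae⟩

/-- The covariances of the Wiener integrals of `F` with the increment from `p` to `q`. -/
def CylVar.cov (F : CylVar T P X μ) (B : ℝ → Ω → ℝ) (p q : ℝ) (i : Fin F.n) : ℝ :=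
  ∫ ω, F.W i ω * (B q ω - B p ω) ∂P

/-- The derivative of `F` in the direction of the increment from `p` to `q`. -/
def CylVar.dirDeriv (F : CylVar T P X μ) (B : ℝ → Ω → ℝ) (p q : ℝ) (ω : Ω) : ℝ :=
  fderiv ℝ F.f (fun j => F.W j ω) (F.cov B p q)

/-- The bridge from finitely many coordinates to Wiener integrals: both the arguments of `F.f` and
the directions of differentiation are limits of values of the same linear functionals, at the path
and at its covariances with an increment. -/
lemma CylVar.exists_approx [IsFiniteMeasure P] (hB : IsCovProcess P B μ)
    (hBX : ∀ t ∈ Icc 0 T, B t =ᵐ[P] X t) (F : CylVar T P X μ) :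
    ∃ L : ℕ → (ℝ → ℝ) →ₗ[ℝ] (Fin F.n → ℝ), (∀ k, Measurable (L k)) ∧
      (∀ᵐ ω ∂P, Tendsto (fun k => L k fun t => B t ω) atTop (𝓝 fun i => F.W i ω)) ∧
      ∀ (p q : ℝ) (c : ℝ → ℝ), (∀ t, c t = ∫ ω, B t ω * (B q ω - B p ω) ∂P) →
        Tendsto (fun k => L k c) atTop (𝓝 (F.cov B p q)) := by
  choose g h1 h2 h3 h4 using fun i => (F.wiener i).exists_seq hB hBX
  refine ⟨fun k => LinearMap.pi fun i => (g i k).path, fun k => ?_, ?_, fun p q c hc => ?_⟩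
  · exact measurable_pi_lambda _ fun i => (g i k).measurable_path
  · filter_upwards [ae_all_iff.2 h4] with ω hω
    exact tendsto_pi_nhds.2 fun i => hω i
  · refine tendsto_pi_nhds.2 fun i => ?_
    have := tendsto_integral_mul_of_tendsto_eLpNorm (fun k => hB.memLp_path (g i k))
      (F.wiener i).1 (hB.memLp_incr p q) (h3 i)
    refine this.congr fun k => ?_
    exact (hB.path_cov (g i k) p q hc).symm

lemma CylVar.aestronglyMeasurable_W (F : CylVar T P X μ) :
    AEMeasurable (fun ω i => F.W i ω) P :=
  aemeasurable_pi_lambda _ fun i => (F.wiener i).1.1.aemeasurable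

lemma CylVar.aestronglyMeasurable_comp (F : CylVar T P X μ) {g : (Fin F.n → ℝ) → ℝ}
    (hg : Continuous g) : AEStronglyMeasurable (fun ω => g fun i => F.W i ω) P :=
  (hg.measurable.comp_aemeasurable F.aestronglyMeasurable_W).aestronglyMeasurable

lemma CylVar.memLp_val [IsFiniteMeasure P] (F : CylVar T P X μ) : MemLp F.val 2 P := by
  obtain ⟨C, -, hC⟩ := F.smooth.exists_bound
  exact MemLp.of_bound (F.aestronglyMeasurable_comp F.smooth.continuous) C (ae_of_all _ fun _ => hC _)

lemma CylVar.exists_bound_dirDeriv (F : CylVar T P X μ) :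
    ∃ C, 0 ≤ C ∧ ∀ B p q ω, |F.dirDeriv B p q ω| ≤ C * ‖F.cov B p q‖ := by
  obtain ⟨C, hC0, hC⟩ := F.smooth.exists_bound_fderiv
  exact ⟨C, hC0, fun B p q ω => (ContinuousLinearMap.le_opNorm _ _).trans
    (mul_le_mul_of_nonneg_right (hC _) (norm_nonneg _))⟩

lemma CylVar.memLp_dirDeriv [IsFiniteMeasure P] (F : CylVar T P X μ) (p q : ℝ) :
    MemLp (F.dirDeriv B p q) 2 P := by
  obtain ⟨C, -, hC⟩ := F.exists_bound_dirDeriv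
  exact MemLp.of_bound (F.aestronglyMeasurable_comp
    (F.smooth.continuous_fderiv.clm_apply continuous_const)) _ (ae_of_all _ fun ω => hC B p q ω)

/-- The divergence of `F` times the indicator of the interval from `p` to `q`. -/
def CylVar.divergence (F : CylVar T P X μ) (B : ℝ → Ω → ℝ) (p q : ℝ) (ω : Ω) : ℝ :=
  F.val ω * (B q ω - B p ω) - F.dirDeriv B p q ω

lemma CylVar.memLp_divergence [IsFiniteMeasure P] (hB : IsCovProcess P B μ) (F : CylVar T P X μ)
    (p q : ℝ) : MemLp (F.divergence B p q) 2 P := by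
  obtain ⟨C, -, hC⟩ := F.smooth.exists_bound
  refine MemLp.sub ?_ (F.memLp_dirDeriv p q)
  refine ((hB.memLp_incr p q).const_mul C).mono (F.memLp_val.1.mul (hB.memLp_incr p q).1)
    (ae_of_all _ fun ω => ?_)
  simp only [norm_mul, Real.norm_eq_abs]
  exact mul_le_mul_of_nonneg_right ((hC _).trans (le_abs_self _)) (abs_nonneg _)

lemma tendsto_fderiv_apply {n : ℕ} {f : (Fin n → ℝ) → ℝ} (hf : IsSmoothBounded f)
    {x k : ℕ → Fin n → ℝ} {x₀ k₀ : Fin n → ℝ} (hx : Tendsto x atTop (𝓝 x₀))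
    (hk : Tendsto k atTop (𝓝 k₀)) :
    Tendsto (fun j => fderiv ℝ f (x j) (k j)) atTop (𝓝 (fderiv ℝ f x₀ k₀)) := by
  have h : Tendsto (fun j => fderiv ℝ f (x j)) atTop (𝓝 (fderiv ℝ f x₀)) :=
    (hf.continuous_fderiv.tendsto x₀).comp hx
  have hc : Continuous fun z : ((Fin n → ℝ) →L[ℝ] ℝ) × (Fin n → ℝ) => z.1 z.2 :=
    continuous_fst.clm_apply continuous_snd
  exact (hc.tendsto (fderiv ℝ f x₀, k₀)).comp (h.prodMk_nhds hk)

lemma exists_norm_bound_of_tendsto {E : Type*} [SeminormedAddCommGroup E] {x : ℕ → E} {x₀ : E}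
    (hx : Tendsto x atTop (𝓝 x₀)) : ∃ C, 0 ≤ C ∧ ∀ k, ‖x k‖ ≤ C := by
  obtain ⟨C, hC⟩ := (Metric.isBounded_range_of_tendsto x hx).exists_norm_le
  exact ⟨C, (norm_nonneg _).trans (hC _ ⟨0, rfl⟩), fun k => hC _ ⟨k, rfl⟩⟩

/-- Passage to the limit in `isometry_step`. Dominated convergence applies since the functions and
their derivatives are bounded and convergent directions are bounded. -/
lemma CylVar.isometry [IsFiniteMeasure P] (hB : IsCovProcess P B μ)
    (hBX : ∀ t ∈ Icc 0 T, B t =ᵐ[P] X t) (F G : CylVar T P X μ) (p₁ q₁ p₂ q₂ : ℝ) :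
    ∫ ω, F.divergence B p₁ q₁ ω * G.divergence B p₂ q₂ ω ∂P =
      (∫ ω, F.val ω * G.val ω ∂P) * (∫ ω, (B q₁ ω - B p₁ ω) * (B q₂ ω - B p₂ ω) ∂P) +
      ∫ ω, F.dirDeriv B p₂ q₂ ω * G.dirDeriv B p₁ q₁ ω ∂P := by
  obtain ⟨L₁, hm₁, hW₁, hc₁⟩ := F.exists_approx hB hBX
  obtain ⟨L₂, hm₂, hW₂, hc₂⟩ := G.exists_approx hB hBX
  obtain ⟨A₁, hA₁0, hA₁⟩ := F.smooth.exists_bound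
  obtain ⟨A₂, hA₂0, hA₂⟩ := G.smooth.exists_bound
  obtain ⟨D₁, hD₁0, hD₁⟩ := F.smooth.exists_bound_fderiv
  obtain ⟨D₂, hD₂0, hD₂⟩ := G.smooth.exists_bound_fderiv
  set c₁ : ℝ → ℝ := fun t => ∫ ω, B t ω * (B q₁ ω - B p₁ ω) ∂P with hc₁'
  set c₂ : ℝ → ℝ := fun t => ∫ ω, B t ω * (B q₂ ω - B p₂ ω) ∂P with hc₂'
  have t11 := hc₁ p₁ q₁ c₁ fun _ => rfl
  have t12 := hc₁ p₂ q₂ c₂ fun _ => rfl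
  have t21 := hc₂ p₁ q₁ c₁ fun _ => rfl
  have t22 := hc₂ p₂ q₂ c₂ fun _ => rfl
  have key : ∀ k, _ := fun k => isometry_step hB.meas hB.gauss hB.zero_mean (L₁ k) (L₂ k)
    (hm₁ k) (hm₂ k) F.smooth G.smooth p₁ q₁ p₂ q₂ (c₁ := c₁) (c₂ := c₂) (fun _ => rfl) fun _ => rfl
  have hXp : Measurable (fun ω t => B t ω) := measurable_pi_lambda _ hB.meas
  have hcq : c₁ q₂ - c₁ p₂ = ∫ ω, (B q₁ ω - B p₁ ω) * (B q₂ ω - B p₂ ω) ∂P := by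
    rw [hc₁', ← integral_sub]
    · congr with ω; ring
    · exact (hB.memLp _).integrable_mul_two (hB.memLp_incr _ _)
    · exact (hB.memLp _).integrable_mul_two (hB.memLp_incr _ _)
  rw [← hcq]
  obtain ⟨K11, hK110, hK11⟩ := exists_norm_bound_of_tendsto t11
  obtain ⟨K12, hK120, hK12⟩ := exists_norm_bound_of_tendsto t12
  obtain ⟨K21, hK210, hK21⟩ := exists_norm_bound_of_tendsto t21
  obtain ⟨K22, hK220, hK22⟩ := exists_norm_bound_of_tendsto t22
  have mf₁ : ∀ k, Measurable (fun ω => F.f (L₁ k fun t => B t ω)) := fun k =>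
    F.smooth.continuous.measurable.comp ((hm₁ k).comp hXp)
  have mf₂ : ∀ k, Measurable (fun ω => G.f (L₂ k fun t => B t ω)) := fun k =>
    G.smooth.continuous.measurable.comp ((hm₂ k).comp hXp)
  have md₁ : ∀ k c, Measurable (fun ω => fderiv ℝ F.f (L₁ k fun t => B t ω) c) := fun k c =>
    (F.smooth.continuous_fderiv.clm_apply continuous_const).measurable.comp ((hm₁ k).comp hXp)
  have md₂ : ∀ k c, Measurable (fun ω => fderiv ℝ G.f (L₂ k fun t => B t ω) c) := fun k c =>
    (G.smooth.continuous_fderiv.clm_apply continuous_const).measurable.comp ((hm₂ k).comp hXp)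
  have mξ : ∀ p q, Measurable (fun ω => B q ω - B p ω) := fun p q => (hB.meas q).sub (hB.meas p)
  have bd : ∀ {n : ℕ} (A : (Fin n → ℝ) →L[ℝ] ℝ) (x : Fin n → ℝ) {D K : ℝ}, ‖A‖ ≤ D → ‖x‖ ≤ K →
      |A x| ≤ D * K := fun A x D K hA hx =>
    (ContinuousLinearMap.le_opNorm _ _).trans (mul_le_mul hA hx (norm_nonneg _)
      ((norm_nonneg _).trans hA))
  -- The left side of the formula at level `k` is computed as a limit in two ways: directly, and
  -- after rewriting it by `key`.
  refine tendsto_nhds_unique (f := fun k => ∫ ω,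
    (F.f (L₁ k fun t => B t ω) * (B q₁ ω - B p₁ ω) -
        fderiv ℝ F.f (L₁ k fun t => B t ω) (L₁ k c₁)) *
      (G.f (L₂ k fun t => B t ω) * (B q₂ ω - B p₂ ω) -
        fderiv ℝ G.f (L₂ k fun t => B t ω) (L₂ k c₂)) ∂P) (l := atTop) ?_ ?_
  · refine tendsto_integral_of_dominated_convergence
      (fun ω => (A₁ * |B q₁ ω - B p₁ ω| + D₁ * K11) * (A₂ * |B q₂ ω - B p₂ ω| + D₂ * K22))
      (fun k => ?_) ?_ (fun k => ae_of_all _ fun ω => ?_) ?_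
    · exact ((((mf₁ k).mul (mξ _ _)).sub (md₁ k _)).mul
        (((mf₂ k).mul (mξ _ _)).sub (md₂ k _))).aestronglyMeasurable
    · exact MemLp.integrable_mul_two
        (((hB.memLp_incr _ _).abs.const_mul _).add (memLp_const _))
        (((hB.memLp_incr _ _).abs.const_mul _).add (memLp_const _))
    · rw [norm_mul]
      refine mul_le_mul ((norm_sub_le _ _).trans (add_le_add ?_ ?_))
        ((norm_sub_le _ _).trans (add_le_add ?_ ?_)) (norm_nonneg _) (by positivity)
      · rw [norm_mul]; exact mul_le_mul_of_nonneg_right (hA₁ _) (abs_nonneg _)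
      · exact bd _ _ (hD₁ _) (hK11 k)
      · rw [norm_mul]; exact mul_le_mul_of_nonneg_right (hA₂ _) (abs_nonneg _)
      · exact bd _ _ (hD₂ _) (hK22 k)
    · filter_upwards [hW₁, hW₂] with ω h1 h2
      refine Tendsto.mul (Tendsto.sub (Tendsto.mul ?_ tendsto_const_nhds) ?_)
        (Tendsto.sub (Tendsto.mul ?_ tendsto_const_nhds) ?_)
      · exact (F.smooth.continuous.tendsto _).comp h1
      · exact tendsto_fderiv_apply F.smooth h1 t11
      · exact (G.smooth.continuous.tendsto _).comp h2
      · exact tendsto_fderiv_apply G.smooth h2 t22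
  · simp_rw [key]
    refine Tendsto.add (Tendsto.mul_const _ ?_) ?_
    · refine tendsto_integral_of_dominated_convergence (fun ω => A₁ * A₂)
        (fun k => ((mf₁ k).mul (mf₂ k)).aestronglyMeasurable) (integrable_const _)
        (fun k => ae_of_all _ fun ω => ?_) ?_
      · rw [norm_mul]; exact mul_le_mul (hA₁ _) (hA₂ _) (norm_nonneg _) hA₁0
      · filter_upwards [hW₁, hW₂] with ω h1 h2
        exact ((F.smooth.continuous.tendsto _).comp h1).mul ((G.smooth.continuous.tendsto _).comp h2)
    · refine tendsto_integral_of_dominated_convergence (fun ω => (D₁ * K12) * (D₂ * K21))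
        (fun k => ((md₁ k _).mul (md₂ k _)).aestronglyMeasurable) (integrable_const _)
        (fun k => ae_of_all _ fun ω => ?_) ?_
      · rw [norm_mul]
        exact mul_le_mul (bd _ _ (hD₁ _) (hK12 k)) (bd _ _ (hD₂ _) (hK21 k)) (norm_nonneg _)
          (by positivity)
      · filter_upwards [hW₁, hW₂] with ω h1 h2
        exact (tendsto_fderiv_apply F.smooth h1 t12).mul (tendsto_fderiv_apply G.smooth h2 t21)

/-- The limit of `duality_step`, by the same domination as for the isometry. -/
lemma CylVar.duality [IsFiniteMeasure P] (hB : IsCovProcess P B μ)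
    (hBX : ∀ t ∈ Icc 0 T, B t =ᵐ[P] X t) (F G : CylVar T P X μ) (p q : ℝ) :
    ∫ ω, F.val ω * G.divergence B p q ω ∂P = ∫ ω, G.val ω * F.dirDeriv B p q ω ∂P := by
  obtain ⟨L₁, hm₁, hW₁, hc₁⟩ := F.exists_approx hB hBX
  obtain ⟨L₂, hm₂, hW₂, hc₂⟩ := G.exists_approx hB hBX
  obtain ⟨A₁, hA₁0, hA₁⟩ := F.smooth.exists_bound
  obtain ⟨A₂, hA₂0, hA₂⟩ := G.smooth.exists_bound
  obtain ⟨D₁, hD₁0, hD₁⟩ := F.smooth.exists_bound_fderiv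
  obtain ⟨D₂, hD₂0, hD₂⟩ := G.smooth.exists_bound_fderiv
  set c : ℝ → ℝ := fun t => ∫ ω, B t ω * (B q ω - B p ω) ∂P with hc'
  have t1 := hc₁ p q c fun _ => rfl
  have t2 := hc₂ p q c fun _ => rfl
  have key : ∀ k, _ := fun k => duality_step hB.meas hB.gauss hB.zero_mean (L₁ k) (L₂ k)
    (hm₁ k) (hm₂ k) F.smooth G.smooth p q (c := c) (fun _ => rfl)
  have hXp : Measurable (fun ω t => B t ω) := measurable_pi_lambda _ hB.meas
  obtain ⟨K1, hK10, hK1⟩ := exists_norm_bound_of_tendsto t1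
  obtain ⟨K2, hK20, hK2⟩ := exists_norm_bound_of_tendsto t2
  have mf₁ : ∀ k, Measurable (fun ω => F.f (L₁ k fun t => B t ω)) := fun k =>
    F.smooth.continuous.measurable.comp ((hm₁ k).comp hXp)
  have mf₂ : ∀ k, Measurable (fun ω => G.f (L₂ k fun t => B t ω)) := fun k =>
    G.smooth.continuous.measurable.comp ((hm₂ k).comp hXp)
  have md₁ : ∀ k c, Measurable (fun ω => fderiv ℝ F.f (L₁ k fun t => B t ω) c) := fun k c =>
    (F.smooth.continuous_fderiv.clm_apply continuous_const).measurable.comp ((hm₁ k).comp hXp)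
  have md₂ : ∀ k c, Measurable (fun ω => fderiv ℝ G.f (L₂ k fun t => B t ω) c) := fun k c =>
    (G.smooth.continuous_fderiv.clm_apply continuous_const).measurable.comp ((hm₂ k).comp hXp)
  have mξ : Measurable (fun ω => B q ω - B p ω) := (hB.meas q).sub (hB.meas p)
  have bd : ∀ {n : ℕ} (A : (Fin n → ℝ) →L[ℝ] ℝ) (x : Fin n → ℝ) {D K : ℝ}, ‖A‖ ≤ D → ‖x‖ ≤ K →
      |A x| ≤ D * K := fun A x D K hA hx =>
    (ContinuousLinearMap.le_opNorm _ _).trans (mul_le_mul hA hx (norm_nonneg _)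
      ((norm_nonneg _).trans hA))
  refine tendsto_nhds_unique (f := fun k => ∫ ω, F.f (L₁ k fun t => B t ω) *
      (G.f (L₂ k fun t => B t ω) * (B q ω - B p ω) -
        fderiv ℝ G.f (L₂ k fun t => B t ω) (L₂ k c)) ∂P) (l := atTop) ?_ ?_
  · refine tendsto_integral_of_dominated_convergence
      (fun ω => A₁ * (A₂ * |B q ω - B p ω| + D₂ * K2))
      (fun k => ?_) ?_ (fun k => ae_of_all _ fun ω => ?_) ?_
    · exact ((mf₁ k).mul (((mf₂ k).mul mξ).sub (md₂ k _))).aestronglyMeasurable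
    · exact (MemLp.integrable one_le_two
        (((hB.memLp_incr _ _).abs.const_mul _).add (memLp_const _))).const_mul _
    · rw [norm_mul]
      refine mul_le_mul (hA₁ _) ((norm_sub_le _ _).trans (add_le_add ?_ ?_)) (norm_nonneg _) hA₁0
      · rw [norm_mul]; exact mul_le_mul_of_nonneg_right (hA₂ _) (abs_nonneg _)
      · exact bd _ _ (hD₂ _) (hK2 k)
    · filter_upwards [hW₁, hW₂] with ω h1 h2
      refine Tendsto.mul ?_ (Tendsto.sub (Tendsto.mul ?_ tendsto_const_nhds) ?_)
      · exact (F.smooth.continuous.tendsto _).comp h1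
      · exact (G.smooth.continuous.tendsto _).comp h2
      · exact tendsto_fderiv_apply G.smooth h2 t2
  · simp_rw [key]
    refine tendsto_integral_of_dominated_convergence (fun ω => A₂ * (D₁ * K1))
      (fun k => ((mf₂ k).mul (md₁ k _)).aestronglyMeasurable) (integrable_const _)
      (fun k => ae_of_all _ fun ω => ?_) ?_
    · rw [norm_mul]
      exact mul_le_mul (hA₂ _) (bd _ _ (hD₁ _) (hK1 k)) (norm_nonneg _) hA₂0
    · filter_upwards [hW₁, hW₂] with ω h1 h2
      exact ((G.smooth.continuous.tendsto _).comp h2).mul (tendsto_fderiv_apply F.smooth h1 t1)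

/-! ### Bounded measurable functions -/

/-- Bounded measurable functions. -/
def IsBM (ψ : ℝ → ℝ) : Prop := Measurable ψ ∧ ∃ C, ∀ x, |ψ x| ≤ C

namespace IsBM

variable {ψ χ : ℝ → ℝ}

lemma add (hψ : IsBM ψ) (hχ : IsBM χ) : IsBM (fun x => ψ x + χ x) := by
  obtain ⟨h1, C, h2⟩ := hψ
  obtain ⟨h3, D, h4⟩ := hχ
  exact ⟨h1.add h3, C + D, fun x => (abs_add_le _ _).trans (add_le_add (h2 x) (h4 x))⟩

lemma const_mul (hψ : IsBM ψ) (c : ℝ) : IsBM (fun x => c * ψ x) := by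
  obtain ⟨h1, C, h2⟩ := hψ
  refine ⟨h1.const_mul c, |c| * C, fun x => ?_⟩
  rw [abs_mul]
  exact mul_le_mul_of_nonneg_left (h2 x) (abs_nonneg _)

lemma sub (hψ : IsBM ψ) (hχ : IsBM χ) : IsBM (fun x => ψ x - χ x) := by
  simpa [sub_eq_add_neg] using hψ.add (hχ.const_mul (-1))

lemma mul (hψ : IsBM ψ) (hχ : IsBM χ) : IsBM (fun x => ψ x * χ x) := by
  obtain ⟨h1, C, h2⟩ := hψ
  obtain ⟨h3, D, h4⟩ := hχ
  refine ⟨h1.mul h3, C * D, fun x => ?_⟩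
  rw [abs_mul]
  exact mul_le_mul (h2 x) (h4 x) (abs_nonneg _) ((abs_nonneg _).trans (h2 x))

lemma zero : IsBM (fun _ => 0) := ⟨measurable_const, 0, by simp⟩

lemma sum {ι : Type*} (s : Finset ι) {f : ι → ℝ → ℝ} (hf : ∀ i ∈ s, IsBM (f i)) :
    IsBM (fun x => ∑ i ∈ s, f i x) := by
  classical
  induction s using Finset.induction_on with
  | empty => simpa using zero
  | insert a s ha ih =>
    simp only [Finset.sum_insert ha]
    exact (hf a (by simp)).add (ih fun i hi => hf i (by simp [hi]))

end IsBM

lemma halfLine_eq (b x : ℝ) : halfLine b x = if x ≤ b then 1 else 0 := by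
  simp [halfLine, indicator_apply]

lemma isBM_indicator {s : Set ℝ} (hs : MeasurableSet s) : IsBM (s.indicator 1) :=
  ⟨measurable_one.indicator hs, 1, fun x => by by_cases h : x ∈ s <;> simp [h]⟩

lemma isBM_halfLine (b : ℝ) : IsBM (halfLine b) := isBM_indicator measurableSet_Iic

lemma isBM_incrFun (p q : ℝ) : IsBM (incrFun p q) := (isBM_halfLine q).sub (isBM_halfLine p)

lemma abs_incrFun_le (p q x : ℝ) : |incrFun p q x| ≤ 1 := by
  simp only [incrFun, halfLine_eq]
  split_ifs <;> simp

/-! ### Algebra and limits of the bilinear form -/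

section Bil

variable {μ : SignedMeasure (ℝ × ℝ)} {ψ ψ' χ χ' : ℝ → ℝ}

lemma integrable_mul_of_bound {E : Type*} [MeasurableSpace E] {m : Measure E} [IsFiniteMeasure m]
    {f : E → ℝ} (hf : Measurable f) {C : ℝ} (hC : ∀ x, |f x| ≤ C) : Integrable f m :=
  Integrable.of_bound hf.aestronglyMeasurable C (ae_of_all _ hC)

lemma IsBM.integrable (hψ : IsBM ψ) (hχ : IsBM χ) :
    Integrable (fun p : ℝ × ℝ => ψ p.1 * χ p.2) μ.totalVariation := by
  obtain ⟨h1, C, h2⟩ := hψ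
  obtain ⟨h3, D, h4⟩ := hχ
  refine integrable_mul_of_bound (C := C * D)
    ((h1.comp measurable_fst).mul (h3.comp measurable_snd)) fun x => ?_
  rw [abs_mul]
  exact mul_le_mul (h2 _) (h4 _) (abs_nonneg _) ((abs_nonneg _).trans (h2 x.1))

lemma _root_.MeasureTheory.Integrable.mul_sgn {f : ℝ × ℝ → ℝ}
    (hf : Integrable f μ.totalVariation) :
    Integrable (fun p => f p * sgn μ p) μ.totalVariation :=
  hf.mul_bdd (c := 1) (measurable_sgn μ).aestronglyMeasurable
      (ae_of_all _ fun x => by simp [abs_sgn])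

lemma bil_add_left (h : Integrable (fun p : ℝ × ℝ => ψ p.1 * χ p.2) μ.totalVariation)
    (h' : Integrable (fun p : ℝ × ℝ => ψ' p.1 * χ p.2) μ.totalVariation) :
    bil μ (fun x => ψ x + ψ' x) χ = bil μ ψ χ + bil μ ψ' χ := by
  unfold bil
  rw [← integral_add h.mul_sgn h'.mul_sgn]
  congr with p; ring

lemma bil_add_right (h : Integrable (fun p : ℝ × ℝ => ψ p.1 * χ p.2) μ.totalVariation)
    (h' : Integrable (fun p : ℝ × ℝ => ψ p.1 * χ' p.2) μ.totalVariation) :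
    bil μ ψ (fun x => χ x + χ' x) = bil μ ψ χ + bil μ ψ χ' := by
  unfold bil
  rw [← integral_add h.mul_sgn h'.mul_sgn]
  congr with p; ring

lemma bil_mul_left (c : ℝ) : bil μ (fun x => c * ψ x) χ = c * bil μ ψ χ := by
  unfold bil
  rw [← integral_const_mul]
  congr with p; ring

lemma bil_mul_right (c : ℝ) : bil μ ψ (fun x => c * χ x) = c * bil μ ψ χ := by
  unfold bil
  rw [← integral_const_mul]
  congr with p; ring

lemma bil_sub_left (h : Integrable (fun p : ℝ × ℝ => ψ p.1 * χ p.2) μ.totalVariation)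
    (h' : Integrable (fun p : ℝ × ℝ => ψ' p.1 * χ p.2) μ.totalVariation) :
    bil μ (fun x => ψ x - ψ' x) χ = bil μ ψ χ - bil μ ψ' χ := by
  unfold bil
  rw [← integral_sub h.mul_sgn h'.mul_sgn]
  congr with p; ring

lemma bil_sub_right (h : Integrable (fun p : ℝ × ℝ => ψ p.1 * χ p.2) μ.totalVariation)
    (h' : Integrable (fun p : ℝ × ℝ => ψ p.1 * χ' p.2) μ.totalVariation) :
    bil μ ψ (fun x => χ x - χ' x) = bil μ ψ χ - bil μ ψ χ' := by
  unfold bil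
  rw [← integral_sub h.mul_sgn h'.mul_sgn]
  congr with p; ring

lemma IsBM.bil_add_left (h : IsBM ψ) (h' : IsBM ψ') (hχ : IsBM χ) :
    bil μ (fun x => ψ x + ψ' x) χ = bil μ ψ χ + bil μ ψ' χ :=
  CovMeasure.bil_add_left (h.integrable hχ) (h'.integrable hχ)

lemma IsBM.bil_add_right (hψ : IsBM ψ) (h : IsBM χ) (h' : IsBM χ') :
    bil μ ψ (fun x => χ x + χ' x) = bil μ ψ χ + bil μ ψ χ' :=
  CovMeasure.bil_add_right (hψ.integrable h) (hψ.integrable h')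

lemma IsBM.bil_sub_left (h : IsBM ψ) (h' : IsBM ψ') (hχ : IsBM χ) :
    bil μ (fun x => ψ x - ψ' x) χ = bil μ ψ χ - bil μ ψ' χ :=
  CovMeasure.bil_sub_left (h.integrable hχ) (h'.integrable hχ)

lemma IsBM.bil_sub_right (hψ : IsBM ψ) (h : IsBM χ) (h' : IsBM χ') :
    bil μ ψ (fun x => χ x - χ' x) = bil μ ψ χ - bil μ ψ χ' :=
  CovMeasure.bil_sub_right (hψ.integrable h) (hψ.integrable h')

lemma bil_zero_left : bil μ (fun _ => 0) χ = 0 := by simp [bil]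

lemma bil_sum_left {ι : Type*} (s : Finset ι) {f : ι → ℝ → ℝ} (c : ι → ℝ)
    (hf : ∀ i ∈ s, Integrable (fun p : ℝ × ℝ => f i p.1 * χ p.2) μ.totalVariation) :
    bil μ (fun x => ∑ i ∈ s, c i * f i x) χ = ∑ i ∈ s, c i * bil μ (f i) χ := by
  unfold bil
  simp_rw [← integral_const_mul]
  rw [← integral_finsetSum _ fun i hi => ((hf i hi).mul_sgn).const_mul _]
  congr with p
  simp only [Finset.sum_mul]
  exact Finset.sum_congr rfl fun i _ => by ring

lemma bil_sum_right {ι : Type*} (s : Finset ι) {f : ι → ℝ → ℝ} (c : ι → ℝ)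
    (hf : ∀ i ∈ s, Integrable (fun p : ℝ × ℝ => ψ p.1 * f i p.2) μ.totalVariation) :
    bil μ ψ (fun x => ∑ i ∈ s, c i * f i x) = ∑ i ∈ s, c i * bil μ ψ (f i) := by
  unfold bil
  simp_rw [← integral_const_mul]
  rw [← integral_finsetSum _ fun i hi => ((hf i hi).mul_sgn).const_mul _]
  congr with p
  simp only [Finset.mul_sum, Finset.sum_mul]
  exact Finset.sum_congr rfl fun i _ => by ring

lemma innerH_eq_bil (h : Integrable (fun p : ℝ × ℝ => ψ p.1 * χ p.2) μ.totalVariation) :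
    innerH μ ψ χ = bil μ ψ χ := vectorIntegral_eq μ h

lemma apply_prod_eq_bil {s t : Set ℝ} (hs : MeasurableSet s) (ht : MeasurableSet t) :
    μ (s ×ˢ t) = bil μ (s.indicator 1) (t.indicator 1) := by
  rw [apply_eq_integral_sgn μ (hs.prod ht), ← integral_indicator (hs.prod ht), bil]
  congr with p
  by_cases h1 : p.1 ∈ s <;> by_cases h2 : p.2 ∈ t <;> simp [h1, h2]

lemma bil_tendsto {ψ' χ' : ℕ → ℝ → ℝ} {C D : ℝ}
    (hψm : ∀ k, Measurable (ψ' k)) (hψC : ∀ k x, |ψ' k x| ≤ C)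
    (hχm : ∀ k, Measurable (χ' k)) (hχD : ∀ k x, |χ' k x| ≤ D)
    (hψ : ∀ᵐ p ∂μ.totalVariation, Tendsto (fun k => ψ' k p.1) atTop (𝓝 (ψ p.1)))
    (hχ : ∀ᵐ p ∂μ.totalVariation, Tendsto (fun k => χ' k p.2) atTop (𝓝 (χ p.2))) :
    Tendsto (fun k => bil μ (ψ' k) (χ' k)) atTop (𝓝 (bil μ ψ χ)) := by
  refine tendsto_integral_of_dominated_convergence (fun _ => C * D) (fun k => ?_)
    (integrable_const _) (fun k => ae_of_all _ fun p => ?_) ?_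
  · exact (((hψm k).comp measurable_fst).mul ((hχm k).comp measurable_snd)).mul
      (measurable_sgn μ) |>.aestronglyMeasurable
  · rw [norm_mul, norm_mul, Real.norm_eq_abs (sgn μ p), abs_sgn, mul_one]
    exact mul_le_mul (hψC k _) (hχD k _) (norm_nonneg _) ((abs_nonneg _).trans (hψC k 0))
  · filter_upwards [hψ, hχ] with p h1 h2
    exact (h1.mul h2).mul tendsto_const_nhds

/-- The symmetric and positivity properties that make `bil μ` an inner product. -/
def IsGood (μ : SignedMeasure (ℝ × ℝ)) (S : Set (ℝ → ℝ)) : Prop :=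
  ∀ ψ ∈ S, ∀ χ ∈ S, bil μ ψ χ = bil μ χ ψ ∧ 0 ≤ bil μ ψ ψ

/-- Both properties survive bounded almost everywhere limits. Convergence is required in each
coordinate separately, since comparing the two marginals of |μ| itself uses the symmetry established
here. -/
lemma IsGood.closure {S S' : Set (ℝ → ℝ)} (h : IsGood μ S)
    (hS : ∀ ψ ∈ S', ∃ (f : ℕ → ℝ → ℝ) (C : ℝ), (∀ k, f k ∈ S) ∧ (∀ k, Measurable (f k)) ∧
      (∀ k x, |f k x| ≤ C) ∧
      (∀ᵐ p ∂μ.totalVariation, Tendsto (fun k => f k p.1) atTop (𝓝 (ψ p.1))) ∧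
      (∀ᵐ p ∂μ.totalVariation, Tendsto (fun k => f k p.2) atTop (𝓝 (ψ p.2)))) :
    IsGood μ S' := by
  intro ψ hψ χ hχ
  obtain ⟨f, C, h1, h2, h3, h4, h5⟩ := hS ψ hψ
  obtain ⟨g, D, j1, j2, j3, j4, j5⟩ := hS χ hχ
  constructor
  · refine tendsto_nhds_unique (bil_tendsto h2 h3 j2 j3 h4 j5) ?_
    refine (bil_tendsto j2 j3 h2 h3 j4 h5).congr fun k => ?_
    exact (h _ (j1 k) _ (h1 k)).1
  · exact ge_of_tendsto' (bil_tendsto h2 h3 h2 h3 h4 h5) fun k => (h _ (h1 k) _ (h1 k)).2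

end Bil

/-! ### The covariance form on bounded functions, and the marginals of |μ| -/

section Cov

variable {Ω : Type*} [MeasurableSpace Ω] {P : Measure Ω} {B : ℝ → Ω → ℝ}
  {μ : SignedMeasure (ℝ × ℝ)}

/-- On combinations of half-lines the form is the second moment of the same combinations of the
process, and second moments are symmetric and positive. -/
lemma IsCovProcess.isGood_span (hB : IsCovProcess P B μ) :
    IsGood μ (Submodule.span ℝ (range halfLine)) := by
  have key : ∀ c d : ℝ →₀ ℝ,
      bil μ (fun x => ∑ i ∈ c.support, c i * halfLine i x)
        (fun x => ∑ i ∈ d.support, d i * halfLine i x) =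
      ∫ ω, (∑ i ∈ c.support, c i * B i ω) * (∑ i ∈ d.support, d i * B i ω) ∂P := by
    intro c d
    rw [bil_sum_left _ _ fun i _ => (isBM_halfLine i).integrable
      (IsBM.sum _ fun j _ => (isBM_halfLine j).const_mul _)]
    simp_rw [Finset.sum_mul]
    rw [integral_finsetSum]
    · refine Finset.sum_congr rfl fun i _ => ?_
      rw [bil_sum_right _ _ fun j _ => (isBM_halfLine i).integrable (isBM_halfLine j)]
      simp_rw [mul_assoc, Finset.mul_sum]
      rw [integral_finsetSum]
      · refine Finset.sum_congr rfl fun j _ => ?_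
        rw [← hB.cov, ← integral_const_mul, ← integral_const_mul]
        congr with ω; ring
      · intro j _
        exact ((hB.memLp i).integrable_mul_two ((hB.memLp j).const_mul _)).const_mul _
    · intro i _
      exact ((hB.memLp i).const_mul _).integrable_mul_two
        (memLp_finsetSum _ fun j _ => (hB.memLp j).const_mul _)
  have rep : ∀ ψ ∈ Submodule.span ℝ (range halfLine),
      ∃ c : ℝ →₀ ℝ, ψ = fun x => ∑ i ∈ c.support, c i * halfLine i x := by
    intro ψ hψ
    obtain ⟨c, rfl⟩ := Finsupp.mem_span_range_iff_exists_finsupp.1 hψ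
    refine ⟨c, ?_⟩
    ext x
    simp [Finsupp.sum]
  intro ψ hψ χ hχ
  obtain ⟨c, rfl⟩ := rep ψ hψ
  obtain ⟨d, rfl⟩ := rep χ hχ
  rw [key, key, key]
  refine ⟨?_, integral_nonneg fun ω => mul_self_nonneg _⟩
  congr with ω; ring

/-- Step approximation of a function on a bounded interval. -/
def stepApprox (g : ℝ → ℝ) (k : ℕ) (x : ℝ) : ℝ :=
  ∑ j ∈ Finset.Ico (-(k : ℤ) ^ 2) ((k : ℤ) ^ 2),
    g (((j + 1 : ℤ) : ℝ) / k) * incrFun ((j : ℝ) / k) (((j + 1 : ℤ) : ℝ) / k) x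

lemma stepApprox_mem (g : ℝ → ℝ) (k : ℕ) :
    stepApprox g k ∈ Submodule.span ℝ (range halfLine) := by
  have : stepApprox g k = ∑ j ∈ Finset.Ico (-(k : ℤ) ^ 2) ((k : ℤ) ^ 2),
      g (((j + 1 : ℤ) : ℝ) / k) •
        (halfLine (((j + 1 : ℤ) : ℝ) / k) - halfLine ((j : ℝ) / k)) := by
    ext x; simp [stepApprox, incrFun]
  rw [this]
  refine Submodule.sum_mem _ fun j _ => Submodule.smul_mem _ _ (Submodule.sub_mem _ ?_ ?_)
  · exact Submodule.subset_span ⟨_, rfl⟩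
  · exact Submodule.subset_span ⟨_, rfl⟩

lemma measurable_stepApprox (g : ℝ → ℝ) (k : ℕ) : Measurable (stepApprox g k) :=
  (IsBM.sum _ fun _ _ => (isBM_incrFun _ _).const_mul _).1

/-- The cells ]j/k, (j+1)/k] are closed on the right, so the cell containing x is found with a
ceiling. -/
lemma incrFun_eq_ite {k : ℕ} (hk : 0 < k) (j : ℤ) (x : ℝ) :
    incrFun ((j : ℝ) / k) (((j + 1 : ℤ) : ℝ) / k) x = if j = ⌈x * k⌉ - 1 then 1 else 0 := by
  have hk' : (0 : ℝ) < k := by exact_mod_cast hk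
  simp only [incrFun, halfLine_eq, le_div_iff₀ hk', ← Int.ceil_le]
  split_ifs <;> first | omega | simp

lemma stepApprox_eq (g : ℝ → ℝ) {k : ℕ} (hk : 0 < k) (x : ℝ) :
    stepApprox g k x = if ⌈x * k⌉ - 1 ∈ Finset.Ico (-(k : ℤ) ^ 2) ((k : ℤ) ^ 2) then
      g ((⌈x * k⌉ : ℝ) / k) else 0 := by
  simp only [stepApprox, incrFun_eq_ite hk, mul_ite, mul_one, mul_zero, Finset.sum_ite_eq']
  simp

lemma abs_stepApprox_le {g : ℝ → ℝ} {C : ℝ} (hC : ∀ x, |g x| ≤ C) (k : ℕ) (x : ℝ) :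
    |stepApprox g k x| ≤ C := by
  have hC0 : 0 ≤ C := (abs_nonneg _).trans (hC 0)
  rcases Nat.eq_zero_or_pos k with rfl | hk
  · simpa [stepApprox] using hC0
  · rw [stepApprox_eq g hk]
    split_ifs
    · exact hC _
    · simpa using hC0

lemma tendsto_stepApprox {g : ℝ → ℝ} (hg : Continuous g) (x : ℝ) :
    Tendsto (fun k => stepApprox g k x) atTop (𝓝 (g x)) := by
  have h1 : Tendsto (fun k : ℕ => (⌈x * (k : ℝ)⌉ : ℝ) / k) atTop (𝓝 x) := by
    have hz : Tendsto (fun k : ℕ => x + 1 / (k : ℝ)) atTop (𝓝 x) := by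
      simpa using (tendsto_const_nhds (x := x)).add (tendsto_one_div_atTop_nhds_zero_nat (𝕜 := ℝ))
    refine tendsto_of_tendsto_of_tendsto_of_le_of_le' tendsto_const_nhds hz ?_ ?_
    all_goals
      filter_upwards [eventually_gt_atTop 0] with k hk
      have hk' : (0 : ℝ) < k := by exact_mod_cast hk
    · rw [le_div_iff₀ hk']; exact Int.le_ceil _
    · rw [div_le_iff₀ hk', add_mul, one_div, inv_mul_cancel₀ hk'.ne']
      exact (Int.ceil_lt_add_one _).le
  have h2 := (hg.tendsto x).comp h1
  refine h2.congr' ?_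
  -- The k-th grid covers ]-k, k]; a margin of one absorbs the rounding of x to the grid.
  obtain ⟨N, hN⟩ := exists_nat_gt (|x| + 1)
  filter_upwards [eventually_ge_atTop N, eventually_gt_atTop 0] with k hk hk0
  have hkx : |x| + 1 < k := hN.trans_le (by exact_mod_cast hk)
  have hk1 : (1 : ℝ) ≤ k := by exact_mod_cast hk0
  rw [stepApprox_eq g hk0, if_pos]
  · rfl
  · have hb := abs_le.1 (le_refl |x|)
    have hxk : |x * k| ≤ (k - 1) * k := by
      rw [abs_mul, Nat.abs_cast]
      exact mul_le_mul_of_nonneg_right (by linarith) (by positivity)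
    have h3 := abs_le.1 hxk
    have h4 := Int.ceil_lt_add_one (x * (k : ℝ))
    have h5 := Int.le_ceil (x * (k : ℝ))
    rw [Finset.mem_Ico]
    constructor
    · have : (-(k : ℝ) ^ 2) ≤ (⌈x * (k : ℝ)⌉ : ℝ) - 1 := by nlinarith
      exact_mod_cast this
    · have : (⌈x * (k : ℝ)⌉ : ℝ) - 1 < (k : ℝ) ^ 2 := by nlinarith
      exact_mod_cast this

/-- Two closures: step functions reach bounded continuous functions pointwise, and these reach
bounded measurable functions almost everywhere. -/
lemma IsCovProcess.isGood (hB : IsCovProcess P B μ) : IsGood μ {ψ | IsBM ψ} := by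
  have hc : IsGood μ {ψ | Continuous ψ ∧ IsBM ψ} := by
    refine hB.isGood_span.closure fun ψ hψ => ?_
    obtain ⟨hψc, hψm, C, hC⟩ := hψ
    exact ⟨stepApprox ψ, C, stepApprox_mem ψ, measurable_stepApprox ψ, abs_stepApprox_le hC,
      ae_of_all _ fun p => tendsto_stepApprox hψc _, ae_of_all _ fun p => tendsto_stepApprox hψc _⟩
  refine hc.closure fun ψ hψ => ?_
  obtain ⟨hψm, C, hC⟩ := hψ
  -- Almost everywhere convergence for the sum of the marginals is convergence in both coordinates
  -- at once.
  set ρ : Measure ℝ := μ.totalVariation.fst + μ.totalVariation.snd with hρ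
  have hψi : Integrable ψ ρ := integrable_mul_of_bound hψm hC
  have hex : ∀ k : ℕ, ∃ g : BoundedContinuousFunction ℝ ℝ,
      ∫⁻ x, ‖ψ x - g x‖ₑ ∂ρ ≤ ((k : ℝ≥0∞) + 1)⁻¹ := fun k => by
    obtain ⟨g, hg, -⟩ := hψi.exists_boundedContinuous_lintegral_sub_le
      (ε := ((k : ℝ≥0∞) + 1)⁻¹) (by simp)
    exact ⟨g, hg⟩
  choose g hg using hex
  have h1 : TendstoInMeasure ρ (fun k x => g k x) atTop ψ := by
    refine tendstoInMeasure_of_tendsto_eLpNorm (p := 1) (by norm_num)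
      (fun k => (g k).continuous.aestronglyMeasurable) hψm.aestronglyMeasurable ?_
    have hz : Tendsto (fun k : ℕ => ((k : ℝ≥0∞) + 1)⁻¹) atTop (𝓝 0) := by
      have := ENNReal.tendsto_inv_nat_nhds_zero.comp (tendsto_add_atTop_nat 1)
      refine this.congr fun k => ?_
      simp
    refine tendsto_of_tendsto_of_tendsto_of_le_of_le tendsto_const_nhds hz (fun _ => bot_le)
      fun k => ?_
    refine le_trans ?_ (hg k)
    rw [eLpNorm_sub_comm, eLpNorm_one_eq_lintegral_enorm]
    rfl
  obtain ⟨ns, -, hns⟩ := h1.exists_seq_tendsto_ae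
  have hC0 : 0 ≤ C := (abs_nonneg _).trans (hC 0)
  -- L¹ approximation loses the uniform bound; clamping to [-C, C] restores it without moving the
  -- limit.
  have hcont : Continuous fun y : ℝ => max (-C) (min C y) := by fun_prop
  have hclamp : ∀ y : ℝ, |max (-C) (min C y)| ≤ C := fun y => by
    rw [abs_le]
    exact ⟨le_max_left _ _, max_le (by linarith) (min_le_left _ _)⟩
  have hlim : ∀ᵐ x ∂ρ, Tendsto (fun k => max (-C) (min C (g (ns k) x))) atTop (𝓝 (ψ x)) := by
    filter_upwards [hns] with x hx
    have h2 := (hcont.tendsto (ψ x)).comp hx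
    have h3 := abs_le.1 (hC x)
    rwa [min_eq_right h3.2, max_eq_right h3.1] at h2
  rw [hρ, ae_add_measure_iff] at hlim
  refine ⟨fun k x => max (-C) (min C (g (ns k) x)), C, fun k => ?_, fun k => ?_,
    fun k x => hclamp _, ?_, ?_⟩
  · have := hcont.comp (g (ns k)).continuous
    exact ⟨this, this.measurable, C, fun x => hclamp _⟩
  · exact (hcont.comp (g (ns k)).continuous).measurable
  · exact ae_of_ae_map measurable_fst.aemeasurable hlim.1
  · exact ae_of_ae_map measurable_snd.aemeasurable hlim.2

variable (hB : IsCovProcess P B μ)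
include hB

lemma IsCovProcess.bil_symm {ψ χ : ℝ → ℝ} (hψ : IsBM ψ) (hχ : IsBM χ) :
    bil μ ψ χ = bil μ χ ψ := (hB.isGood ψ hψ χ hχ).1

lemma IsCovProcess.bil_nonneg {ψ : ℝ → ℝ} (hψ : IsBM ψ) : 0 ≤ bil μ ψ ψ :=
  (hB.isGood ψ hψ ψ hψ).2

/-- The Cauchy-Schwarz inequality for `bil μ`. -/
lemma IsCovProcess.bil_sq_le {ψ χ : ℝ → ℝ} (hψ : IsBM ψ) (hχ : IsBM χ) :
    bil μ ψ χ ^ 2 ≤ bil μ ψ ψ * bil μ χ χ := by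
  have h : ∀ l : ℝ, 0 ≤ bil μ χ χ * (l * l) + 2 * bil μ ψ χ * l + bil μ ψ ψ := by
    intro l
    have hl := hχ.const_mul l
    have h0 := hB.bil_nonneg (hψ.add hl)
    have e1 := hψ.bil_add_left (μ := μ) hl (hψ.add hl)
    have e2 := hψ.bil_add_right (μ := μ) hψ hl
    have e3 := hl.bil_add_right (μ := μ) hψ hl
    have e4 : bil μ (fun x => l * χ x) ψ = l * bil μ χ ψ := bil_mul_left l
    have e5 : bil μ ψ (fun x => l * χ x) = l * bil μ ψ χ := bil_mul_right l
    have e6 : bil μ (fun x => l * χ x) (fun x => l * χ x) = l * bil μ χ (fun x => l * χ x) :=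
      bil_mul_left l
    have e7 : bil μ χ (fun x => l * χ x) = l * bil μ χ χ := bil_mul_right l
    have e8 := hB.bil_symm hχ hψ
    rw [e1, e2, e3, e4, e5, e6, e7, e8] at h0
    linarith
  have := discrim_le_zero h
  rw [discrim] at this
  nlinarith

lemma IsCovProcess.incr_cov (p q r s : ℝ) :
    ∫ ω, (B q ω - B p ω) * (B s ω - B r ω) ∂P = bil μ (incrFun p q) (incrFun r s) := by
  have e : ∀ ω, (B q ω - B p ω) * (B s ω - B r ω) =
      (B q ω * B s ω - B q ω * B r ω) - (B p ω * B s ω - B p ω * B r ω) := fun ω => by ring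
  simp_rw [e]
  have i : ∀ a b, Integrable (fun ω => B a ω * B b ω) P := fun a b =>
    (hB.memLp a).integrable_mul_two (hB.memLp b)
  have i2 : ∀ a b c, Integrable (fun ω => B a ω * B b ω - B a ω * B c ω) P := fun a b c =>
    (i a b).sub (i a c)
  have h := isBM_halfLine
  have e1 := (h q).bil_sub_left (μ := μ) (h p) (isBM_incrFun r s)
  have e2 := (h q).bil_sub_right (μ := μ) (h s) (h r)
  have e3 := (h p).bil_sub_right (μ := μ) (h s) (h r)
  unfold incrFun at e1 ⊢
  rw [integral_sub (i2 _ _ _) (i2 _ _ _), integral_sub (i _ _) (i _ _),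
    integral_sub (i _ _) (i _ _), e1, e2, e3]
  simp only [hB.cov]

/-- Mean square continuity. -/
lemma IsCovProcess.tendsto_bil_incrFun (b : ℝ) {a : ℕ → ℝ} (ha : Tendsto a atTop (𝓝 b)) :
    Tendsto (fun k => bil μ (incrFun (a k) b) (incrFun (a k) b)) atTop (𝓝 0) := by
  have := hB.gauss.isProbabilityMeasure
  set ξ : ℕ → Ω → ℝ := fun k => B b - B (a k) with hξ
  have hG : ∀ k, HasGaussianLaw (ξ k) P := fun k => hB.gauss.hasGaussianLaw_sub
  have hm : ∀ k, Measurable (ξ k) := fun k => (hB.meas b).sub (hB.meas (a k))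
  have h0 : ∀ k, ∫ ω, ξ k ω ∂P = 0 := fun k => by
    simp only [hξ, Pi.sub_apply]
    rw [integral_sub ((hB.memLp _).integrable one_le_two) ((hB.memLp _).integrable one_le_two),
      hB.zero_mean, hB.zero_mean, sub_zero]
  have hvar : ∀ k, Var[ξ k; P] = bil μ (incrFun (a k) b) (incrFun (a k) b) := fun k => by
    rw [variance_eq_sub (hG k).memLp_two, h0, ← hB.incr_cov]
    simp [pow_two, hξ]
  -- For centred Gaussian increments the characteristic function at 1 determines the variance.
  -- Continuity of paths sends it to 1 by dominated convergence, and a logarithm then sends the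
  -- variance to 0.
  have hchar : ∀ k, ‖∫ ω, Complex.exp (ξ k ω * Complex.I) ∂P‖ = Real.exp (-(Var[ξ k; P] / 2)) := by
    intro k
    have h1 := (hG k).charFun_map_eq 1
    have h2 : (fun ω => inner ℝ (1 : ℝ) (ξ k ω)) = ξ k := by ext ω; simp
    rw [h2, charFun_apply, integral_map (hm k).aemeasurable
      (by fun_prop)] at h1
    have h3 : ∀ ω, Complex.exp (((inner ℝ (ξ k ω) (1 : ℝ) : ℝ) : ℂ) * Complex.I) =
        Complex.exp (ξ k ω * Complex.I) := fun ω => by simp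
    simp_rw [h3] at h1
    rw [h1, h0, Complex.norm_exp]
    congr 1
    simp
  have hlim : Tendsto (fun k => ∫ ω, Complex.exp (ξ k ω * Complex.I) ∂P) atTop
      (𝓝 (∫ _, (1 : ℂ) ∂P)) := by
    refine tendsto_integral_of_dominated_convergence (fun _ => 1) (fun k => ?_)
      (integrable_const _) (fun k => ae_of_all _ fun ω => ?_) (ae_of_all _ fun ω => ?_)
    · exact (Measurable.cexp (((Complex.measurable_ofReal.comp (hm k))).mul_const _)).aestronglyMeasurable
    · rw [Complex.norm_exp_ofReal_mul_I]
    · have h1 : Tendsto (fun k => ξ k ω) atTop (𝓝 0) := by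
        have := ((hB.cont ω).tendsto b).comp ha
        have h2 := (tendsto_const_nhds (x := B b ω)).sub this
        simpa [hξ] using! h2
      have h2 : Continuous fun x : ℝ => Complex.exp (x * Complex.I) := by fun_prop
      simpa using! (h2.tendsto 0).comp h1
  have hlim2 := hlim.norm
  simp_rw [hchar] at hlim2
  simp only [integral_const, probReal_univ, one_smul, norm_one] at hlim2
  have hlim3 := (Real.continuousAt_log (one_ne_zero)).tendsto.comp hlim2
  have hlim4 := hlim3.const_mul (-2)
  simp only [Function.comp_def, Real.log_exp, Real.log_one, mul_zero, hvar] at hlim4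
  refine hlim4.congr fun k => by ring

/-- The marginal of the total variation has no atoms. -/
lemma IsCovProcess.marginal_singleton (b : ℝ) : marginal μ {b} = 0 := by
  -- The sign of μ on the line of height b: paired with the indicator of {b}, it returns the whole
  -- mass of |μ| on that line.
  set ψ : ℝ → ℝ := fun u => sgn μ (u, b) with hψ
  have hψm : IsBM ψ := ⟨(measurable_sgn μ).comp (measurable_id.prodMk measurable_const), 1,
    fun x => (abs_sgn μ _).le⟩
  set a : ℕ → ℝ := fun k => b - 1 / ((k : ℝ) + 1) with ha
  have hab : ∀ k, a k < b := fun k => by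
    have : (0 : ℝ) < 1 / ((k : ℝ) + 1) := by positivity
    simp only [ha]; linarith
  have halim : Tendsto a atTop (𝓝 b) := by
    have := (tendsto_const_nhds (x := b)).sub tendsto_one_div_add_atTop_nhds_zero_nat
    simpa only [sub_zero] using this
  have h1 : Tendsto (fun k => bil μ ψ (incrFun (a k) b)) atTop
      (𝓝 (bil μ ψ (({b} : Set ℝ).indicator 1))) := by
    refine bil_tendsto (ψ' := fun _ => ψ) (C := 1) (D := 1) (fun _ => hψm.1)
      (fun _ x => (abs_sgn μ _).le)
      (fun k => (isBM_incrFun _ _).1) (fun k x => abs_incrFun_le _ _ _)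
      (ae_of_all _ fun p => tendsto_const_nhds) (ae_of_all _ fun p => ?_)
    refine tendsto_const_nhds.congr' ?_
    rcases lt_trichotomy p.2 b with h | h | h
    · filter_upwards [halim.eventually (lt_mem_nhds h)] with k hk
      simp [incrFun, halfLine_eq, h.le, hk.le, h.ne]
    · refine Eventually.of_forall fun k => ?_
      simp [incrFun, halfLine_eq, h, not_le.2 (hab k)]
    · refine Eventually.of_forall fun k => ?_
      simp [incrFun, halfLine_eq, not_le.2 h, not_le.2 ((hab k).trans h), h.ne']
  -- Cauchy-Schwarz reduces this to mean square continuity at b.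
  have h2 : Tendsto (fun k => bil μ ψ (incrFun (a k) b)) atTop (𝓝 0) := by
    have h3 := (hB.tendsto_bil_incrFun b halim).const_mul (bil μ ψ ψ)
    rw [mul_zero] at h3
    have h4 : Tendsto (fun k => bil μ ψ (incrFun (a k) b) ^ 2) atTop (𝓝 0) :=
      tendsto_of_tendsto_of_tendsto_of_le_of_le tendsto_const_nhds h3 (fun _ => sq_nonneg _)
        fun k => hB.bil_sq_le hψm (isBM_incrFun _ _)
    have h5 := h4.sqrt
    simp only [Real.sqrt_sq_eq_abs, Real.sqrt_zero] at h5
    exact tendsto_zero_iff_abs_tendsto_zero _ |>.2 h5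
  have h3 := tendsto_nhds_unique h1 h2
  have h4 : bil μ ψ (({b} : Set ℝ).indicator 1) =
      μ.totalVariation.real (Prod.snd ⁻¹' {b}) := by
    rw [bil, ← integral_indicator_one (measurable_snd (measurableSet_singleton b))]
    congr with p
    by_cases h : p.2 = b
    · have hp : p = (p.1, b) := by ext <;> simp [h]
      have : sgn μ p * sgn μ p = 1 := by
        have := abs_sgn μ p
        rw [← abs_mul_abs_self, this, one_mul]
      simp only [hψ, h, mem_singleton_iff, indicator_of_mem, Pi.one_apply, mul_one, mem_preimage]
      rw [← hp, this]
    · simp [h]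
  rw [h4, measureReal_eq_zero_iff] at h3
  rwa [marginal, Measure.snd_apply (measurableSet_singleton b)]

/-- The first marginal of the total variation is absolutely continuous with respect to the
second one. -/
lemma IsCovProcess.fst_absolutelyContinuous : μ.totalVariation.fst ≪ marginal μ := by
  refine Measure.AbsolutelyContinuous.mk fun N hN h0 => ?_
  rw [marginal, Measure.snd_apply hN] at h0
  rw [Measure.fst_apply hN]
  -- Symmetry of the form exchanges A × C with C × A, which lies in the |μ|-null set ℝ × N.
  have hrect : ∀ A C : Set ℝ, MeasurableSet A → MeasurableSet C → A ⊆ N → μ (A ×ˢ C) = 0 := by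
    intro A C hA hC hAN
    rw [apply_prod_eq_bil hA hC, hB.bil_symm (isBM_indicator hA) (isBM_indicator hC),
      ← apply_prod_eq_bil hC hA]
    exact SignedMeasure.null_of_totalVariation_zero _
      (measure_mono_null (fun p hp => hAN hp.2) h0)
  set S : Set (ℝ × ℝ) := Prod.fst ⁻¹' N with hS
  have hSm : MeasurableSet S := measurable_fst hN
  -- The Jordan parts agree on rectangles inside N × ℝ, hence on all of it; being carried by
  -- disjoint sets, both vanish there.
  have heq : μ.toJordanDecomposition.posPart.restrict S =
      μ.toJordanDecomposition.negPart.restrict S := by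
    refine Measure.ext_prod fun {s t} hs ht => ?_
    rw [Measure.restrict_apply (hs.prod ht), Measure.restrict_apply (hs.prod ht)]
    have h1 : (s ×ˢ t) ∩ S = (s ∩ N) ×ˢ t := by
      ext p; simp [hS]; tauto
    rw [h1]
    have h2 := hrect (s ∩ N) t (hs.inter hN) ht inter_subset_right
    rw [μ.apply_eq_posPart_real_sub_negPart_real ((hs.inter hN).prod ht), sub_eq_zero,
      measureReal_eq_measureReal_iff] at h2
    exact h2
  have hH := measurableSet_hahnSet μ
  have hpos : μ.toJordanDecomposition.posPart S = 0 := by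
    have h1 : μ.toJordanDecomposition.posPart S =
        μ.toJordanDecomposition.posPart.restrict S (hahnSet μ) := by
      rw [Measure.restrict_apply hH, inter_comm]
      exact (measure_inter_conull (posPart_compl_hahnSet μ)).symm
    rw [h1, heq]
    exact le_antisymm ((Measure.restrict_apply_le _ _).trans (negPart_hahnSet μ).le) bot_le
  have hneg : μ.toJordanDecomposition.negPart S = 0 := by
    have := congrArg (fun ρ : Measure (ℝ × ℝ) => ρ univ) heq
    simpa [hpos] using this.symm
  simp [SignedMeasure.totalVariation, hpos, hneg]

lemma IsCovProcess.ae_fst {p : ℝ → Prop} (h : ∀ᵐ r ∂marginal μ, p r) :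
    ∀ᵐ z ∂μ.totalVariation, p z.1 :=
  ae_of_ae_map measurable_fst.aemeasurable (hB.fst_absolutelyContinuous.ae_le h)

omit hB in
lemma ae_snd_of_marginal {p : ℝ → Prop} (h : ∀ᵐ r ∂marginal μ, p r) :
    ∀ᵐ z ∂μ.totalVariation, p z.2 :=
  ae_of_ae_map measurable_snd.aemeasurable h

end Cov

/-! ### Cutting functions of `L_μ` down to bounded ones -/

section Trunc

variable {μ : SignedMeasure (ℝ × ℝ)}

/-- Restriction of a function to a set. -/
def cut (E : Set ℝ) (φ : ℝ → ℝ) (x : ℝ) : ℝ := E.indicator 1 x * φ x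

lemma cut_of_mem {E : Set ℝ} {φ : ℝ → ℝ} {x : ℝ} (h : x ∈ E) : cut E φ x = φ x := by
  simp [cut, h]

lemma cut_of_notMem {E : Set ℝ} {φ : ℝ → ℝ} {x : ℝ} (h : x ∉ E) : cut E φ x = 0 := by
  simp [cut, h]

lemma abs_cut_le (E : Set ℝ) (φ : ℝ → ℝ) (x : ℝ) : |cut E φ x| ≤ |φ x| := by
  by_cases h : x ∈ E
  · rw [cut_of_mem h]
  · simp [cut_of_notMem h]

lemma IsBM.cut {φ : ℝ → ℝ} (h : IsBM φ) {E : Set ℝ} (hE : MeasurableSet E) : IsBM (cut E φ) :=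
  (isBM_indicator hE).mul h

lemma isBM_cut {φ : ℝ → ℝ} (hφ : Measurable φ) {E : Set ℝ} (hE : MeasurableSet E) {M : ℝ}
    (h : ∀ x ∈ E, |φ x| ≤ M) : IsBM (cut E φ) := by
  refine ⟨(isBM_indicator hE).1.mul hφ, max M 0, fun x => ?_⟩
  by_cases hx : x ∈ E
  · rw [cut_of_mem hx]; exact (h x hx).trans (le_max_left _ _)
  · simp [cut_of_notMem hx]

lemma tendsto_cut {E : ℕ → Set ℝ} (hE : ∀ x, ∀ᶠ M in atTop, x ∈ E M) (φ : ℝ → ℝ) (x : ℝ) :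
    Tendsto (fun M => cut (E M) φ x) atTop (𝓝 (φ x)) := by
  refine tendsto_const_nhds.congr' ?_
  filter_upwards [hE x] with M hM
  rw [cut_of_mem hM]

lemma MemL.integrable {h : ℝ → ℝ} (hh : MemL μ h) :
    Integrable (fun p : ℝ × ℝ => h p.1 * h p.2) μ.totalVariation := by
  refine ⟨((hh.1.comp measurable_fst).mul (hh.1.comp measurable_snd)).aestronglyMeasurable, ?_⟩
  have := hh.2
  rw [absNormSq] at this
  simpa [HasFiniteIntegral, enorm_mul] using this

/-- The uncut integrand dominates. Inequalities proved for bounded functions, above all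
Cauchy-Schwarz, reach unbounded ones in this way. -/
lemma tendsto_bil_cut {h χ : ℝ → ℝ} (hh : Measurable h) (hχ : Measurable χ)
    (hi : Integrable (fun p : ℝ × ℝ => h p.1 * χ p.2) μ.totalVariation)
    {E : ℕ → Set ℝ} (hEm : ∀ M, MeasurableSet (E M)) (hE : ∀ x, ∀ᶠ M in atTop, x ∈ E M) :
    Tendsto (fun M => bil μ (cut (E M) h) χ) atTop (𝓝 (bil μ h χ)) := by
  refine tendsto_integral_of_dominated_convergence (fun p => ‖h p.1 * χ p.2‖) (fun M => ?_)
    hi.norm (fun M => ae_of_all _ fun p => ?_) (ae_of_all _ fun p => ?_)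
  · exact ((((isBM_indicator (hEm M)).1.mul hh).comp measurable_fst).mul
      (hχ.comp measurable_snd)).mul (measurable_sgn μ) |>.aestronglyMeasurable
  · rw [norm_mul, Real.norm_eq_abs (sgn μ p), abs_sgn, mul_one, norm_mul, norm_mul]
    exact mul_le_mul_of_nonneg_right (abs_cut_le _ _ _) (norm_nonneg _)
  · exact ((tendsto_cut hE h p.1).mul_const _).mul_const _

lemma tendsto_bil_cut_cut {h : ℝ → ℝ} (hh : MemL μ h)
    {E : ℕ → Set ℝ} (hEm : ∀ M, MeasurableSet (E M)) (hE : ∀ x, ∀ᶠ M in atTop, x ∈ E M) :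
    Tendsto (fun M => bil μ (cut (E M) h) (cut (E M) h)) atTop (𝓝 (innerH μ h h)) := by
  rw [innerH_eq_bil hh.integrable]
  refine tendsto_integral_of_dominated_convergence (fun p => ‖h p.1 * h p.2‖) (fun M => ?_)
    hh.integrable.norm (fun M => ae_of_all _ fun p => ?_) (ae_of_all _ fun p => ?_)
  · have hm := (isBM_indicator (hEm M)).1.mul hh.1
    exact ((hm.comp measurable_fst).mul (hm.comp measurable_snd)).mul
      (measurable_sgn μ) |>.aestronglyMeasurable
  · rw [norm_mul, Real.norm_eq_abs (sgn μ p), abs_sgn, mul_one, norm_mul, norm_mul]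
    exact mul_le_mul (abs_cut_le _ _ _) (abs_cut_le _ _ _) (norm_nonneg _) (norm_nonneg _)
  · exact ((tendsto_cut hE h p.1).mul (tendsto_cut hE h p.2)).mul_const _

lemma bil_cut_cut_le {h : ℝ → ℝ} (hh : MemL μ h) (E : Set ℝ) :
    bil μ (cut E h) (cut E h) ≤ ∫ p, |h p.1 * h p.2| ∂μ.totalVariation := by
  refine (le_abs_self _).trans ?_
  rw [bil, ← Real.norm_eq_abs]
  refine (norm_integral_le_integral_norm _).trans ?_
  refine integral_mono_of_nonneg (ae_of_all _ fun p => norm_nonneg _) hh.integrable.abs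
    (ae_of_all _ fun p => ?_)
  simp only
  rw [norm_mul, Real.norm_eq_abs (sgn μ p), abs_sgn, mul_one, norm_mul, abs_mul]
  exact mul_le_mul (abs_cut_le _ _ _) (abs_cut_le _ _ _) (norm_nonneg _) (abs_nonneg _)

lemma abs_bil_le {ψ χ : ℝ → ℝ} {C D : ℝ} (hψ : ∀ x, |ψ x| ≤ C) (hχ : ∀ x, |χ x| ≤ D) :
    |bil μ ψ χ| ≤ C * D * μ.totalVariation.real univ := by
  rw [bil, ← Real.norm_eq_abs]
  refine norm_integral_le_of_norm_le_const (ae_of_all _ fun p => ?_)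
  rw [norm_mul, norm_mul, Real.norm_eq_abs (sgn μ p), abs_sgn, mul_one]
  exact mul_le_mul (hψ _) (hχ _) (norm_nonneg _) ((abs_nonneg _).trans (hψ 0))

end Trunc

/-! ### Pairings of Wiener integrands and cylindrical derivatives with increments -/

section Pairing

variable {Ω : Type*} [MeasurableSpace Ω] {T : ℝ} {P : Measure Ω} {X B : ℝ → Ω → ℝ}
  {μ : SignedMeasure (ℝ × ℝ)}

lemma StepFun.val_eq (g : StepFun T) :
    g.val = fun x => ∑ i, g.c i * incrFun (g.a i) (g.b i) x := by
  ext x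
  refine Finset.sum_congr rfl fun i _ => ?_
  have := g.le i
  simp only [indicator_apply, mem_Ioc, incrFun, halfLine_eq]
  by_cases h1 : x ≤ g.a i
  · simp [h1, h1.trans this, not_lt.2 h1]
  · by_cases h2 : x ≤ g.b i <;> simp [h1, h2, not_le.1 h1]

lemma StepFun.isBM (g : StepFun T) : IsBM g.val := by
  rw [g.val_eq]
  exact IsBM.sum _ fun i _ => (isBM_incrFun _ _).const_mul _

lemma StepFun.bil_val (hB : IsCovProcess P B μ) (g : StepFun T) (p q : ℝ) :
    bil μ g.val (incrFun p q) = ∫ ω, g.path (fun t => B t ω) * (B q ω - B p ω) ∂P := by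
  rw [g.val_eq, bil_sum_left _ _ fun i _ => (isBM_incrFun _ _).integrable (isBM_incrFun _ _)]
  simp only [StepFun.path_apply, Finset.sum_mul]
  rw [integral_finsetSum _ fun i _ =>
    ((hB.memLp_incr _ _).const_mul _).integrable_mul_two (hB.memLp_incr _ _)]
  refine Finset.sum_congr rfl fun i _ => ?_
  rw [← hB.incr_cov, ← integral_const_mul]
  congr with ω; ring

/-- The covariance of a Wiener integral and an increment, as a limit of truncated pairings. -/
lemma IsWienerIntegral.tendsto_bil [IsFiniteMeasure P] (hB : IsCovProcess P B μ)
    (hBX : ∀ t ∈ Icc 0 T, B t =ᵐ[P] X t) {φ : ℝ → ℝ} (hφ : Measurable φ) {W : Ω → ℝ}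
    (hW : IsWienerIntegral T P X μ φ W) (p q : ℝ) {E : ℕ → Set ℝ}
    (hEm : ∀ M, MeasurableSet (E M)) (hE : ∀ x, ∀ᶠ M in atTop, x ∈ E M)
    (hb : ∀ M, ∃ C, ∀ x ∈ E M, |φ x| ≤ C) :
    Tendsto (fun M => bil μ (cut (E M) φ) (incrFun p q)) atTop
      (𝓝 (∫ ω, W ω * (B q ω - B p ω) ∂P)) := by
  obtain ⟨g, h1, h2, h3, -⟩ := hW.exists_seq hB hBX
  have hk := isBM_incrFun p q
  set b : ℝ := bil μ (incrFun p q) (incrFun p q) with hbd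
  have hb0 : 0 ≤ b := hB.bil_nonneg hk
  have hcov : Tendsto (fun k => bil μ (g k).val (incrFun p q)) atTop
      (𝓝 (∫ ω, W ω * (B q ω - B p ω) ∂P)) := by
    simp_rw [StepFun.bil_val hB]
    exact tendsto_integral_mul_of_tendsto_eLpNorm (fun k => hB.memLp_path (g k)) hW.1
      (hB.memLp_incr p q) h3
  have hsm : Tendsto (fun k => √(innerH μ (φ - (g k).val) (φ - (g k).val) * b)) atTop (𝓝 0) := by
    simpa using (h2.mul_const b).sqrt
  rw [Metric.tendsto_atTop]
  intro ε hε
  -- The step function is fixed before the cut level grows. Three errors below ε / 4 arise: the cut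
  -- distance to the step function, the cut of the step function, and the error in its covariance.
  obtain ⟨k, hk1, hk2⟩ := ((Metric.tendsto_nhds.1 hcov (ε / 4) (by positivity)).and
    (hsm.eventually (gt_mem_nhds (show (0 : ℝ) < ε / 4 by positivity)))).exists
  have hl1 := tendsto_bil_cut (μ := μ) (g k).isBM.1 hk.1 ((g k).isBM.integrable hk) hEm hE
  have hl2 := ((tendsto_bil_cut_cut (h1 k) hEm hE).mul_const b).sqrt
  have hev := (Metric.tendsto_nhds.1 hl1 (ε / 4) (by positivity)).and
    (hl2.eventually (gt_mem_nhds hk2))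
  obtain ⟨N, hN⟩ := eventually_atTop.1 hev
  refine ⟨N, fun M hM => ?_⟩
  obtain ⟨j1, j2⟩ := hN M hM
  obtain ⟨C, hC⟩ := hb M
  obtain ⟨-, D, hD⟩ := (g k).isBM
  have c1 : IsBM (cut (E M) φ) := isBM_cut hφ (hEm M) hC
  have c2 : IsBM (cut (E M) (g k).val) := (g k).isBM.cut (hEm M)
  have c3 := c1.bil_sub_left (μ := μ) c2 hk
  have e : (fun x => cut (E M) φ x - cut (E M) (g k).val x) = cut (E M) (φ - (g k).val) := by
    ext x; simp [cut, mul_sub]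
  rw [e] at c3
  -- After the cut both functions are bounded, so Cauchy-Schwarz is available for their difference.
  have c4 := hB.bil_sq_le (e ▸ c1.sub c2) hk
  have c5 := Real.abs_le_sqrt c4
  rw [c3] at c5
  rw [Real.dist_eq] at hk1 j1 ⊢
  have e2 : bil μ (cut (E M) φ) (incrFun p q) - ∫ ω, W ω * (B q ω - B p ω) ∂P =
      (bil μ (cut (E M) φ) (incrFun p q) - bil μ (cut (E M) (g k).val) (incrFun p q)) +
      (bil μ (cut (E M) (g k).val) (incrFun p q) - bil μ (g k).val (incrFun p q)) +
      (bil μ (g k).val (incrFun p q) - ∫ ω, W ω * (B q ω - B p ω) ∂P) := by ring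
  rw [e2]
  refine (abs_add_three _ _ _).trans_lt ?_
  linarith

variable (F : CylVar T P X μ)

/-- The sets where the directions of a cylindrical variable are bounded. -/
def CylVar.level (M : ℕ) : Set ℝ := {x | ∀ i, |F.φ i x| ≤ M}

lemma CylVar.measurableSet_level (M : ℕ) : MeasurableSet (F.level M) := by
  simp only [CylVar.level, ofPred_forall]
  exact MeasurableSet.iInter fun i => measurableSet_le (F.memL i).1.abs measurable_const

lemma CylVar.eventually_mem_level (x : ℝ) : ∀ᶠ M in atTop, x ∈ F.level M := by
  simp only [CylVar.level, mem_ofPred_eq, eventually_all]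
  intro i
  obtain ⟨N, hN⟩ := exists_nat_ge |F.φ i x|
  filter_upwards [eventually_ge_atTop N] with M hM
  exact hN.trans (by exact_mod_cast hM)

lemma CylVar.isBM_cut_level (M : ℕ) (i : Fin F.n) : IsBM (cut (F.level M) (F.φ i)) :=
  isBM_cut (F.memL i).1 (F.measurableSet_level M) (M := M) fun _ hx => hx i

lemma CylVar.tendsto_cov [IsFiniteMeasure P] (hB : IsCovProcess P B μ)
    (hBX : ∀ t ∈ Icc 0 T, B t =ᵐ[P] X t) (p q : ℝ) (i : Fin F.n) :
    Tendsto (fun M => bil μ (cut (F.level M) (F.φ i)) (incrFun p q)) atTop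
      (𝓝 (F.cov B p q i)) :=
  (F.wiener i).tendsto_bil hB hBX (F.memL i).1 p q F.measurableSet_level F.eventually_mem_level
    fun M => ⟨M, fun _ hx => hx i⟩

lemma fderiv_apply_eq_sum {n : ℕ} (L : (Fin n → ℝ) →L[ℝ] ℝ) (v : Fin n → ℝ) :
    L v = ∑ i, L (Pi.single i 1) * v i := by
  conv_lhs => rw [← Finset.univ_sum_single v, map_sum]
  refine Finset.sum_congr rfl fun i _ => ?_
  have : (Pi.single i (v i) : Fin n → ℝ) = v i • Pi.single i (1 : ℝ) := by
    rw [← Pi.single_smul, smul_eq_mul, mul_one]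
  rw [this, map_smul, smul_eq_mul, mul_comm]

lemma CylVar.cut_deriv (E : Set ℝ) (ω : Ω) :
    cut E (F.deriv ω) = fun x => ∑ i, fderiv ℝ F.f (fun j => F.W j ω) (Pi.single i 1) *
      cut E (F.φ i) x := by
  ext x
  simp only [cut, CylVar.deriv, Finset.mul_sum]
  exact Finset.sum_congr rfl fun i _ => by ring

lemma CylVar.measurable_deriv (ω : Ω) : Measurable (F.deriv ω) := by
  unfold CylVar.deriv
  exact Finset.measurable_sum _ fun i _ => (F.memL i).1.const_mul _

lemma CylVar.isBM_cut_deriv (M : ℕ) (ω : Ω) : IsBM (cut (F.level M) (F.deriv ω)) := by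
  rw [F.cut_deriv]
  exact IsBM.sum _ fun i _ => (F.isBM_cut_level M i).const_mul _

lemma CylVar.bil_cut_deriv (M : ℕ) (ω : Ω) {χ : ℝ → ℝ} (hχ : IsBM χ) :
    bil μ (cut (F.level M) (F.deriv ω)) χ =
      fderiv ℝ F.f (fun j => F.W j ω) fun i => bil μ (cut (F.level M) (F.φ i)) χ := by
  rw [F.cut_deriv, bil_sum_left _ _ fun i _ => (F.isBM_cut_level M i).integrable hχ,
    fderiv_apply_eq_sum]

lemma CylVar.tendsto_bil_cut_deriv [IsFiniteMeasure P] (hB : IsCovProcess P B μ)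
    (hBX : ∀ t ∈ Icc 0 T, B t =ᵐ[P] X t) (p q : ℝ) (ω : Ω) :
    Tendsto (fun M => bil μ (cut (F.level M) (F.deriv ω)) (incrFun p q)) atTop
      (𝓝 (F.dirDeriv B p q ω)) := by
  simp_rw [F.bil_cut_deriv _ _ (isBM_incrFun p q)]
  exact ((fderiv ℝ F.f _).continuous.tendsto _).comp
    (tendsto_pi_nhds.2 fun i => F.tendsto_cov hB hBX p q i)

/-- The pairing of a bounded function with an increment is close to the directional derivative of
a cylindrical variable when the function is close to its Malliavin derivative. -/
lemma CylVar.pairing_sq_le [IsFiniteMeasure P] (hB : IsCovProcess P B μ)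
    (hBX : ∀ t ∈ Icc 0 T, B t =ᵐ[P] X t) (p q : ℝ) (ω : Ω) {ζ Z : ℝ → ℝ} (hζ : IsBM ζ)
    (hζZ : ∀ᵐ r ∂marginal μ, ζ r = Z r) (hZ : MemL μ (Z - F.deriv ω)) :
    (bil μ ζ (incrFun p q) - F.dirDeriv B p q ω) ^ 2 ≤
      innerH μ (Z - F.deriv ω) (Z - F.deriv ω) * bil μ (incrFun p q) (incrFun p q) := by
  have hk := isBM_incrFun p q
  -- Equality off a null set of the second marginal serves in both coordinates, by absolute
  -- continuity of the first marginal.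
  have a1 := hB.ae_fst hζZ
  have a2 := ae_snd_of_marginal hζZ
  have hh : MemL μ (ζ - F.deriv ω) := by
    refine ⟨hζ.1.sub (F.measurable_deriv ω), ?_⟩
    refine lt_of_eq_of_lt (lintegral_congr_ae ?_) hZ.2
    filter_upwards [a1, a2] with z h1 h2
    simp [h1, h2]
  have hi : innerH μ (Z - F.deriv ω) (Z - F.deriv ω) =
      innerH μ (ζ - F.deriv ω) (ζ - F.deriv ω) := by
    rw [innerH_eq_bil hh.integrable, innerH_eq_bil hZ.integrable]
    refine integral_congr_ae ?_
    filter_upwards [a1, a2] with z h1 h2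
    simp [h1, h2]
  rw [hi]
  have l1 := (tendsto_bil_cut (μ := μ) hζ.1 hk.1 (hζ.integrable hk) F.measurableSet_level
    F.eventually_mem_level).sub (F.tendsto_bil_cut_deriv hB hBX p q ω)
  have l2 := (tendsto_bil_cut_cut hh F.measurableSet_level F.eventually_mem_level).mul_const
    (bil μ (incrFun p q) (incrFun p q))
  -- Cauchy-Schwarz is applied at each cut level and the cut is then removed from both sides.
  refine le_of_tendsto_of_tendsto' (l1.pow 2) l2 fun M => ?_
  have c1 := hζ.cut (F.measurableSet_level M)
  have c2 := F.isBM_cut_deriv M ω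
  rw [← c1.bil_sub_left (μ := μ) c2 hk]
  have e : (fun x => cut (F.level M) ζ x - cut (F.level M) (F.deriv ω) x) =
      cut (F.level M) (ζ - F.deriv ω) := by
    ext x; simp [cut, mul_sub]
  rw [e]
  exact hB.bil_sq_le (e ▸ c1.sub c2) hk

/-- A uniform bound for the pairing of the truncated derivative with bounded functions. -/
lemma CylVar.exists_bil_cut_deriv_le (hB : IsCovProcess P B μ) :
    ∃ K, 0 ≤ K ∧ ∀ M ω χ, IsBM χ →
      |bil μ (cut (F.level M) (F.deriv ω)) χ| ≤ K * √(bil μ χ χ) := by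
  obtain ⟨C, hC0, hC⟩ := F.smooth.exists_bound_fderiv
  -- The |H|-norms bound the form of every cut of the directions, which makes the constant
  -- independent of the cut level.
  set a : Fin F.n → ℝ := fun i => √(∫ p, |F.φ i p.1 * F.φ i p.2| ∂μ.totalVariation)
  refine ⟨C * ∑ i, a i, mul_nonneg hC0 (Finset.sum_nonneg fun i _ => Real.sqrt_nonneg _),
    fun M ω χ hχ => ?_⟩
  rw [F.bil_cut_deriv M ω hχ]
  rw [← Real.norm_eq_abs]
  refine ((fderiv ℝ F.f fun j => F.W j ω).le_opNorm _).trans ?_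
  rw [mul_assoc]
  refine mul_le_mul (hC _) ?_ (norm_nonneg _) hC0
  have hi : ∀ i, |bil μ (cut (F.level M) (F.φ i)) χ| ≤ a i * √(bil μ χ χ) := fun i => by
    refine (Real.abs_le_sqrt (hB.bil_sq_le (F.isBM_cut_level M i) hχ)).trans ?_
    rw [Real.sqrt_mul' _ (hB.bil_nonneg hχ)]
    exact mul_le_mul_of_nonneg_right (Real.sqrt_le_sqrt (bil_cut_cut_le (F.memL i) _))
      (Real.sqrt_nonneg _)
  rw [Finset.sum_mul]
  refine (pi_norm_le_iff_of_nonneg (Finset.sum_nonneg fun i _ =>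
    mul_nonneg (Real.sqrt_nonneg _) (Real.sqrt_nonneg _))).2 fun i => (hi i).trans ?_
  exact Finset.single_le_sum (f := fun i => a i * √(bil μ χ χ))
    (fun i _ => mul_nonneg (Real.sqrt_nonneg _) (Real.sqrt_nonneg _)) (Finset.mem_univ i)

end Pairing

/-! ### Inner products and limits in L² -/

section LTwo

variable {Ω : Type*} [MeasurableSpace Ω] {P : Measure Ω} {ι : Type*} {l : Filter ι}

lemma inner_toLp {f g : Ω → ℝ} (hf : MemLp f 2 P) (hg : MemLp g 2 P) :
    inner ℝ (hf.toLp f) (hg.toLp g) = ∫ ω, f ω * g ω ∂P := by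
  rw [L2.inner_def]
  refine integral_congr_ae ?_
  filter_upwards [hf.coeFn_toLp, hg.coeFn_toLp] with ω h1 h2
  simp [h1, h2, mul_comm]

lemma tendsto_toLp {f : ι → Ω → ℝ} {f' : Ω → ℝ} (hf : ∀ i, MemLp (f i) 2 P) (hf' : MemLp f' 2 P)
    (h : Tendsto (fun i => eLpNorm (f' - f i) 2 P) l (𝓝 0)) :
    Tendsto (fun i => (hf i).toLp (f i)) l (𝓝 (hf'.toLp f')) := by
  rw [Lp.tendsto_Lp_iff_tendsto_eLpNorm'' f hf f' hf']
  simpa only [eLpNorm_sub_comm] using h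

lemma tendsto_integral_mul {f g : ι → Ω → ℝ} {f' g' : Ω → ℝ} (hf : ∀ i, MemLp (f i) 2 P)
    (hf' : MemLp f' 2 P) (hg : ∀ i, MemLp (g i) 2 P) (hg' : MemLp g' 2 P)
    (h1 : Tendsto (fun i => eLpNorm (f' - f i) 2 P) l (𝓝 0))
    (h2 : Tendsto (fun i => eLpNorm (g' - g i) 2 P) l (𝓝 0)) :
    Tendsto (fun i => ∫ ω, f i ω * g i ω ∂P) l (𝓝 (∫ ω, f' ω * g' ω ∂P)) := by
  have := (tendsto_toLp hf hf' h1).inner (𝕜 := ℝ) (tendsto_toLp hg hg' h2)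
  simpa only [inner_toLp] using this

/-- A family in `L²` whose mutual inner products converge is convergent. -/
lemma exists_tendsto_of_tendsto_integral_mul [l.NeBot] {f : ι → Ω → ℝ}
    (hf : ∀ i, MemLp (f i) 2 P) {L : ℝ}
    (h : Tendsto (fun p : ι × ι => ∫ ω, f p.1 ω * f p.2 ω ∂P) (l ×ˢ l) (𝓝 L)) :
    ∃ g, MemLp g 2 P ∧ Tendsto (fun i => eLpNorm (g - f i) 2 P) l (𝓝 0) := by
  set x : ι → Lp ℝ 2 P := fun i => (hf i).toLp (f i) with hx
  have hd : Tendsto (fun i => ∫ ω, f i ω * f i ω ∂P) l (𝓝 L) :=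
    h.comp (tendsto_id.prodMk tendsto_id)
  -- Expanding the square, the three inner products contribute L - 2L + L = 0.
  have hn : Tendsto (fun p : ι × ι => ‖x p.1 - x p.2‖ ^ 2) (l ×ˢ l) (𝓝 0) := by
    have h1 := ((hd.comp tendsto_fst).sub (h.const_mul 2)).add (hd.comp tendsto_snd)
    rw [show L - 2 * L + L = 0 by ring] at h1
    refine h1.congr fun p => ?_
    rw [norm_sub_sq_real, hx, inner_toLp, ← real_inner_self_eq_norm_sq,
      ← real_inner_self_eq_norm_sq, inner_toLp, inner_toLp]
    rfl
  have hdist : Tendsto (fun p : ι × ι => dist (x p.1) (x p.2)) (l ×ˢ l) (𝓝 0) := by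
    have := hn.sqrt
    simpa [dist_eq_norm, Real.sqrt_sq] using this
  have hc : Cauchy (map x l) := by
    refine ⟨inferInstance, ?_⟩
    rw [Metric.uniformity_eq_comap_nhds_zero, ← tendsto_iff_comap, prod_map_map_eq,
      tendsto_map'_iff]
    exact hdist
  obtain ⟨y, hy⟩ := CompleteSpace.complete hc
  refine ⟨y, Lp.memLp y, ?_⟩
  have h2 : Tendsto x l (𝓝 ((Lp.memLp y).toLp y)) := by rwa [Lp.toLp_coeFn]
  rw [hx, Lp.tendsto_Lp_iff_tendsto_eLpNorm'' f hf _ (Lp.memLp y)] at h2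
  simpa only [eLpNorm_sub_comm] using h2

lemma _root_.ENNReal.rpow_half_tendsto_zero {ι : Type*} {l : Filter ι} {a : ι → ℝ≥0∞}
    (h : Tendsto a l (𝓝 0)) : Tendsto (fun i => a i ^ (1 / 2 : ℝ)) l (𝓝 0) := by
  have := (ENNReal.continuous_rpow_const (y := (1 / 2 : ℝ))).tendsto 0
  rw [ENNReal.zero_rpow_of_pos (by norm_num)] at this
  exact this.comp h

/-- Multiplication by ξ need not be continuous on L², so the relation is passed to the limit almost
surely, along a common subsequence. -/
lemma ae_eq_of_tendsto_eLpNorm {f g h : ℕ → Ω → ℝ} {f' g' h' : Ω → ℝ}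
    (hf : Tendsto (fun i => eLpNorm (f' - f i) 2 P) atTop (𝓝 0))
    (hg : Tendsto (fun i => eLpNorm (g' - g i) 2 P) atTop (𝓝 0))
    (hh : Tendsto (fun i => eLpNorm (h' - h i) 2 P) atTop (𝓝 0))
    (hfm : ∀ i, MemLp (f i) 2 P) (hgm : ∀ i, MemLp (g i) 2 P) (hhm : ∀ i, MemLp (h i) 2 P)
    (hf' : MemLp f' 2 P) (hg' : MemLp g' 2 P) (hh' : MemLp h' 2 P)
    {ξ : Ω → ℝ} (he : ∀ i ω, h i ω = f i ω * ξ ω - g i ω) :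
    h' =ᵐ[P] fun ω => f' ω * ξ ω - g' ω := by
  have key : ∀ {u : ℕ → Ω → ℝ} {u' : Ω → ℝ}, (∀ i, MemLp (u i) 2 P) → MemLp u' 2 P →
      Tendsto (fun i => eLpNorm (u' - u i) 2 P) atTop (𝓝 0) →
      TendstoInMeasure P u atTop u' := fun hu hu' h =>
    tendstoInMeasure_of_tendsto_eLpNorm (p := 2) (by norm_num) (fun i => (hu i).1) hu'.1
      (by simpa only [eLpNorm_sub_comm] using h)
  obtain ⟨n1, m1, h1⟩ := (key hfm hf' hf).exists_seq_tendsto_ae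
  obtain ⟨n2, m2, h2⟩ := ((key hgm hg' hg).comp m1.tendsto_atTop).exists_seq_tendsto_ae
  obtain ⟨n3, m3, h3⟩ := ((key hhm hh' hh).comp
    (m1.tendsto_atTop.comp m2.tendsto_atTop)).exists_seq_tendsto_ae
  filter_upwards [h1, h2, h3] with ω a1 a2 a3
  have b1 := (a1.comp (m2.tendsto_atTop.comp m3.tendsto_atTop))
  have b2 := (a2.comp m3.tendsto_atTop)
  refine tendsto_nhds_unique a3 (((b1.mul_const (ξ ω)).sub b2).congr fun k => ?_)
  simp [he]

end LTwo

/-! ### Directional derivatives and divergences of a single variable -/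

section DirDeriv

variable {Ω : Type*} [MeasurableSpace Ω] {T : ℝ} {P : Measure Ω} {X B : ℝ → Ω → ℝ}
  {μ : SignedMeasure (ℝ × ℝ)}

/-- `θ p q` is the directional derivative of `V` along the increment from `p` to `q`. -/
structure HasDirDeriv (T : ℝ) (P : Measure Ω) (X B : ℝ → Ω → ℝ) (μ : SignedMeasure (ℝ × ℝ))
    (V : Ω → ℝ) (θ : ℝ → ℝ → Ω → ℝ) : Prop where
  memLp : MemLp V 2 P
  memLp_deriv : ∀ p q, MemLp (θ p q) 2 P
  approx : ∃ G : ℕ → CylVar T P X μ,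
    Tendsto (fun k => eLpNorm (V - (G k).val) 2 P) atTop (𝓝 0) ∧
    ∀ p q, Tendsto (fun k => eLpNorm (θ p q - (G k).dirDeriv B p q) 2 P) atTop (𝓝 0)

/-- The divergence of `V` times the indicator of the interval from `p` to `q`. -/
def divg (B : ℝ → Ω → ℝ) (V : Ω → ℝ) (θ : ℝ → ℝ → Ω → ℝ) (p q : ℝ) (ω : Ω) : ℝ :=
  V ω * (B q ω - B p ω) - θ p q ω

variable [IsFiniteMeasure P] (hB : IsCovProcess P B μ) (hBX : ∀ t ∈ Icc 0 T, B t =ᵐ[P] X t)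
  {V V' : Ω → ℝ} {θ θ' : ℝ → ℝ → Ω → ℝ}
include hB hBX

/-- Only pairings of the derivative with increments are used later, and `CylVar.pairing_sq_le`
controls them by the H-distance to the cylindrical derivatives. The version `ζ`, bounded by `R`,
keeps these pairings square integrable. -/
lemma IsMalliavinDeriv.hasDirDeriv {Z ζ : Ω → ℝ → ℝ} (h : IsMalliavinDeriv T P X μ V Z)
    (hζm : ∀ p q, AEStronglyMeasurable (fun ω => bil μ (ζ ω) (incrFun p q)) P) {R : Ω → ℝ}
    (hR : MemLp R 2 P) (hζ : ∀ ω, Measurable (ζ ω)) (hζR : ∀ ω r, |ζ ω r| ≤ R ω)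
    (hζZ : ∀ᵐ ω ∂P, ∀ᵐ r ∂marginal μ, ζ ω r = Z ω r) :
    HasDirDeriv T P X B μ V fun p q ω => bil μ (ζ ω) (incrFun p q) := by
  obtain ⟨hV, -, G, h1, h2, h3⟩ := h
  refine ⟨hV, fun p q => ?_, G, h2, fun p q => ?_⟩
  · refine (hR.mul_const (1 * μ.totalVariation.real univ)).mono (hζm p q) (ae_of_all _ fun ω => ?_)
    rw [Real.norm_eq_abs]
    refine (abs_bil_le (hζR ω) (abs_incrFun_le p q)).trans ?_
    rw [mul_assoc]
    exact le_abs_self _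
  · set b := bil μ (incrFun p q) (incrFun p q) with hb
    have hb0 : 0 ≤ b := hB.bil_nonneg (isBM_incrFun p q)
    have h4 := ENNReal.Tendsto.mul_const (b := ENNReal.ofReal b) h3 (Or.inr ENNReal.ofReal_ne_top)
    rw [zero_mul] at h4
    refine tendsto_of_tendsto_of_tendsto_of_le_of_le tendsto_const_nhds
      (ENNReal.rpow_half_tendsto_zero h4) (fun _ => bot_le) fun k => ?_
    simp only
    rw [eLpNorm_eq_lintegral_rpow_enorm_toReal (by norm_num) (by norm_num)]
    simp only [ENNReal.toReal_ofNat]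
    refine ENNReal.rpow_le_rpow ?_ (by norm_num)
    rw [← lintegral_mul_const' _ _ ENNReal.ofReal_ne_top]
    refine lintegral_mono_ae ?_
    filter_upwards [h1 k, hζZ] with ω hω hω'
    have := (G k).pairing_sq_le hB hBX p q ω ⟨hζ ω, R ω, hζR ω⟩ hω' hω
    rw [← ENNReal.ofReal_mul' hb0, Real.enorm_eq_ofReal_abs,
      ENNReal.ofReal_rpow_of_nonneg (abs_nonneg _) (by norm_num)]
    refine ENNReal.ofReal_le_ofReal ?_
    simpa using this

/-- The isometry makes the cylindrical divergences Cauchy. This yields the square integrability of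
the divergence, which is not evident since V times an increment is only a product of square
integrable variables. -/
lemma HasDirDeriv.exists_tendsto (h : HasDirDeriv T P X B μ V θ) : ∃ G : ℕ → CylVar T P X μ,
    Tendsto (fun k => eLpNorm (V - (G k).val) 2 P) atTop (𝓝 0) ∧
    (∀ p q, Tendsto (fun k => eLpNorm (θ p q - (G k).dirDeriv B p q) 2 P) atTop (𝓝 0)) ∧
    ∀ p q, MemLp (divg B V θ p q) 2 P ∧
      Tendsto (fun k => eLpNorm (divg B V θ p q - (G k).divergence B p q) 2 P) atTop (𝓝 0) := by
  obtain ⟨G, h1, h2⟩ := h.approx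
  refine ⟨G, h1, h2, fun p q => ?_⟩
  have t : Tendsto (fun j : ℕ × ℕ => ∫ ω, (G j.1).divergence B p q ω *
      (G j.2).divergence B p q ω ∂P) (atTop ×ˢ atTop)
      (𝓝 ((∫ ω, V ω * V ω ∂P) * (∫ ω, (B q ω - B p ω) * (B q ω - B p ω) ∂P) +
        ∫ ω, θ p q ω * θ p q ω ∂P)) := by
    simp_rw [CylVar.isometry hB hBX]
    have s1 := h1.comp (tendsto_fst (f := (atTop : Filter ℕ)) (g := (atTop : Filter ℕ)))
    have s2 := h1.comp (tendsto_snd (f := (atTop : Filter ℕ)) (g := (atTop : Filter ℕ)))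
    have s3 := (h2 p q).comp (tendsto_fst (f := (atTop : Filter ℕ)) (g := (atTop : Filter ℕ)))
    have s4 := (h2 p q).comp (tendsto_snd (f := (atTop : Filter ℕ)) (g := (atTop : Filter ℕ)))
    refine ((tendsto_integral_mul (fun j : ℕ × ℕ => (G j.1).memLp_val) h.memLp
      (fun j : ℕ × ℕ => (G j.2).memLp_val) h.memLp s1 s2).mul_const _).add ?_
    exact tendsto_integral_mul (fun j : ℕ × ℕ => (G j.1).memLp_dirDeriv p q) (h.memLp_deriv p q)
      (fun j : ℕ × ℕ => (G j.2).memLp_dirDeriv p q) (h.memLp_deriv p q) s3 s4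
  obtain ⟨D, hD, hDt⟩ := exists_tendsto_of_tendsto_integral_mul
    (fun k => (G k).memLp_divergence hB p q) t
  -- The abstract L² limit is identified with the explicit expression `divg`.
  have he := ae_eq_of_tendsto_eLpNorm h1 (h2 p q) hDt (fun k => (G k).memLp_val)
    (fun k => (G k).memLp_dirDeriv p q) (fun k => (G k).memLp_divergence hB p q)
    h.memLp (h.memLp_deriv p q) hD (ξ := fun ω => B q ω - B p ω) fun k ω => rfl
  refine ⟨hD.ae_eq he, hDt.congr fun k => eLpNorm_congr_ae ?_⟩
  filter_upwards [he] with ω hω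
  simp [hω, divg]

lemma HasDirDeriv.memLp_divg (h : HasDirDeriv T P X B μ V θ) (p q : ℝ) :
    MemLp (divg B V θ p q) 2 P := by
  obtain ⟨G, -, -, h3⟩ := h.exists_tendsto hB hBX
  exact (h3 p q).1

/-- Every term of `CylVar.isometry` is an L² inner product of convergent sequences. -/
lemma HasDirDeriv.isometry (h : HasDirDeriv T P X B μ V θ) (h' : HasDirDeriv T P X B μ V' θ')
    (p q p' q' : ℝ) :
    ∫ ω, divg B V θ p q ω * divg B V' θ' p' q' ω ∂P =
      (∫ ω, V ω * V' ω ∂P) * bil μ (incrFun p q) (incrFun p' q') +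
      ∫ ω, θ p' q' ω * θ' p q ω ∂P := by
  obtain ⟨G, h1, h2, h3⟩ := h.exists_tendsto hB hBX
  obtain ⟨G', h1', h2', h3'⟩ := h'.exists_tendsto hB hBX
  refine tendsto_nhds_unique (tendsto_integral_mul (fun k => (G k).memLp_divergence hB p q)
    (h3 p q).1 (fun k => (G' k).memLp_divergence hB p' q') (h3' p' q').1 (h3 p q).2
    (h3' p' q').2) ?_
  simp_rw [CylVar.isometry hB hBX, hB.incr_cov]
  refine ((tendsto_integral_mul (fun j => (G j).memLp_val) h.memLp
      (fun j => (G' j).memLp_val) h'.memLp h1 h1').mul_const _).add ?_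
  exact tendsto_integral_mul (fun j => (G j).memLp_dirDeriv p' q') (h.memLp_deriv p' q')
      (fun j => (G' j).memLp_dirDeriv p q) (h'.memLp_deriv p q) (h2 p' q') (h2' p q)

lemma HasDirDeriv.duality (h : HasDirDeriv T P X B μ V θ) (F : CylVar T P X μ) (p q : ℝ) :
    ∫ ω, F.val ω * divg B V θ p q ω ∂P = ∫ ω, V ω * F.dirDeriv B p q ω ∂P := by
  obtain ⟨G, h1, h2, h3⟩ := h.exists_tendsto hB hBX
  refine tendsto_nhds_unique (tendsto_integral_mul (fun _ => F.memLp_val) F.memLp_val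
    (fun k => (G k).memLp_divergence hB p q) (h3 p q).1 (by simp) (h3 p q).2) ?_
  simp_rw [CylVar.duality hB hBX]
  exact tendsto_integral_mul (fun j => (G j).memLp_val) h.memLp
    (fun _ => F.memLp_dirDeriv p q) (F.memLp_dirDeriv p q) h1 (by simp)

end DirDeriv

/-! ### Averages over short intervals, and Fubini -/

section Avg

lemma measurable_halfLine_uncurry : Measurable fun z : ℝ × ℝ => halfLine z.1 z.2 := by
  simp only [halfLine_eq]
  exact Measurable.ite (measurableSet_le measurable_snd measurable_fst) measurable_const
    measurable_const

lemma _root_.Measurable.incrFun {α : Type*} [MeasurableSpace α] {p q x : α → ℝ} (hp : Measurable p)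
    (hq : Measurable q) (hx : Measurable x) : Measurable fun a => incrFun (p a) (q a) (x a) :=
  (measurable_halfLine_uncurry.comp (hq.prodMk hx)).sub
    (measurable_halfLine_uncurry.comp (hp.prodMk hx))

lemma _root_.Measurable.integral_right {α β : Type*} [MeasurableSpace α] [MeasurableSpace β]
    {ν : Measure β} [SFinite ν] {f : α → β → ℝ} (hf : Measurable (Function.uncurry f)) :
    Measurable fun a => ∫ b, f a b ∂ν :=
  (hf.stronglyMeasurable.integral_prod_right').measurable

lemma integral_swap_of_bound {α β : Type*} [MeasurableSpace α] [MeasurableSpace β]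
    {ρ : Measure α} {ν : Measure β} [IsFiniteMeasure ρ] [IsFiniteMeasure ν] {f : α → β → ℝ}
    (hf : Measurable (Function.uncurry f)) {C : ℝ} (hC : ∀ a b, |f a b| ≤ C) :
    ∫ a, ∫ b, f a b ∂ν ∂ρ = ∫ b, ∫ a, f a b ∂ρ ∂ν :=
  integral_integral_swap (integrable_mul_of_bound hf fun x => hC x.1 x.2)

/-- The average of `g 1_{[0,T]}` over the interval from `b - ε` to `b`. -/
def avg (T ε : ℝ) (g : ℝ → ℝ) (b : ℝ) : ℝ :=
  ε⁻¹ * ∫ s in Icc 0 T, g s * incrFun s (s + ε) b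

/-- As a function of s, the increment function at b is the indicator of [b - ε, b[ when ε > 0, and
minus the indicator of [b, b - ε[ when ε < 0. The sign matches the oriented integral, so one formula
covers left and right averages. -/
lemma integral_mul_incrFun (T ε : ℝ) (g : ℝ → ℝ) (b : ℝ) :
    ∫ s in Icc 0 T, g s * incrFun s (s + ε) b = ∫ s in (b - ε)..b, (Icc 0 T).indicator g s := by
  rw [← integral_indicator measurableSet_Icc]
  have e : ∀ s, (Icc 0 T).indicator (fun s => g s * incrFun s (s + ε) b) s =
      (Icc 0 T).indicator g s * incrFun s (s + ε) b := fun s => by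
    by_cases h : s ∈ Icc 0 T
    · rw [indicator_of_mem h, indicator_of_mem h]
    · rw [indicator_of_notMem h, indicator_of_notMem h, zero_mul]
  simp_rw [e]
  rcases le_total 0 ε with h | h
  · rw [intervalIntegral.integral_of_le (by linarith), integral_Ioc_eq_integral_Ioo,
      ← integral_Ico_eq_integral_Ioo, ← integral_indicator measurableSet_Ico]
    congr with s
    simp only [incrFun, halfLine_eq, indicator_apply (Ico _ _), mem_Ico]
    by_cases h1 : b ≤ s
    · simp [h1, not_lt.2 h1, show b ≤ s + ε by linarith]
    · by_cases h2 : b ≤ s + ε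
      · simp [h1, h2, not_le.1 h1, show b - ε ≤ s by linarith]
      · simp [h1, h2]
  · rw [intervalIntegral.integral_of_ge (by linarith), integral_Ioc_eq_integral_Ioo,
      ← integral_Ico_eq_integral_Ioo, ← integral_indicator measurableSet_Ico, ← integral_neg]
    congr with s
    simp only [incrFun, halfLine_eq, indicator_apply (Ico _ _), mem_Ico]
    by_cases h1 : b ≤ s
    · by_cases h2 : b ≤ s + ε
      · simp [h1, h2, show ¬ (s < b - ε) by intro h3; linarith]
      · simp [h1, h2, show s < b - ε by linarith]
    · simp [h1, show ¬ (b ≤ s + ε) by intro h3; linarith]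

lemma avg_eq (T ε : ℝ) (g : ℝ → ℝ) (b : ℝ) :
    avg T ε g b = ε⁻¹ * ∫ s in (b - ε)..b, (Icc 0 T).indicator g s := by
  rw [avg, integral_mul_incrFun]

lemma abs_avg_le (T ε : ℝ) {g : ℝ → ℝ} {C : ℝ} (hC : ∀ s, |g s| ≤ C) (b : ℝ) :
    |avg T ε g b| ≤ C := by
  have hC0 : 0 ≤ C := (abs_nonneg _).trans (hC 0)
  have h := intervalIntegral.norm_integral_le_of_norm_le_const (a := b - ε) (b := b) (C := C)
    (f := (Icc 0 T).indicator g) fun x _ => (norm_indicator_le_norm_self _ _).trans (hC x)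
  rw [avg_eq, abs_mul, abs_inv]
  rw [sub_sub_cancel, Real.norm_eq_abs] at h
  rcases eq_or_ne ε 0 with rfl | hε
  · simpa using hC0
  · rw [inv_mul_le_iff₀ (abs_pos.2 hε), mul_comm]
    exact h

lemma measurable_avg {α : Type*} [MeasurableSpace α] (T ε : ℝ) {g : α → ℝ → ℝ}
    (hg : Measurable (Function.uncurry g)) {b : α → ℝ} (hb : Measurable b) :
    Measurable fun a => avg T ε (g a) (b a) := by
  refine Measurable.const_mul (Measurable.integral_right
    (f := fun a s => g a s * incrFun s (s + ε) (b a)) ?_) _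
  exact hg.mul (measurable_snd.incrFun (measurable_snd.add_const _) (hb.comp measurable_fst))

lemma isBM_avg (T ε : ℝ) {g : ℝ → ℝ} (hg : IsBM g) : IsBM (avg T ε g) := by
  obtain ⟨h1, C, h2⟩ := hg
  exact ⟨measurable_avg T ε (g := fun _ => g) (h1.comp measurable_snd) measurable_id, C,
    abs_avg_le T ε h2⟩

variable {μ : SignedMeasure (ℝ × ℝ)} {T : ℝ}

/-- Pairing with an average. -/
lemma bil_avg_right (ε : ℝ) {ψ u : ℝ → ℝ} (hψ : IsBM ψ) (hu : IsBM u) :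
    bil μ ψ (avg T ε u) = ε⁻¹ * ∫ s in Icc 0 T, u s * bil μ ψ (incrFun s (s + ε)) := by
  obtain ⟨hψm, A, hA⟩ := hψ
  obtain ⟨hum, C, hC⟩ := hu
  have hA0 := (abs_nonneg _).trans (hA 0)
  have hC0 := (abs_nonneg _).trans (hC 0)
  have e := integral_swap_of_bound (ρ := volume.restrict (Icc 0 T)) (ν := μ.totalVariation)
    (f := fun s p => u s * (ψ p.1 * incrFun s (s + ε) p.2 * sgn μ p)) (C := C * (A * 1 * 1)) ?_ ?_
  · have e2 : ∀ s, u s * bil μ ψ (incrFun s (s + ε)) =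
        ∫ p, u s * (ψ p.1 * incrFun s (s + ε) p.2 * sgn μ p) ∂μ.totalVariation := fun s =>
      (integral_const_mul _ _).symm
    simp_rw [e2]
    rw [e, ← integral_const_mul, bil]
    congr with p
    rw [avg, ← integral_const_mul, ← integral_const_mul, ← integral_const_mul,
      ← integral_mul_const]
    congr with s; ring
  · exact (hum.comp measurable_fst).mul (((hψm.comp (measurable_fst.comp measurable_snd)).mul
      (measurable_fst.incrFun (measurable_fst.add_const _)
        (measurable_snd.comp measurable_snd))).mul ((measurable_sgn μ).comp measurable_snd))
  · intro s p
    rw [abs_mul, abs_mul, abs_mul, abs_sgn]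
    gcongr
    · exact hC _
    · exact hA _
    · exact abs_incrFun_le _ _ _

/-- Fubini; this produces the trace term of the regularized integral. -/
lemma integral_avg_mul_sgn (ε : ℝ) {d : ℝ → ℝ → ℝ} (hd : Measurable (Function.uncurry d)) {C : ℝ}
    (hC : ∀ r s, |d r s| ≤ C) :
    ε⁻¹ * ∫ s in Icc 0 T, bil μ (fun r => d r s) (incrFun s (s + ε)) =
      ∫ p, avg T ε (d p.1) p.2 * sgn μ p ∂μ.totalVariation := by
  have hC0 := (abs_nonneg _).trans (hC 0 0)
  simp only [bil]
  rw [integral_swap_of_bound (C := C * 1 * 1), ← integral_const_mul]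
  · congr with p
    rw [avg, ← integral_const_mul, ← integral_const_mul, ← integral_mul_const]
    congr with s; ring
  · exact (((hd.comp ((measurable_fst.comp measurable_snd).prodMk measurable_fst))).mul
      (measurable_fst.incrFun (measurable_fst.add_const _)
        (measurable_snd.comp measurable_snd))).mul ((measurable_sgn μ).comp measurable_snd)
  · intro s p
    rw [abs_mul, abs_mul, abs_sgn]
    gcongr
    · exact hC _ _
    · exact abs_incrFun_le _ _ _

/-- Fubini in the first term of the isometry. -/
lemma bil_avg_avg (ε η : ℝ) {u : ℝ → ℝ} (hu : IsBM u) :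
    (ε⁻¹ * η⁻¹) * ∫ z, u z.1 * u z.2 * bil μ (incrFun z.1 (z.1 + ε)) (incrFun z.2 (z.2 + η))
      ∂(volume.restrict (Icc 0 T)).prod (volume.restrict (Icc 0 T)) =
    bil μ (avg T ε u) (avg T η u) := by
  obtain ⟨hum, C, hC⟩ := hu
  have hC0 := (abs_nonneg _).trans (hC 0)
  simp only [bil]
  simp_rw [← integral_const_mul (_ * _)]
  rw [integral_swap_of_bound (C := |ε⁻¹ * η⁻¹| * (C * C * (1 * 1 * 1)))]
  · congr with p
    rw [avg, avg, mul_mul_mul_comm, ← integral_prod_mul (fun s => u s * incrFun s (s + ε) p.1)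
      (fun s => u s * incrFun s (s + η) p.2), ← integral_const_mul, ← integral_mul_const]
    congr with z; ring
  · refine Measurable.const_mul (((hum.comp (measurable_fst.comp measurable_fst)).mul
      (hum.comp (measurable_snd.comp measurable_fst))).mul (Measurable.mul (Measurable.mul ?_ ?_)
      ((measurable_sgn μ).comp measurable_snd))) _
    · exact (measurable_fst.comp measurable_fst).incrFun
        ((measurable_fst.comp measurable_fst).add_const _) (measurable_fst.comp measurable_snd)
    · exact (measurable_snd.comp measurable_fst).incrFun
        ((measurable_snd.comp measurable_fst).add_const _) (measurable_snd.comp measurable_snd)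
  · intro s p
    simp only [abs_mul (_ * _), abs_mul (u _), abs_mul (incrFun _ _ _), abs_sgn]
    gcongr
    · exact hC _
    · exact hC _
    · exact abs_incrFun_le _ _ _
    · exact abs_incrFun_le _ _ _

/-- Fubini in the second term of the isometry. Each derivative is paired with the increment attached
to the other one, hence the crossed coordinates of the two points. -/
lemma integral_avg_mul_avg (ε η : ℝ) {d : ℝ → ℝ → ℝ} (hd : Measurable (Function.uncurry d)) {C : ℝ}
    (hC : ∀ r s, |d r s| ≤ C) :
    (ε⁻¹ * η⁻¹) * ∫ z, bil μ (fun r => d r z.1) (incrFun z.2 (z.2 + η)) *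
      bil μ (fun r => d r z.2) (incrFun z.1 (z.1 + ε))
      ∂(volume.restrict (Icc 0 T)).prod (volume.restrict (Icc 0 T)) =
    ∫ w, avg T ε (d w.1.1) w.2.2 * avg T η (d w.2.1) w.1.2 * (sgn μ w.1 * sgn μ w.2)
      ∂μ.totalVariation.prod μ.totalVariation := by
  have hC0 := (abs_nonneg _).trans (hC 0 0)
  simp only [bil]
  simp_rw [← integral_prod_mul]
  rw [integral_swap_of_bound (C := (C * 1 * 1) * (C * 1 * 1)), ← integral_const_mul]
  · congr with w
    have h := integral_prod_mul (μ := volume.restrict (Icc 0 T)) (ν := volume.restrict (Icc 0 T))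
      (fun s => d w.1.1 s * incrFun s (s + ε) w.2.2) (fun s => d w.2.1 s * incrFun s (s + η) w.1.2)
    rw [avg, avg, mul_mul_mul_comm ε⁻¹, ← h, mul_assoc (ε⁻¹ * η⁻¹), ← integral_mul_const]
    congr with z; ring
  · have m1 : Measurable fun x : (ℝ × ℝ) × ((ℝ × ℝ) × (ℝ × ℝ)) => x.1.1 := by fun_prop
    have m2 : Measurable fun x : (ℝ × ℝ) × ((ℝ × ℝ) × (ℝ × ℝ)) => x.1.2 := by fun_prop
    have m3 : Measurable fun x : (ℝ × ℝ) × ((ℝ × ℝ) × (ℝ × ℝ)) => x.2.1.1 := by fun_prop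
    have m4 : Measurable fun x : (ℝ × ℝ) × ((ℝ × ℝ) × (ℝ × ℝ)) => x.2.1.2 := by fun_prop
    have m5 : Measurable fun x : (ℝ × ℝ) × ((ℝ × ℝ) × (ℝ × ℝ)) => x.2.2.1 := by fun_prop
    have m6 : Measurable fun x : (ℝ × ℝ) × ((ℝ × ℝ) × (ℝ × ℝ)) => x.2.2.2 := by fun_prop
    exact (((hd.comp (m3.prodMk m1)).mul (m2.incrFun (m2.add_const _) m4)).mul
      ((measurable_sgn μ).comp (m3.prodMk m4))).mul
      (((hd.comp (m5.prodMk m2)).mul (m1.incrFun (m1.add_const _) m6)).mul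
      ((measurable_sgn μ).comp (m5.prodMk m6)))
  · intro z w
    rw [abs_mul, abs_mul, abs_mul, abs_mul, abs_mul, abs_sgn, abs_sgn]
    gcongr
    · exact hC _ _
    · exact abs_incrFun_le _ _ _
    · exact hC _ _
    · exact abs_incrFun_le _ _ _

end Avg

/-! ### Square integrable functions with a parameter -/

section ProductLTwo

variable {Ω α : Type*} [MeasurableSpace Ω] [MeasurableSpace α] {P : Measure Ω} {ρ : Measure α}
  [IsFiniteMeasure P] [IsFiniteMeasure ρ]

lemma sq_integral_le {f : α → ℝ} (hf : MemLp f 2 ρ) :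
    (∫ a, f a ∂ρ) ^ 2 ≤ (∫ a, f a ^ 2 ∂ρ) * ρ.real univ := by
  have h1 : MemLp (fun _ : α => (1 : ℝ)) 2 ρ := memLp_const 1
  have := real_inner_mul_inner_self_le (hf.toLp f) (h1.toLp _)
  simp only [inner_toLp] at this
  simpa [pow_two] using this

lemma _root_.MeasureTheory.MemLp.integral_abs {F : α → Ω → ℝ}
    (hF : MemLp (fun z : α × Ω => F z.1 z.2) 2 (ρ.prod P)) :
    MemLp (fun ω => ∫ a, |F a ω| ∂ρ) 2 P := by
  have hm : AEStronglyMeasurable (fun ω => ∫ a, |F a ω| ∂ρ) P :=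
    hF.1.norm.prod_swap.integral_prod_right'
  have hsq : Integrable (fun z : α × Ω => F z.1 z.2 ^ 2) (ρ.prod P) := hF.integrable_sq
  rw [memLp_two_iff_integrable_sq hm]
  refine (hsq.integral_prod_right.mul_const (ρ.real univ)).mono' (hm.pow 2) ?_
  filter_upwards [hsq.prod_left_ae, hF.1.prod_swap.prodMk_left] with ω h1 h2
  have hF2 : MemLp (fun a => F a ω) 2 ρ := (memLp_two_iff_integrable_sq h2).2 h1
  have := sq_integral_le hF2.norm
  rw [Real.norm_eq_abs, abs_of_nonneg (sq_nonneg _)]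
  simpa [Real.norm_eq_abs] using this

/-- For fixed ω the integral of the absolute value factorizes, and both factors are square
integrable in ω by Cauchy-Schwarz in the parameter. -/
lemma integrable_mul_prod {F G : α → Ω → ℝ} (hFm : Measurable (Function.uncurry F))
    (hGm : Measurable (Function.uncurry G))
    (hF : MemLp (fun z : α × Ω => F z.1 z.2) 2 (ρ.prod P))
    (hG : MemLp (fun z : α × Ω => G z.1 z.2) 2 (ρ.prod P)) :
    Integrable (fun x : Ω × (α × α) => F x.2.1 x.1 * G x.2.2 x.1) (P.prod (ρ.prod ρ)) := by
  have h1 : Measurable fun x : Ω × (α × α) => F x.2.1 x.1 :=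
    hFm.comp ((measurable_fst.comp measurable_snd).prodMk measurable_fst)
  have h2 : Measurable fun x : Ω × (α × α) => G x.2.2 x.1 :=
    hGm.comp ((measurable_snd.comp measurable_snd).prodMk measurable_fst)
  refine (integrable_prod_iff (h1.mul h2).aestronglyMeasurable).2 ⟨?_, ?_⟩
  · filter_upwards [(hF.integrable one_le_two).prod_left_ae,
      (hG.integrable one_le_two).prod_left_ae] with ω a1 a2
    exact a1.mul_prod a2
  · refine (hF.integral_abs.integrable_mul_two hG.integral_abs).congr (ae_of_all _ fun ω => ?_)
    simp only
    rw [← integral_prod_mul]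
    simp

lemma integral_integral_mul {F G : α → Ω → ℝ} (hFm : Measurable (Function.uncurry F))
    (hGm : Measurable (Function.uncurry G))
    (hF : MemLp (fun z : α × Ω => F z.1 z.2) 2 (ρ.prod P))
    (hG : MemLp (fun z : α × Ω => G z.1 z.2) 2 (ρ.prod P)) :
    ∫ ω, (∫ a, F a ω ∂ρ) * (∫ a, G a ω ∂ρ) ∂P =
      ∫ z, ∫ ω, F z.1 ω * G z.2 ω ∂P ∂ρ.prod ρ := by
  rw [← integral_integral_swap (integrable_mul_prod hFm hGm hF hG)]
  congr with ω
  rw [integral_prod_mul (fun a => F a ω) fun a => G a ω]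

lemma _root_.MeasureTheory.MemLp.integral_param {F : α → Ω → ℝ} (hFm : Measurable (Function.uncurry F))
    (hF : MemLp (fun z : α × Ω => F z.1 z.2) 2 (ρ.prod P)) :
    MemLp (fun ω => ∫ a, F a ω ∂ρ) 2 P := by
  refine hF.integral_abs.mono ?_ (ae_of_all _ fun ω => ?_)
  · exact (Measurable.integral_right (f := fun ω a => F a ω)
      (hFm.comp measurable_swap)).aestronglyMeasurable
  · exact (norm_integral_le_integral_norm _).trans (le_abs_self _)

lemma integral_mul_integral {F : α → Ω → ℝ}
    (hF : MemLp (fun z : α × Ω => F z.1 z.2) 2 (ρ.prod P)) {h : Ω → ℝ} (hh : MemLp h 2 P) :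
    ∫ ω, h ω * (∫ a, F a ω ∂ρ) ∂P = ∫ a, ∫ ω, h ω * F a ω ∂P ∂ρ := by
  simp_rw [← integral_const_mul]
  refine integral_integral_swap ?_
  have h1 : MemLp (fun z : Ω × α => F z.2 z.1) 2 (P.prod ρ) :=
    hF.comp_measurePreserving Measure.measurePreserving_swap
  have h2 : MemLp (fun z : Ω × α => h z.1) 2 (P.prod ρ) := hh.comp_fst ρ
  exact h2.integrable_mul_two h1

end ProductLTwo

/-! ### Mean square convergence of the approximate divergences -/

section Core

instance (μ : SignedMeasure (ℝ × ℝ)) : IsFiniteMeasure (marginal μ) := by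
  unfold marginal; infer_instance

/-- A dominated process with a dominated derivative, both recovered by averaging. -/
structure IsRegularProc {Ω : Type*} [MeasurableSpace Ω] (T : ℝ) (P : Measure Ω)
    (X B : ℝ → Ω → ℝ) (μ : SignedMeasure (ℝ × ℝ)) (U : ℝ → Ω → ℝ) (D : Ω → ℝ → ℝ → ℝ)
    (R : Ω → ℝ) : Prop where
  measU : Measurable fun q : ℝ × Ω => U q.1 q.2
  measD : Measurable fun q : Ω × ℝ × ℝ => D q.1 q.2.1 q.2.2
  measR : Measurable R
  memLpR : MemLp R 2 P
  leU : ∀ s ω, |U s ω| ≤ R ω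
  leD : ∀ ω r s, |D ω r s| ≤ R ω
  hasDirDeriv : ∀ᵐ s ∂(volume.restrict (Icc 0 T)), HasDirDeriv T P X B μ (U s)
    fun p q ω => bil μ (fun r => D ω r s) (incrFun p q)
  avgU : ∀ᵐ ω ∂P, ∀ᵐ b ∂marginal μ,
    Tendsto (fun ε => avg T ε (fun s => U s ω) b) (𝓝[≠] 0) (𝓝 (U b ω))
  avgD : ∀ᵐ b ∂marginal μ, ∀ᵐ ω ∂P, ∀ᵐ r ∂marginal μ,
    Tendsto (fun ε => avg T ε (D ω r) b) (𝓝[≠] 0) (𝓝 (D ω r b))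

variable {Ω : Type*} [MeasurableSpace Ω] {T : ℝ} {P : Measure Ω} {X B : ℝ → Ω → ℝ}
  {μ : SignedMeasure (ℝ × ℝ)} {U : ℝ → Ω → ℝ} {D : Ω → ℝ → ℝ → ℝ} {R : Ω → ℝ}

/-- The pairing of the derivative of `U s` with the increment from `p` to `q`. -/
def dirD (μ : SignedMeasure (ℝ × ℝ)) (D : Ω → ℝ → ℝ → ℝ) (s p q : ℝ) (ω : Ω) : ℝ :=
  bil μ (fun r => D ω r s) (incrFun p q)

/-- The divergence of `U s` times the indicator of the interval from `s` to `s + ε`. -/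
def localDiv (B : ℝ → Ω → ℝ) (μ : SignedMeasure (ℝ × ℝ)) (U : ℝ → Ω → ℝ) (D : Ω → ℝ → ℝ → ℝ)
    (ε s : ℝ) (ω : Ω) : ℝ :=
  divg B (U s) (dirD μ D s) s (s + ε) ω

/-- The approximation of the divergence of `U` at scale `ε`. -/
def approxDiv (T : ℝ) (B : ℝ → Ω → ℝ) (μ : SignedMeasure (ℝ × ℝ)) (U : ℝ → Ω → ℝ)
    (D : Ω → ℝ → ℝ → ℝ) (ε : ℝ) (ω : Ω) : ℝ :=
  ε⁻¹ * ∫ s in Icc 0 T, localDiv B μ U D ε s ω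

/-- The density of the covariances of the approximations of the divergence. -/
def covDensity (T : ℝ) (μ : SignedMeasure (ℝ × ℝ)) (U : ℝ → Ω → ℝ) (D : Ω → ℝ → ℝ → ℝ)
    (ε η : ℝ) (ω : Ω) : ℝ :=
  bil μ (avg T ε fun s => U s ω) (avg T η fun s => U s ω) +
  ∫ w, avg T ε (D ω w.1.1) w.2.2 * avg T η (D ω w.2.1) w.1.2 * (sgn μ w.1 * sgn μ w.2)
      ∂μ.totalVariation.prod μ.totalVariation

namespace IsRegularProc

variable (h : IsRegularProc T P X B μ U D R)
include h

lemma nonneg (ω : Ω) : 0 ≤ R ω := (abs_nonneg _).trans (h.leU 0 ω)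

lemma isBM_U (ω : Ω) : IsBM fun s => U s ω :=
  ⟨h.measU.comp measurable_prodMk_right, R ω, fun s => h.leU s ω⟩

lemma measurable_D (ω : Ω) : Measurable (Function.uncurry (D ω)) :=
  h.measD.comp measurable_prodMk_left

lemma abs_dirD_le (s p q : ℝ) (ω : Ω) :
    |dirD μ D s p q ω| ≤ R ω * μ.totalVariation.real univ := by
  have := abs_bil_le (μ := μ) (fun r => h.leD ω r s) (abs_incrFun_le p q)
  rwa [mul_one] at this

lemma measurable_dirD {α : Type*} [MeasurableSpace α] {s p q : α → ℝ} {ω : α → Ω}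
    (hs : Measurable s) (hp : Measurable p) (hq : Measurable q) (hω : Measurable ω) :
    Measurable fun a => dirD μ D (s a) (p a) (q a) (ω a) := by
  refine Measurable.integral_right (f := fun a z => D (ω a) z.1 (s a) *
    incrFun (p a) (q a) z.2 * sgn μ z) ?_
  refine (Measurable.mul ?_ ?_).mul ((measurable_sgn μ).comp measurable_snd)
  · exact h.measD.comp ((hω.comp measurable_fst).prodMk
      ((measurable_fst.comp measurable_snd).prodMk (hs.comp measurable_fst)))
  · exact (hp.comp measurable_fst).incrFun (hq.comp measurable_fst)
      (measurable_snd.comp measurable_snd)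

lemma measurable_localDiv (hB : IsCovProcess P B μ) (ε : ℝ) :
    Measurable (Function.uncurry (localDiv B μ U D ε)) := by
  have hBm : Measurable (Function.uncurry B) :=
    measurable_uncurry_of_continuous_of_measurable hB.cont hB.meas
  refine (h.measU.mul ((hBm.comp ((measurable_fst.add_const ε).prodMk measurable_snd)).sub
    hBm)).sub ?_
  exact h.measurable_dirD measurable_fst measurable_fst (measurable_fst.add_const ε) measurable_snd

/-- The isometry, applied to one divergence with itself, bounds its second moment uniformly in s. -/
lemma memLp_localDiv [IsProbabilityMeasure P] (hB : IsCovProcess P B μ)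
    (hBX : ∀ t ∈ Icc 0 T, B t =ᵐ[P] X t) (ε : ℝ) :
    MemLp (fun z : ℝ × Ω => localDiv B μ U D ε z.1 z.2) 2
      ((volume.restrict (Icc 0 T)).prod P) := by
  have hm := h.measurable_localDiv hB ε
  refine (memLp_two_iff_integrable_sq hm.aestronglyMeasurable).2 ?_
  have hm2 : Measurable fun z : ℝ × Ω => localDiv B μ U D ε z.1 z.2 ^ 2 := hm.pow_const 2
  refine (integrable_prod_iff hm2.aestronglyMeasurable).2 ⟨?_, ?_⟩
  · filter_upwards [h.hasDirDeriv] with s hs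
    exact (hs.memLp_divg hB hBX s (s + ε)).integrable_sq
  · set C : ℝ := (∫ ω, R ω ^ 2 ∂P) * (1 * 1 * μ.totalVariation.real univ) +
      (∫ ω, R ω ^ 2 ∂P) * (μ.totalVariation.real univ) ^ 2
    refine Integrable.of_bound (C := C) ?_ ?_
    · exact (Measurable.integral_right (f := fun s ω => ‖localDiv B μ U D ε s ω ^ 2‖)
        hm2.norm).aestronglyMeasurable
    · filter_upwards [h.hasDirDeriv] with s hs
      have e := hs.isometry hB hBX hs s (s + ε) s (s + ε)
      have hR := h.memLpR.integrable_sq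
      have hR0 : 0 ≤ ∫ ω, R ω ^ 2 ∂P := integral_nonneg fun ω => sq_nonneg _
      have e2 : ∀ ω, ‖localDiv B μ U D ε s ω ^ 2‖ = divg B (U s)
          (fun p q ω => bil μ (fun r => D ω r s) (incrFun p q)) s (s + ε) ω *
          divg B (U s) (fun p q ω => bil μ (fun r => D ω r s) (incrFun p q)) s (s + ε) ω := by
        intro ω
        rw [Real.norm_eq_abs, abs_of_nonneg (sq_nonneg _), pow_two]
        rfl
      simp only [e2]
      rw [Real.norm_eq_abs, abs_of_nonneg (integral_nonneg fun ω => mul_self_nonneg _), e]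
      refine add_le_add ?_ ?_
      · refine mul_le_mul ?_ ((le_abs_self _).trans
          (abs_bil_le (abs_incrFun_le _ _) (abs_incrFun_le _ _)))
          (hB.bil_nonneg (isBM_incrFun _ _)) hR0
        refine integral_mono_of_nonneg (ae_of_all _ fun ω => mul_self_nonneg _) hR
          (ae_of_all _ fun ω => ?_)
        simp only
        rw [← pow_two]
        exact sq_le_sq' (by linarith [(abs_le.1 (h.leU s ω)).1]) (abs_le.1 (h.leU s ω)).2
      · rw [← integral_mul_const]
        refine integral_mono_of_nonneg (ae_of_all _ fun ω => mul_self_nonneg _)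
          (hR.mul_const _) (ae_of_all _ fun ω => ?_)
        simp only
        rw [← pow_two, ← mul_pow]
        have := abs_le.1 (h.abs_dirD_le s s (s + ε) ω)
        exact sq_le_sq' this.1 this.2

lemma memLp_approxDiv [IsProbabilityMeasure P] (hB : IsCovProcess P B μ)
    (hBX : ∀ t ∈ Icc 0 T, B t =ᵐ[P] X t) (ε : ℝ) : MemLp (approxDiv T B μ U D ε) 2 P :=
  ((h.memLp_localDiv hB hBX ε).integral_param (h.measurable_localDiv hB ε)).const_mul _

/-- Fubini brings the expectation inside, the isometry is applied to pairs of times, and Fubini at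
fixed ω moves the time integrals onto the process and its derivative as averages. -/
lemma integral_approxDiv_mul [IsProbabilityMeasure P] (hB : IsCovProcess P B μ)
    (hBX : ∀ t ∈ Icc 0 T, B t =ᵐ[P] X t) (ε η : ℝ) :
    ∫ ω, approxDiv T B μ U D ε ω * approxDiv T B μ U D η ω ∂P =
      ∫ ω, covDensity T μ U D ε η ω ∂P := by
  set lam : Measure ℝ := volume.restrict (Icc 0 T) with hlam
  set m : ℝ := μ.totalVariation.real univ
  set K : Ω → ℝ × ℝ → ℝ := fun ω z =>
    U z.1 ω * U z.2 ω * bil μ (incrFun z.1 (z.1 + ε)) (incrFun z.2 (z.2 + η)) +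
    dirD μ D z.1 z.2 (z.2 + η) ω * dirD μ D z.2 z.1 (z.1 + ε) ω with hK
  have b1 : ∀ (ω : Ω) (z : ℝ × ℝ), |U z.1 ω * U z.2 ω *
      bil μ (incrFun z.1 (z.1 + ε)) (incrFun z.2 (z.2 + η))| ≤ R ω ^ 2 * m := by
    intro ω z
    rw [abs_mul, abs_mul, pow_two]
    have := abs_bil_le (μ := μ) (abs_incrFun_le z.1 (z.1 + ε)) (abs_incrFun_le z.2 (z.2 + η))
    rw [one_mul, one_mul] at this
    have h0 := h.nonneg ω
    gcongr
    · exact h.leU _ _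
    · exact h.leU _ _
  have b2 : ∀ (ω : Ω) (z : ℝ × ℝ), |dirD μ D z.1 z.2 (z.2 + η) ω * dirD μ D z.2 z.1 (z.1 + ε) ω| ≤
      R ω ^ 2 * m ^ 2 := by
    intro ω z
    rw [abs_mul, ← mul_pow, pow_two]
    have h0 := h.nonneg ω
    have := h.abs_dirD_le z.1 z.2 (z.2 + η) ω
    exact mul_le_mul this (h.abs_dirD_le _ _ _ _) (abs_nonneg _) ((abs_nonneg _).trans this)
  have mU1 : Measurable fun x : Ω × (ℝ × ℝ) => U x.2.1 x.1 :=
    h.measU.comp ((measurable_fst.comp measurable_snd).prodMk measurable_fst)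
  have mU2 : Measurable fun x : Ω × (ℝ × ℝ) => U x.2.2 x.1 :=
    h.measU.comp ((measurable_snd.comp measurable_snd).prodMk measurable_fst)
  have mb : Measurable fun z : ℝ × ℝ =>
      bil μ (incrFun z.1 (z.1 + ε)) (incrFun z.2 (z.2 + η)) := by
    refine Measurable.integral_right (f := fun (z p : ℝ × ℝ) => incrFun z.1 (z.1 + ε) p.1 *
      incrFun z.2 (z.2 + η) p.2 * sgn μ p) ?_
    refine (Measurable.mul ?_ ?_).mul ((measurable_sgn μ).comp measurable_snd)
    · exact (measurable_fst.comp measurable_fst).incrFun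
        ((measurable_fst.comp measurable_fst).add_const _) (measurable_fst.comp measurable_snd)
    · exact (measurable_snd.comp measurable_fst).incrFun
        ((measurable_snd.comp measurable_fst).add_const _) (measurable_snd.comp measurable_snd)
  have m1 : Measurable fun x : Ω × (ℝ × ℝ) => U x.2.1 x.1 * U x.2.2 x.1 *
      bil μ (incrFun x.2.1 (x.2.1 + ε)) (incrFun x.2.2 (x.2.2 + η)) :=
    (mU1.mul mU2).mul (mb.comp measurable_snd)
  have m2 : Measurable fun x : Ω × (ℝ × ℝ) =>
      dirD μ D x.2.1 x.2.2 (x.2.2 + η) x.1 * dirD μ D x.2.2 x.2.1 (x.2.1 + ε) x.1 :=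
    (h.measurable_dirD (measurable_fst.comp measurable_snd) (measurable_snd.comp measurable_snd)
      ((measurable_snd.comp measurable_snd).add_const _) measurable_fst).mul
    (h.measurable_dirD (measurable_snd.comp measurable_snd) (measurable_fst.comp measurable_snd)
      ((measurable_fst.comp measurable_snd).add_const _) measurable_fst)
  have i1 : ∀ ω, Integrable (fun z : ℝ × ℝ => U z.1 ω * U z.2 ω *
      bil μ (incrFun z.1 (z.1 + ε)) (incrFun z.2 (z.2 + η))) (lam.prod lam) := fun ω =>
    integrable_mul_of_bound (m1.comp measurable_prodMk_left) (b1 ω)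
  have i2 : ∀ ω, Integrable (fun z : ℝ × ℝ => dirD μ D z.1 z.2 (z.2 + η) ω *
      dirD μ D z.2 z.1 (z.1 + ε) ω) (lam.prod lam) := fun ω =>
    integrable_mul_of_bound (m2.comp measurable_prodMk_left) (b2 ω)
  have hR := h.memLpR.integrable_sq
  have j1 : ∀ z : ℝ × ℝ, Integrable (fun ω => U z.1 ω * U z.2 ω *
      bil μ (incrFun z.1 (z.1 + ε)) (incrFun z.2 (z.2 + η))) P := fun z =>
    (hR.mul_const m).mono' (m1.comp measurable_prodMk_right).aestronglyMeasurable
      (ae_of_all _ fun ω => b1 ω z)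
  have j2 : ∀ z : ℝ × ℝ, Integrable (fun ω => dirD μ D z.1 z.2 (z.2 + η) ω *
      dirD μ D z.2 z.1 (z.1 + ε) ω) P := fun z =>
    (hR.mul_const (m ^ 2)).mono' (m2.comp measurable_prodMk_right).aestronglyMeasurable
      (ae_of_all _ fun ω => b2 ω z)
  have hKi : Integrable (Function.uncurry K) (P.prod (lam.prod lam)) := by
    refine (((hR.mul_const m).comp_fst (lam.prod lam)).add
      ((hR.mul_const (m ^ 2)).comp_fst (lam.prod lam))).mono' (m1.add m2).aestronglyMeasurable
      (ae_of_all _ fun x => ?_)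
    exact (norm_add_le _ _).trans (add_le_add (b1 _ _) (b2 _ _))
  -- At fixed ω, the averages over the two times are unfolded into the integrand of the isometry.
  have hcov : ∀ ω, covDensity T μ U D ε η ω = (ε⁻¹ * η⁻¹) * ∫ z, K ω z ∂lam.prod lam := by
    intro ω
    rw [covDensity, ← bil_avg_avg ε η (h.isBM_U ω),
      ← integral_avg_mul_avg ε η (h.measurable_D ω) (h.leD ω), ← mul_add]
    exact congrArg _ (integral_add (i1 ω) (i2 ω)).symm
  simp_rw [hcov]
  rw [integral_const_mul, integral_integral_swap hKi]
  have e : ∀ ω, approxDiv T B μ U D ε ω * approxDiv T B μ U D η ω = (ε⁻¹ * η⁻¹) *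
      ((∫ s, localDiv B μ U D ε s ω ∂lam) * ∫ s, localDiv B μ U D η s ω ∂lam) := fun ω => by
    simp only [approxDiv]; ring
  simp_rw [e]
  rw [integral_const_mul, integral_integral_mul (h.measurable_localDiv hB ε)
    (h.measurable_localDiv hB η) (h.memLp_localDiv hB hBX ε) (h.memLp_localDiv hB hBX η)]
  congr 1
  refine integral_congr_ae ?_
  -- Differentiability holds for almost every time, hence at both times of almost every pair.
  filter_upwards [(Measure.quasiMeasurePreserving_fst (μ := lam) (ν := lam)).ae h.hasDirDeriv,
    (Measure.quasiMeasurePreserving_snd (μ := lam) (ν := lam)).ae h.hasDirDeriv] with z h1 h2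
  have e3 := h1.isometry hB hBX h2 z.1 (z.1 + ε) z.2 (z.2 + η)
  rw [← integral_mul_const] at e3
  exact e3.trans (integral_add (j1 z) (j2 z)).symm

/-- Convergence of the averages of the derivative, with the exceptional sets in a convenient
order. -/
lemma ae_tendsto_avg_seq [IsProbabilityMeasure P] {ε : ℕ → ℝ}
    (hε : Tendsto ε atTop (𝓝[≠] 0)) :
    ∀ᵐ ω ∂P, ∀ᵐ r ∂marginal μ, ∀ᵐ b ∂marginal μ,
      Tendsto (fun n => avg T (ε n) (D ω r) b) atTop (𝓝 (D ω r b)) := by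
  have hDm : Measurable (Function.uncurry fun (x : ℝ × (Ω × ℝ)) (s : ℝ) => D x.2.1 x.2.2 s) :=
    h.measD.comp ((measurable_fst.comp (measurable_snd.comp measurable_fst)).prodMk
      ((measurable_snd.comp (measurable_snd.comp measurable_fst)).prodMk measurable_snd))
  have hm : ∀ n, Measurable fun x : ℝ × (Ω × ℝ) => avg T (ε n) (D x.2.1 x.2.2) x.1 := fun n =>
    measurable_avg T (ε n) hDm measurable_fst
  have hl : Measurable fun x : ℝ × (Ω × ℝ) => D x.2.1 x.2.2 x.1 :=
    h.measD.comp ((measurable_fst.comp measurable_snd).prodMk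
      ((measurable_snd.comp measurable_snd).prodMk measurable_fst))
  -- Along a sequence of scales the set of convergence is measurable, so the almost everywhere
  -- quantifiers may be interchanged.
  have hS := measurableSet_tendsto_fun (l := atTop) hm hl
  have h1 : ∀ᵐ b ∂marginal μ, ∀ᵐ z ∂P.prod (marginal μ),
      Tendsto (fun n => avg T (ε n) (D z.1 z.2) b) atTop (𝓝 (D z.1 z.2 b)) := by
    filter_upwards [h.avgD] with b hb
    refine (Measure.ae_prod_iff_ae_ae (p := fun z : Ω × ℝ => Tendsto
      (fun n => avg T (ε n) (D z.1 z.2) b) atTop (𝓝 (D z.1 z.2 b)))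
      (hS.preimage measurable_prodMk_left)).2 ?_
    filter_upwards [hb] with ω hω
    filter_upwards [hω] with r hr
    exact hr.comp hε
  rw [Measure.ae_ae_comm hS] at h1
  exact Measure.ae_ae_of_ae_prod h1

end IsRegularProc

/-- The limit of `covDensity`. -/
def covLimit (μ : SignedMeasure (ℝ × ℝ)) (U : ℝ → Ω → ℝ) (D : Ω → ℝ → ℝ → ℝ) (ω : Ω) : ℝ :=
  bil μ (fun s => U s ω) (fun s => U s ω) +
  ∫ w, D ω w.1.1 w.2.2 * D ω w.2.1 w.1.2 * (sgn μ w.1 * sgn μ w.2)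
      ∂μ.totalVariation.prod μ.totalVariation

namespace IsRegularProc

variable (h : IsRegularProc T P X B μ U D R)
include h

lemma abs_covDensity_le (ε η : ℝ) (ω : Ω) :
    |covDensity T μ U D ε η ω| ≤ R ω ^ 2 * (μ.totalVariation.real univ +
      (μ.totalVariation.prod μ.totalVariation).real univ) := by
  rw [mul_add]
  have h0 := h.nonneg ω
  refine (abs_add_le _ _).trans (add_le_add ?_ ?_)
  · rw [pow_two]
    exact abs_bil_le (abs_avg_le T ε fun s => h.leU s ω) (abs_avg_le T η fun s => h.leU s ω)
  · rw [← Real.norm_eq_abs]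
    refine norm_integral_le_of_norm_le_const (ae_of_all _ fun w => ?_)
    simp only [norm_mul, Real.norm_eq_abs, abs_sgn, mul_one, pow_two]
    exact mul_le_mul (abs_avg_le _ _ (h.leD ω _) _) (abs_avg_le _ _ (h.leD ω _) _)
      (abs_nonneg _) h0

lemma measurable_covDensity (ε η : ℝ) : Measurable (covDensity T μ U D ε η) := by
  have a1 : ∀ ε, Measurable fun x : Ω × ℝ => avg T ε (fun s => U s x.1) x.2 := fun ε => by
    refine measurable_avg T ε (g := fun (x : Ω × ℝ) s => U s x.1) ?_ measurable_snd
    exact h.measU.comp (measurable_snd.prodMk (measurable_fst.comp measurable_fst))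
  have a2 : ∀ ε, Measurable fun x : Ω × ℝ × ℝ => avg T ε (D x.1 x.2.1) x.2.2 := fun ε => by
    refine measurable_avg T ε (g := fun (x : Ω × ℝ × ℝ) s => D x.1 x.2.1 s) ?_
      (measurable_snd.comp measurable_snd)
    exact h.measD.comp ((measurable_fst.comp measurable_fst).prodMk
      ((measurable_fst.comp (measurable_snd.comp measurable_fst)).prodMk measurable_snd))
  refine Measurable.add ?_ ?_
  · refine Measurable.integral_right (f := fun ω (p : ℝ × ℝ) => avg T ε (fun s => U s ω) p.1 *
      avg T η (fun s => U s ω) p.2 * sgn μ p) ?_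
    refine (Measurable.mul ?_ ?_).mul ((measurable_sgn μ).comp measurable_snd)
    · exact (a1 ε).comp (measurable_fst.prodMk (measurable_fst.comp measurable_snd))
    · exact (a1 η).comp (measurable_fst.prodMk (measurable_snd.comp measurable_snd))
  · refine Measurable.integral_right (f := fun ω (w : (ℝ × ℝ) × (ℝ × ℝ)) =>
      avg T ε (D ω w.1.1) w.2.2 * avg T η (D ω w.2.1) w.1.2 * (sgn μ w.1 * sgn μ w.2)) ?_
    have n1 : Measurable fun x : Ω × ((ℝ × ℝ) × (ℝ × ℝ)) => (x.1, x.2.1.1, x.2.2.2) := by fun_prop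
    have n2 : Measurable fun x : Ω × ((ℝ × ℝ) × (ℝ × ℝ)) => (x.1, x.2.2.1, x.2.1.2) := by fun_prop
    refine (((a2 ε).comp n1).mul ((a2 η).comp n2)).mul (Measurable.mul ?_ ?_)
    · exact (measurable_sgn μ).comp (measurable_fst.comp measurable_snd)
    · exact (measurable_sgn μ).comp (measurable_snd.comp measurable_snd)

lemma tendsto_bil_avg_avg (hB : IsCovProcess P B μ) {ω : Ω}
    (h1 : ∀ᵐ b ∂marginal μ,
      Tendsto (fun ε => avg T ε (fun s => U s ω) b) (𝓝[≠] 0) (𝓝 (U b ω)))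
    {ε η : ℕ → ℝ} (hε : Tendsto ε atTop (𝓝[≠] 0)) (hη : Tendsto η atTop (𝓝[≠] 0)) :
    Tendsto (fun n => bil μ (avg T (ε n) fun s => U s ω) (avg T (η n) fun s => U s ω)) atTop
      (𝓝 (bil μ (fun s => U s ω) fun s => U s ω)) := by
  have m : ∀ ε, Measurable (avg T ε fun s => U s ω) := fun ε => (isBM_avg T ε (h.isBM_U ω)).1
  have b : ∀ ε b, |avg T ε (fun s => U s ω) b| ≤ R ω := fun ε b =>
    abs_avg_le T ε (fun s => h.leU s ω) b
  have l1 : ∀ᵐ p ∂μ.totalVariation,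
      Tendsto (fun n => avg T (ε n) (fun s => U s ω) p.1) atTop (𝓝 (U p.1 ω)) := by
    filter_upwards [hB.ae_fst h1] with p hp
    exact hp.comp hε
  have l2 : ∀ᵐ p ∂μ.totalVariation,
      Tendsto (fun n => avg T (η n) (fun s => U s ω) p.2) atTop (𝓝 (U p.2 ω)) := by
    filter_upwards [ae_snd_of_marginal h1] with p hp
    exact hp.comp hη
  exact bil_tendsto (ψ' := fun n => avg T (ε n) fun s => U s ω)
    (χ' := fun n => avg T (η n) fun s => U s ω) (fun n => m _) (fun n => b _) (fun n => m _)
    (fun n => b _) l1 l2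

lemma tendsto_integral_avg_mul_avg (hB : IsCovProcess P B μ) {ω : Ω} {ε η : ℕ → ℝ}
    (h2 : ∀ᵐ r ∂marginal μ, ∀ᵐ b ∂marginal μ,
      Tendsto (fun n => avg T (ε n) (D ω r) b) atTop (𝓝 (D ω r b)))
    (h3 : ∀ᵐ r ∂marginal μ, ∀ᵐ b ∂marginal μ,
      Tendsto (fun n => avg T (η n) (D ω r) b) atTop (𝓝 (D ω r b))) :
    Tendsto (fun n => ∫ w, avg T (ε n) (D ω w.1.1) w.2.2 * avg T (η n) (D ω w.2.1) w.1.2 *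
        (sgn μ w.1 * sgn μ w.2) ∂μ.totalVariation.prod μ.totalVariation) atTop
      (𝓝 (∫ w, D ω w.1.1 w.2.2 * D ω w.2.1 w.1.2 * (sgn μ w.1 * sgn μ w.2)
        ∂μ.totalVariation.prod μ.totalVariation)) := by
  have hDa : ∀ ε, Measurable fun z : ℝ × ℝ => avg T ε (D ω z.1) z.2 := fun ε =>
    measurable_avg T ε (g := fun (z : ℝ × ℝ) s => D ω z.1 s)
      ((h.measurable_D ω).comp ((measurable_fst.comp measurable_fst).prodMk measurable_snd))
      measurable_snd
  have n1 : Measurable fun w : (ℝ × ℝ) × (ℝ × ℝ) => (w.1.1, w.2.2) := by fun_prop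
  have n2 : Measurable fun w : (ℝ × ℝ) × (ℝ × ℝ) => (w.2.1, w.1.2) := by fun_prop
  have l1 : ∀ᵐ w ∂μ.totalVariation.prod μ.totalVariation,
      Tendsto (fun n => avg T (ε n) (D ω w.1.1) w.2.2) atTop (𝓝 (D ω w.1.1 w.2.2)) := by
    refine (Measure.ae_prod_iff_ae_ae ?_).2 ?_
    · exact measurableSet_tendsto_fun (fun n => (hDa _).comp n1) ((h.measurable_D ω).comp n1)
    · have l := hB.ae_fst (p := fun r => ∀ᵐ b ∂marginal μ, Tendsto
        (fun n => avg T (ε n) (D ω r) b) atTop (𝓝 (D ω r b))) h2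
      filter_upwards [l] with p hp
      exact ae_snd_of_marginal (p := fun b => Tendsto
        (fun n => avg T (ε n) (D ω p.1) b) atTop (𝓝 (D ω p.1 b))) hp
  have l2 : ∀ᵐ w ∂μ.totalVariation.prod μ.totalVariation,
      Tendsto (fun n => avg T (η n) (D ω w.2.1) w.1.2) atTop (𝓝 (D ω w.2.1 w.1.2)) := by
    have hS : MeasurableSet {w : (ℝ × ℝ) × (ℝ × ℝ) |
        Tendsto (fun n => avg T (η n) (D ω w.2.1) w.1.2) atTop (𝓝 (D ω w.2.1 w.1.2))} :=
      measurableSet_tendsto_fun (fun n => (hDa _).comp n2) ((h.measurable_D ω).comp n2)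
    -- This factor couples the first coordinate of `w.2` with the second one of `w.1`, so the two
    -- points are exchanged before Fubini.
    refine (Measure.ae_prod_iff_ae_ae hS).2 ((Measure.ae_ae_comm (p := fun z w : ℝ × ℝ =>
      Tendsto (fun n => avg T (η n) (D ω w.1) z.2) atTop (𝓝 (D ω w.1 z.2))) hS).2 ?_)
    have l := hB.ae_fst (p := fun r => ∀ᵐ b ∂marginal μ, Tendsto
      (fun n => avg T (η n) (D ω r) b) atTop (𝓝 (D ω r b))) h3
    filter_upwards [l] with p hp
    exact ae_snd_of_marginal (p := fun b => Tendsto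
      (fun n => avg T (η n) (D ω p.1) b) atTop (𝓝 (D ω p.1 b))) hp
  refine tendsto_integral_of_dominated_convergence (fun _ => R ω ^ 2) (fun n => ?_)
    (integrable_const _) (fun n => ae_of_all _ fun w => ?_) ?_
  · exact ((((hDa _).comp n1).mul ((hDa _).comp n2)).mul (((measurable_sgn μ).comp
      measurable_fst).mul ((measurable_sgn μ).comp measurable_snd))).aestronglyMeasurable
  · simp only [norm_mul, Real.norm_eq_abs, abs_sgn, mul_one, pow_two]
    exact mul_le_mul (abs_avg_le _ _ (h.leD ω _) _) (abs_avg_le _ _ (h.leD ω _) _)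
      (abs_nonneg _) (h.nonneg ω)
  · filter_upwards [l1, l2] with w k1 k2
    exact (k1.mul k2).mul_const _

/-- Domination by a multiple of R². The scales tend to 0 independently and with arbitrary signs,
which is what later gives forward and backward integrals the same L² limit. -/
lemma tendsto_integral_covDensity [IsProbabilityMeasure P] (hB : IsCovProcess P B μ) :
    Tendsto (fun x : ℝ × ℝ => ∫ ω, covDensity T μ U D x.1 x.2 ω ∂P) (𝓝[≠] 0 ×ˢ 𝓝[≠] 0)
      (𝓝 (∫ ω, covLimit μ U D ω ∂P)) := by
  refine tendsto_of_seq_tendsto fun x hx => ?_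
  have hε : Tendsto (fun n => (x n).1) atTop (𝓝[≠] 0) := tendsto_fst.comp hx
  have hη : Tendsto (fun n => (x n).2) atTop (𝓝[≠] 0) := tendsto_snd.comp hx
  refine tendsto_integral_of_dominated_convergence (fun ω => R ω ^ 2 * (μ.totalVariation.real univ +
      (μ.totalVariation.prod μ.totalVariation).real univ))
    (fun n => (h.measurable_covDensity _ _).aestronglyMeasurable)
    (h.memLpR.integrable_sq.mul_const _) (fun n => ae_of_all _ fun ω => h.abs_covDensity_le _ _ ω) ?_
  filter_upwards [h.avgU, h.ae_tendsto_avg_seq hε, h.ae_tendsto_avg_seq hη] with ω h1 h2 h3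
  exact (h.tendsto_bil_avg_avg hB h1 hε hη).add (h.tendsto_integral_avg_mul_avg hB h2 h3)

/-- The approximations of the divergence converge in mean square. -/
lemma exists_tendsto_approxDiv [IsProbabilityMeasure P] (hB : IsCovProcess P B μ)
    (hBX : ∀ t ∈ Icc 0 T, B t =ᵐ[P] X t) :
    ∃ S, MemLp S 2 P ∧
      Tendsto (fun ε => eLpNorm (S - approxDiv T B μ U D ε) 2 P) (𝓝[≠] 0) (𝓝 0) := by
  refine exists_tendsto_of_tendsto_integral_mul (fun ε => h.memLp_approxDiv hB hBX ε)
    (L := ∫ ω, covLimit μ U D ω ∂P) ?_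
  simp_rw [h.integral_approxDiv_mul hB hBX]
  exact h.tendsto_integral_covDensity hB

end IsRegularProc

end Core

/-! ### The limit is the Skorohod integral -/

section Skorohod

variable {Ω : Type*} [MeasurableSpace Ω] {T : ℝ} {P : Measure Ω} {X B : ℝ → Ω → ℝ}
  {μ : SignedMeasure (ℝ × ℝ)} {U : ℝ → Ω → ℝ} {D : Ω → ℝ → ℝ → ℝ} {R : Ω → ℝ}

/-- A bound for the covariance of a Wiener integral with the increments. -/
lemma CylVar.exists_abs_bil_cut_le (hB : IsCovProcess P B μ) (F : CylVar T P X μ) (i : Fin F.n) :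
    ∃ C, 0 ≤ C ∧ ∀ M p q, |bil μ (cut (F.level M) (F.φ i)) (incrFun p q)| ≤ C := by
  set a := ∫ p, |F.φ i p.1 * F.φ i p.2| ∂μ.totalVariation
  refine ⟨√(a * (1 * 1 * μ.totalVariation.real univ)), Real.sqrt_nonneg _, fun M p q => ?_⟩
  refine (Real.abs_le_sqrt (hB.bil_sq_le (F.isBM_cut_level M i) (isBM_incrFun p q))).trans
    (Real.sqrt_le_sqrt ?_)
  refine mul_le_mul (bil_cut_cut_le (F.memL i) _) ((le_abs_self _).trans
    (abs_bil_le (abs_incrFun_le _ _) (abs_incrFun_le _ _))) (hB.bil_nonneg (isBM_incrFun p q))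
    (integral_nonneg fun p => abs_nonneg _)

/-- The pairing of a Wiener integral with the averages of `U`. -/
def CylVar.avgCov (F : CylVar T P X μ) (B : ℝ → Ω → ℝ) (u : ℝ → ℝ) (ε : ℝ) (i : Fin F.n) : ℝ :=
  ε⁻¹ * ∫ s in Icc 0 T, u s * F.cov B s (s + ε) i

lemma measurable_bil_incrFun {ψ : ℝ → ℝ} (hψ : Measurable ψ) (ε : ℝ) :
    Measurable fun s => bil μ ψ (incrFun s (s + ε)) :=
  Measurable.integral_right (f := fun s p => ψ p.1 * incrFun s (s + ε) p.2 * sgn μ p)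
    (((hψ.comp (measurable_fst.comp measurable_snd)).mul (measurable_fst.incrFun
      (measurable_fst.add_const _) (measurable_snd.comp measurable_snd))).mul
      ((measurable_sgn μ).comp measurable_snd))

lemma CylVar.measurable_cov [IsFiniteMeasure P] (hB : IsCovProcess P B μ)
    (hBX : ∀ t ∈ Icc 0 T, B t =ᵐ[P] X t) (F : CylVar T P X μ) (ε : ℝ) (i : Fin F.n) :
    Measurable fun s => F.cov B s (s + ε) i :=
  measurable_of_tendsto_metrizable (fun M => measurable_bil_incrFun (F.isBM_cut_level M i).1 ε)
    (tendsto_pi_nhds.2 fun s => F.tendsto_cov hB hBX s (s + ε) i)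

lemma CylVar.tendsto_avgCov [IsFiniteMeasure P] (hB : IsCovProcess P B μ)
    (hBX : ∀ t ∈ Icc 0 T, B t =ᵐ[P] X t) (F : CylVar T P X μ) {u : ℝ → ℝ} (hu : IsBM u) (ε : ℝ)
    (i : Fin F.n) :
    Tendsto (fun M => bil μ (cut (F.level M) (F.φ i)) (avg T ε u)) atTop
      (𝓝 (F.avgCov B u ε i)) := by
  simp_rw [bil_avg_right ε (F.isBM_cut_level _ i) hu]
  refine Tendsto.const_mul _ ?_
  obtain ⟨hum, C, hC⟩ := hu
  obtain ⟨A, hA0, hA⟩ := F.exists_abs_bil_cut_le hB i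
  refine tendsto_integral_of_dominated_convergence (fun _ => C * A) (fun M => ?_)
    (integrable_const _) (fun M => ae_of_all _ fun s => ?_) (ae_of_all _ fun s => ?_)
  · exact (hum.mul (measurable_bil_incrFun (F.isBM_cut_level M i).1 ε)).aestronglyMeasurable
  · rw [norm_mul]
    exact mul_le_mul (hC s) (hA _ _ _) (abs_nonneg _) ((abs_nonneg _).trans (hC s))
  · exact (F.tendsto_cov hB hBX s (s + ε) i).const_mul _

lemma CylVar.tendsto_bil_cut_deriv_avg [IsFiniteMeasure P] (hB : IsCovProcess P B μ)
    (hBX : ∀ t ∈ Icc 0 T, B t =ᵐ[P] X t) (F : CylVar T P X μ) {u : ℝ → ℝ} (hu : IsBM u) (ε : ℝ)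
    (ω : Ω) :
    Tendsto (fun M => bil μ (cut (F.level M) (F.deriv ω)) (avg T ε u)) atTop
      (𝓝 (fderiv ℝ F.f (fun j => F.W j ω) (F.avgCov B u ε))) := by
  simp_rw [F.bil_cut_deriv _ _ (isBM_avg T ε hu)]
  exact ((fderiv ℝ F.f _).continuous.tendsto _).comp
    (tendsto_pi_nhds.2 fun i => F.tendsto_avgCov hB hBX hu ε i)

namespace IsRegularProc

variable (h : IsRegularProc T P X B μ U D R)
include h

/-- The duality formula at almost every time s, integrated over s. Expanding in the finitely many
directions of `F` leaves products of square integrable factors, for which Fubini is immediate. -/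
lemma integral_val_mul_approxDiv [IsProbabilityMeasure P] (hB : IsCovProcess P B μ)
    (hBX : ∀ t ∈ Icc 0 T, B t =ᵐ[P] X t) (F : CylVar T P X μ) (ε : ℝ) :
    ∫ ω, F.val ω * approxDiv T B μ U D ε ω ∂P =
      ∫ ω, fderiv ℝ F.f (fun j => F.W j ω) (F.avgCov B (fun s => U s ω) ε) ∂P := by
  set a : Fin F.n → Ω → ℝ := fun i ω => fderiv ℝ F.f (fun j => F.W j ω) (Pi.single i 1) with ha
  have ha2 : ∀ i, MemLp (a i) 2 P := fun i => by
    obtain ⟨C, -, hC⟩ := F.smooth.exists_bound_fderiv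
    refine MemLp.of_bound (F.aestronglyMeasurable_comp (F.smooth.continuous_fderiv.clm_apply
      continuous_const)) (C * ‖(Pi.single i 1 : Fin F.n → ℝ)‖) (ae_of_all _ fun ω => ?_)
    exact (ContinuousLinearMap.le_opNorm _ _).trans
      (mul_le_mul_of_nonneg_right (hC _) (norm_nonneg _))
  set G : Fin F.n → ℝ → Ω → ℝ := fun i s ω => U s ω * F.cov B s (s + ε) i with hG
  have hGm : ∀ i, Measurable (Function.uncurry (G i)) := fun i =>
    h.measU.mul ((F.measurable_cov hB hBX ε i).comp measurable_fst)
  have hG2 : ∀ i, MemLp (fun z : ℝ × Ω => G i z.1 z.2) 2 ((volume.restrict (Icc 0 T)).prod P) := by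
    intro i
    obtain ⟨A, hA0, hA⟩ := F.exists_abs_bil_cut_le hB i
    have hA' : ∀ s, |F.cov B s (s + ε) i| ≤ A := fun s =>
      le_of_tendsto' (F.tendsto_cov hB hBX s (s + ε) i).abs fun M => hA M _ _
    refine ((h.memLpR.comp_snd (volume.restrict (Icc 0 T))).mul_const A).mono
      (hGm i).aestronglyMeasurable (ae_of_all _ fun z => ?_)
    rw [norm_mul, norm_mul]
    exact mul_le_mul ((h.leU _ _).trans (le_abs_self _)) ((hA' _).trans (le_abs_self _))
      (abs_nonneg _) (norm_nonneg _)
  have e1 : ∀ ω, fderiv ℝ F.f (fun j => F.W j ω) (F.avgCov B (fun s => U s ω) ε) =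
      ∑ i, ε⁻¹ * (a i ω * ∫ s in Icc 0 T, G i s ω) := fun ω => by
    rw [fderiv_apply_eq_sum]
    refine Finset.sum_congr rfl fun i _ => ?_
    simp only [CylVar.avgCov, ha, hG]; ring
  have e2 : ∀ ω, F.val ω * approxDiv T B μ U D ε ω =
      ε⁻¹ * (F.val ω * ∫ s in Icc 0 T, localDiv B μ U D ε s ω) := fun ω => by
    simp only [approxDiv]; ring
  simp_rw [e1, e2]
  have hi : ∀ i, Integrable (fun ω => a i ω * ∫ s in Icc 0 T, G i s ω) P := fun i =>
    (ha2 i).integrable_mul_two ((hG2 i).integral_param (hGm i))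
  rw [integral_finsetSum _ fun i _ => (hi i).const_mul _, integral_const_mul]
  simp_rw [integral_const_mul]
  rw [← Finset.mul_sum, integral_mul_integral (h.memLp_localDiv hB hBX ε) F.memLp_val]
  simp_rw [fun i => integral_mul_integral (hG2 i) (ha2 i)]
  congr 1
  rw [← integral_finsetSum]
  · refine integral_congr_ae ?_
    filter_upwards [h.hasDirDeriv] with s hs
    refine (hs.duality hB hBX F s (s + ε)).trans ?_
    rw [← integral_finsetSum]
    · refine integral_congr_ae (ae_of_all _ fun ω => ?_)
      simp only [CylVar.dirDeriv]
      rw [fderiv_apply_eq_sum, Finset.mul_sum]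
      refine Finset.sum_congr rfl fun i _ => ?_
      simp only [ha, hG]; ring
    · intro i _
      refine (ha2 i).integrable_mul_two (hs.memLp.mul_const _)
  · intro i _
    have h1 : MemLp (fun z : ℝ × Ω => a i z.2) 2 ((volume.restrict (Icc 0 T)).prod P) :=
      (ha2 i).comp_snd _
    exact (h1.integrable_mul_two (hG2 i)).integral_prod_left

lemma tendsto_bil_avg_sub (hB : IsCovProcess P B μ) {ω : Ω}
    (h1 : ∀ᵐ b ∂marginal μ,
      Tendsto (fun ε => avg T ε (fun s => U s ω) b) (𝓝[≠] 0) (𝓝 (U b ω))) :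
    Tendsto (fun ε => bil μ (fun b => avg T ε (fun s => U s ω) b - U b ω)
      (fun b => avg T ε (fun s => U s ω) b - U b ω)) (𝓝[≠] 0) (𝓝 0) := by
  refine tendsto_of_seq_tendsto fun ε hε => ?_
  have hU := h.isBM_U ω
  have m : ∀ n, Measurable fun b => avg T (ε n) (fun s => U s ω) b - U b ω := fun n =>
    ((isBM_avg T (ε n) hU).sub hU).1
  have b : ∀ n b, |avg T (ε n) (fun s => U s ω) b - U b ω| ≤ R ω + R ω := fun n b =>
    (abs_sub _ _).trans (add_le_add (abs_avg_le T _ (fun s => h.leU s ω) b) (h.leU b ω))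
  have l : ∀ᵐ b ∂marginal μ,
      Tendsto (fun n => avg T (ε n) (fun s => U s ω) b - U b ω) atTop (𝓝 0) := by
    filter_upwards [h1] with b hb
    simpa using! (hb.comp hε).sub_const (U b ω)
  have := bil_tendsto (μ := μ) (ψ := fun _ => 0) (χ := fun _ => 0)
    (ψ' := fun n b => avg T (ε n) (fun s => U s ω) b - U b ω)
    (χ' := fun n b => avg T (ε n) (fun s => U s ω) b - U b ω) m b m b
    (hB.ae_fst (p := fun b => Tendsto (fun n => avg T (ε n) (fun s => U s ω) b - U b ω) atTop
      (𝓝 0)) l) (ae_snd_of_marginal (p := fun b =>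
      Tendsto (fun n => avg T (ε n) (fun s => U s ω) b - U b ω) atTop (𝓝 0)) l)
  rwa [bil_zero_left] at this

/-- The directions of `F` may be unbounded, so the averages cannot simply be replaced by their limit
under the integral. Cauchy-Schwarz with a constant independent of the cut level reduces the claim to
the convergence of the averages in the norm of H. -/
lemma tendsto_fderiv_avgCov [IsProbabilityMeasure P] (hB : IsCovProcess P B μ)
    (hBX : ∀ t ∈ Icc 0 T, B t =ᵐ[P] X t) (F : CylVar T P X μ) {ω : Ω}
    (h1 : ∀ᵐ b ∂marginal μ,
      Tendsto (fun ε => avg T ε (fun s => U s ω) b) (𝓝[≠] 0) (𝓝 (U b ω)))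
    (hi : Integrable (fun p : ℝ × ℝ => F.deriv ω p.1 * U p.2 ω) μ.totalVariation) :
    Tendsto (fun ε => fderiv ℝ F.f (fun j => F.W j ω) (F.avgCov B (fun s => U s ω) ε)) (𝓝[≠] 0)
      (𝓝 (innerH μ (F.deriv ω) fun t => U t ω)) := by
  obtain ⟨K, hK0, hK⟩ := F.exists_bil_cut_deriv_le hB
  have hU := h.isBM_U ω
  rw [tendsto_iff_dist_tendsto_zero]
  have hz := ((h.tendsto_bil_avg_sub hB h1).sqrt).const_mul K
  rw [Real.sqrt_zero, mul_zero] at hz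
  refine squeeze_zero (fun _ => dist_nonneg) (fun ε => ?_) hz
  rw [Real.dist_eq, innerH_eq_bil (ψ := F.deriv ω) (χ := fun t => U t ω) hi]
  have l2 := tendsto_bil_cut (μ := μ) (F.measurable_deriv ω) hU.1 hi F.measurableSet_level
    F.eventually_mem_level
  refine le_of_tendsto' ((F.tendsto_bil_cut_deriv_avg hB hBX hU ε ω).sub l2).abs fun M => ?_
  rw [← (F.isBM_cut_deriv M ω).bil_sub_right (μ := μ) (isBM_avg T ε hU) hU]
  exact hK M ω _ ((isBM_avg T ε hU).sub hU)

lemma abs_fderiv_avgCov_le [IsProbabilityMeasure P] (hB : IsCovProcess P B μ)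
    (hBX : ∀ t ∈ Icc 0 T, B t =ᵐ[P] X t) (F : CylVar T P X μ) : ∃ K, ∀ ε ω,
    |fderiv ℝ F.f (fun j => F.W j ω) (F.avgCov B (fun s => U s ω) ε)| ≤ K * R ω := by
  obtain ⟨K, hK0, hK⟩ := F.exists_bil_cut_deriv_le hB
  refine ⟨K * √(μ.totalVariation.real univ), fun ε ω => ?_⟩
  have hU := h.isBM_U ω
  refine le_of_tendsto' (F.tendsto_bil_cut_deriv_avg hB hBX hU ε ω).abs fun M => ?_
  refine (hK M ω _ (isBM_avg T ε hU)).trans ?_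
  rw [mul_assoc]
  refine mul_le_mul_of_nonneg_left ?_ hK0
  have := (le_abs_self _).trans (abs_bil_le (μ := μ) (abs_avg_le T ε fun s => h.leU s ω)
    (abs_avg_le T ε fun s => h.leU s ω))
  refine (Real.sqrt_le_sqrt this).trans ?_
  rw [Real.sqrt_mul (mul_self_nonneg _), Real.sqrt_mul_self (h.nonneg ω), mul_comm]

/-- The limit of the approximations of the divergence is the Skorohod integral. -/
lemma isSkorohodIntegral [IsProbabilityMeasure P] (hB : IsCovProcess P B μ)
    (hBX : ∀ t ∈ Icc 0 T, B t =ᵐ[P] X t) {S : Ω → ℝ} (hS : MemLp S 2 P)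
    (hlim : Tendsto (fun ε => eLpNorm (S - approxDiv T B μ U D ε) 2 P) (𝓝[≠] 0) (𝓝 0)) :
    IsSkorohodIntegral T P X μ U S := by
  have dual : ∀ F : CylVar T P X μ,
      Integrable (fun q : Ω × ℝ × ℝ => F.deriv q.1 q.2.1 * U q.2.2 q.1)
        (P.prod μ.totalVariation) →
      ∫ ω, F.val ω * S ω ∂P = ∫ ω, innerH μ (F.deriv ω) (fun t => U t ω) ∂P := by
    intro F hF
    have l1 := tendsto_integral_mul (fun _ => F.memLp_val) F.memLp_val
      (fun ε => h.memLp_approxDiv hB hBX ε) hS (by simp) hlim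
    refine tendsto_nhds_unique l1 ?_
    simp_rw [h.integral_val_mul_approxDiv hB hBX F]
    obtain ⟨K, hK⟩ := h.abs_fderiv_avgCov_le hB hBX F
    refine tendsto_integral_filter_of_dominated_convergence (fun ω => K * R ω)
      (Eventually.of_forall fun ε => ?_) (Eventually.of_forall fun ε => ae_of_all _ fun ω => hK ε ω)
      ((h.memLpR.integrable one_le_two).const_mul K) ?_
    · refine AEStronglyMeasurable.congr ?_
        (ae_of_all _ fun ω => (fderiv_apply_eq_sum _ (F.avgCov B (fun s => U s ω) ε)).symm)
      refine Finset.aestronglyMeasurable_fun_sum _ fun i _ => AEStronglyMeasurable.mul ?_ ?_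
      · exact F.aestronglyMeasurable_comp (F.smooth.continuous_fderiv.clm_apply continuous_const)
      · refine (Measurable.const_mul (Measurable.integral_right (f := fun ω s =>
          U s ω * F.cov B s (s + ε) i) ?_) _).aestronglyMeasurable
        exact (h.measU.comp measurable_swap).mul
          ((F.measurable_cov hB hBX ε i).comp measurable_snd)
    · filter_upwards [h.avgU, hF.prod_right_ae] with ω h1 h2
      exact h.tendsto_fderiv_avgCov hB hBX F h1 h2
  refine ⟨h.measU, ?_, hS, ?_, dual⟩
  · have hle : ∀ ω, absNormSq μ (fun t => U t ω) ≤ ‖R ω‖ₑ ^ 2 * μ.totalVariation univ := by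
      intro ω
      rw [absNormSq, ← lintegral_const]
      refine lintegral_mono fun p => ?_
      have : ∀ s, ‖U s ω‖ₑ ≤ ‖R ω‖ₑ := fun s => by
        rw [enorm_le_iff_norm_le]
        exact (h.leU s ω).trans (le_abs_self _)
      rw [pow_two]
      exact mul_le_mul' (this _) (this _)
    refine (lintegral_mono hle).trans_lt ?_
    rw [lintegral_mul_const _ (h.measR.enorm.pow_const 2)]
    refine ENNReal.mul_lt_top ?_ (measure_lt_top _ _)
    have := h.memLpR.integrable_sq.2
    simpa [HasFiniteIntegral, enorm_pow] using this
  -- The constant 1, with no direction at all, as a test variable: duality gives zero mean.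
  · let F : CylVar T P X μ :=
      { n := 0
        f := fun _ => 1
        smooth := ⟨contDiff_const, fun k => by
          rcases k with _ | k
          · exact ⟨1, fun x => by simp⟩
          · exact ⟨0, fun x => by simp [iteratedFDeriv_succ_const]⟩⟩
        φ := Fin.elim0
        memL := fun i => i.elim0
        W := Fin.elim0
        wiener := fun i => i.elim0 }
    have h0 : ∀ ω t, F.deriv ω t = 0 := fun ω t => by simp [CylVar.deriv, F]
    have := dual F (by simp [h0])
    have h1 : ∀ ω, F.deriv ω = fun _ => 0 := fun ω => funext (h0 ω)
    have h2 : ∀ ω, innerH μ (F.deriv ω) (fun t => U t ω) = 0 := fun ω => by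
      rw [innerH_eq_bil (ψ := F.deriv ω) (χ := fun t => U t ω) (by simp [h0]), h1, bil_zero_left]
    simpa [CylVar.val, F, h2] using this

/-- The regularized integral is the approximation of the divergence plus a trace term. -/
lemma regularized_eq (hB : IsCovProcess P B μ) (ε : ℝ) (ω : Ω) :
    ε⁻¹ * ∫ s in Icc 0 T, U s ω * (B (s + ε) ω - B s ω) =
      approxDiv T B μ U D ε ω + ∫ p, avg T ε (D ω p.1) p.2 * sgn μ p ∂μ.totalVariation := by
  rw [← integral_avg_mul_sgn ε (h.measurable_D ω) (h.leD ω), approxDiv, ← mul_add, ← integral_add]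
  · congr 2 with s
    simp [localDiv, divg, dirD]
  · refine Integrable.sub ?_ ?_
    · have hc : Continuous fun s => B (s + ε) ω - B s ω :=
        ((hB.cont ω).comp (continuous_add_const ε)).sub (hB.cont ω)
      exact (hc.continuousOn.integrableOn_compact isCompact_Icc).bdd_mul (c := R ω)
        (h.isBM_U ω).1.aestronglyMeasurable (ae_of_all _ fun s => h.leU s ω)
    · exact integrable_mul_of_bound (h.measurable_dirD measurable_id measurable_id
        (measurable_id.add_const ε) measurable_const) fun s => h.abs_dirD_le s s (s + ε) ω
  · exact integrable_mul_of_bound (h.measurable_dirD measurable_id measurable_id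
        (measurable_id.add_const ε) measurable_const) fun s => h.abs_dirD_le s s (s + ε) ω

end IsRegularProc

end Skorohod

/-! ### Trigonometric test functions -/

section Trig

lemma abs_iteratedDeriv_sin_cos_le (k : ℕ) (x : ℝ) :
    |iteratedDeriv k Real.sin x| ≤ 1 ∧ |iteratedDeriv k Real.cos x| ≤ 1 := by
  induction k with
  | zero => simpa using ⟨Real.abs_sin_le_one x, Real.abs_cos_le_one x⟩
  | succ k ih =>
    rw [Real.iteratedDeriv_add_one_sin, Real.iteratedDeriv_add_one_cos]
    simpa using ⟨ih.2, ih.1⟩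

lemma isSmoothBounded_comp {g : ℝ → ℝ} (hg : ContDiff ℝ (⊤ : ℕ∞) g)
    (hb : ∀ k x, |iteratedDeriv k g x| ≤ 1) :
    IsSmoothBounded fun x : Fin 1 → ℝ => g (x 0) := by
  let p : (Fin 1 → ℝ) →L[ℝ] ℝ := ContinuousLinearMap.proj 0
  have e : (fun x : Fin 1 → ℝ => g (x 0)) = g ∘ p := rfl
  rw [e]
  refine ⟨hg.comp p.contDiff, fun k => ⟨1 * ∏ _i : Fin k, ‖p‖, fun x => ?_⟩⟩
  rw [p.iteratedFDeriv_comp_right hg x (i := k) (by exact_mod_cast le_top)]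
  refine (ContinuousMultilinearMap.norm_compContinuousLinearMap_le _ _).trans ?_
  refine mul_le_mul_of_nonneg_right ?_ (Finset.prod_nonneg fun _ _ => norm_nonneg _)
  rw [norm_iteratedFDeriv_eq_norm_iteratedDeriv]
  exact hb k _

end Trig

/-! ### Uniqueness of the Skorohod integral -/

section Uniqueness

variable {Ω : Type*} [MeasurableSpace Ω] {T : ℝ} {P : Measure Ω} {X B : ℝ → Ω → ℝ}
  {μ : SignedMeasure (ℝ × ℝ)}

lemma StepFun.isWienerIntegral (hB : IsCovProcess P B μ) (hBX : ∀ t ∈ Icc 0 T, B t =ᵐ[P] X t)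
    (g : StepFun T) : IsWienerIntegral T P X μ g.val (g.integral X) := by
  refine ⟨(hB.memLp_path g).ae_eq (g.integral_ae_eq hBX).symm, fun _ => g, fun _ => ?_, ?_, ?_⟩
  · simp [MemL, absNormSq, measurable_zero]
  · have : innerH μ (g.val - g.val) (g.val - g.val) = 0 := by
      rw [innerH_eq_bil (by simp)]
      simp [bil]
    simp only [this, tendsto_const_nhds]
  · simp

lemma StepFun.memL (g : StepFun T) : MemL μ g.val := by
  refine ⟨g.isBM.1, ?_⟩
  have := (g.isBM.integrable (μ := μ) g.isBM).2
  simpa [HasFiniteIntegral, enorm_mul, absNormSq] using this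

/-- A smooth bounded function of the integral of a step function. -/
def StepFun.cylVar (hB : IsCovProcess P B μ) (hBX : ∀ t ∈ Icc 0 T, B t =ᵐ[P] X t) (g : StepFun T)
    {f : ℝ → ℝ} (hf : IsSmoothBounded fun x : Fin 1 → ℝ => f (x 0)) : CylVar T P X μ where
  n := 1
  f := fun x => f (x 0)
  smooth := hf
  φ := fun _ => g.val
  memL := fun _ => g.memL
  W := fun _ => g.integral X
  wiener := fun _ => g.isWienerIntegral hB hBX

/-- A step function is a bounded direction, so the duality pairing converges absolutely and both
integrals satisfy it with the same right-hand side. -/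
lemma StepFun.integral_cylVar_mul [IsProbabilityMeasure P] (hB : IsCovProcess P B μ)
    (hBX : ∀ t ∈ Icc 0 T, B t =ᵐ[P] X t) {u : ℝ → Ω → ℝ} {S S' : Ω → ℝ}
    (hu : Integrable (fun q : Ω × ℝ × ℝ => u q.2.2 q.1) (P.prod μ.totalVariation))
    (hS : IsSkorohodIntegral T P X μ u S) (hS' : IsSkorohodIntegral T P X μ u S')
    (g : StepFun T) {f : ℝ → ℝ} (hf : IsSmoothBounded fun x : Fin 1 → ℝ => f (x 0)) :
    ∫ ω, f (g.integral X ω) * (S ω - S' ω) ∂P = 0 := by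
  set F := g.cylVar hB hBX hf with hF
  have hi : Integrable (fun q : Ω × ℝ × ℝ => F.deriv q.1 q.2.1 * u q.2.2 q.1)
      (P.prod μ.totalVariation) := by
    obtain ⟨C, hC0, hC⟩ := F.smooth.exists_bound_fderiv
    obtain ⟨hgm, A, hA⟩ := g.isBM
    have hd : ∀ ω r, F.deriv ω r = fderiv ℝ F.f (fun j => F.W j ω) (Pi.single (0 : Fin 1) 1) *
        g.val r := fun ω r => Fin.sum_univ_one _
    refine hu.bdd_mul (c := C * ‖(Pi.single 0 1 : Fin 1 → ℝ)‖ * A) ?_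
      (ae_of_all _ fun q => ?_)
    · simp only [hd]
      have h1 : AEStronglyMeasurable (fun ω => fderiv ℝ F.f (fun j => F.W j ω)
          (Pi.single (0 : Fin 1) 1)) P := F.aestronglyMeasurable_comp
        (F.smooth.continuous_fderiv.clm_apply continuous_const)
      exact h1.comp_fst.mul (hgm.comp (measurable_fst.comp measurable_snd)).aestronglyMeasurable
    · rw [hd, norm_mul]
      refine mul_le_mul ?_ (hA _) (norm_nonneg _) (by positivity)
      exact (ContinuousLinearMap.le_opNorm _ _).trans
        (mul_le_mul_of_nonneg_right (hC _) (norm_nonneg _))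
  have h1 := hS.duality F hi
  have h2 := hS'.duality F hi
  have e : ∀ ω, f (g.integral X ω) * (S ω - S' ω) = F.val ω * S ω - F.val ω * S' ω := fun ω => by
    rw [← mul_sub]; rfl
  simp_rw [e]
  rw [integral_sub (F.memLp_val.integrable_mul_two hS.memLp)
    (F.memLp_val.integrable_mul_two hS'.memLp), h1, h2, sub_self]

/-- The step function with integral `∑ c_t (X_t - X_0)`. -/
def StepFun.ofFinset (T : ℝ) (I : Finset (Icc (0 : ℝ) T)) (c : I → ℝ) : StepFun T where
  n := Fintype.card I
  c := fun i => c ((Fintype.equivFin I).symm i)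
  a := fun _ => 0
  b := fun i => ((Fintype.equivFin I).symm i : Icc (0 : ℝ) T)
  zero_le := fun _ => le_rfl
  le := fun i => ((Fintype.equivFin I).symm i : Icc (0 : ℝ) T).2.1
  le_end := fun i => ((Fintype.equivFin I).symm i : Icc (0 : ℝ) T).2.2

omit [MeasurableSpace Ω] in
lemma StepFun.integral_ofFinset (I : Finset (Icc (0 : ℝ) T)) (c : I → ℝ) (ω : Ω) :
    (StepFun.ofFinset T I c).integral X ω = ∑ t : I, c t * (X (t : Icc (0 : ℝ) T) ω - X 0 ω) :=
  (Fintype.equivFin I).symm.sum_comp fun t : I => c t * (X (t : Icc (0 : ℝ) T) ω - X 0 ω)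

/-- An integrable variable that is orthogonal to the trigonometric functions of the process
vanishes. -/
lemma ae_eq_zero_of_integral_trig [IsProbabilityMeasure P] {ι : Type*} {Z : ι → Ω → ℝ}
    (hZ : ∀ t, Measurable (Z t))
    (hF : ∀ A : Set Ω, MeasurableSet A → ∃ A' : Set Ω,
      MeasurableSet[⨆ t, MeasurableSpace.comap (Z t) inferInstance] A' ∧ A =ᵐ[P] A')
    {V : Ω → ℝ} (hV : Integrable V P)
    (h : ∀ (I : Finset ι) (c : I → ℝ), ∫ ω, Real.cos (∑ t : I, c t * Z t ω) * V ω ∂P = 0 ∧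
      ∫ ω, Real.sin (∑ t : I, c t * Z t ω) * V ω ∂P = 0) :
    V =ᵐ[P] 0 := by
  classical
  have aux : ∀ V : Ω → ℝ, Integrable V P →
      IsFiniteMeasure (P.withDensity fun ω => ((V ω).toNNReal : ℝ≥0∞)) := fun V hV =>
    isFiniteMeasure_withDensity_ofReal hV.2
  have hV' : Integrable (fun ω => -V ω) P := hV.neg
  have := aux V hV
  have := aux _ hV'
  -- The positive and negative parts of V as densities. Orthogonality to sines and cosines says that
  -- the two measures have the same finite-dimensional characteristic functions.
  set ρ := P.withDensity fun ω => ((V ω).toNNReal : ℝ≥0∞) with hρ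
  set ρ' := P.withDensity fun ω => ((-V ω).toNNReal : ℝ≥0∞) with hρ'
  set Φ : Ω → ι → ℝ := fun ω t => Z t ω with hΦ
  have hΦm : Measurable Φ := measurable_pi_lambda _ hZ
  have hpos : ∀ {V : Ω → ℝ}, Integrable V P → Integrable (fun ω => ((V ω).toNNReal : ℝ)) P :=
    fun hV => hV.real_toNNReal
  have hsub : ∀ ω, ((V ω).toNNReal : ℝ) - ((-V ω).toNNReal : ℝ) = V ω := fun ω => by
    simp only [Real.coe_toNNReal']
    exact max_zero_sub_max_neg_zero_eq_self _
  have hmap : ρ.map Φ = ρ'.map Φ := by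
    -- A finite measure on path space is determined by its finite-dimensional projections.
    refine IsProjectiveLimit.unique (P := fun I : Finset ι => (ρ'.map Φ).map I.restrict)
      (fun I => ?_) fun I => rfl
    have hIm : Measurable fun ω => I.restrict (Φ ω) := (Finset.measurable_restrict I).comp hΦm
    change (ρ.map Φ).map I.restrict = (ρ'.map Φ).map I.restrict
    rw [Measure.map_map (Finset.measurable_restrict I) hΦm,
      Measure.map_map (Finset.measurable_restrict I) hΦm]
    refine Measure.ext_of_charFunDual ?_
    ext L
    have hL : ∀ ω, L (I.restrict (Φ ω)) = ∑ t : I, L (Pi.single t 1) * Z t ω := fun ω => by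
      conv_lhs => rw [← Finset.univ_sum_single (I.restrict (Φ ω)), map_sum]
      refine Finset.sum_congr rfl fun t _ => ?_
      have : (Pi.single t (I.restrict (Φ ω) t) : I → ℝ) =
          I.restrict (Φ ω) t • Pi.single t (1 : ℝ) := by
        rw [← Pi.single_smul, smul_eq_mul, mul_one]
      rw [this, map_smul, smul_eq_mul, mul_comm]
      rfl
    obtain ⟨h1, h2⟩ := h I fun t => L (Pi.single t 1)
    simp_rw [← hL] at h1 h2
    have hcm : Measurable fun ω => L (I.restrict (Φ ω)) := L.continuous.measurable.comp hIm
    have hexp : Measurable fun ω => Complex.exp (L (I.restrict (Φ ω)) * Complex.I) :=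
      (((Complex.measurable_ofReal.comp hcm)).mul_const _).cexp
    have hint : ∀ {V : Ω → ℝ}, Integrable V P → Integrable (fun ω =>
        (V ω).toNNReal • Complex.exp (L (I.restrict (Φ ω)) * Complex.I)) P := fun {V} hV => by
      refine (hpos hV).mono' ?_ (ae_of_all _ fun ω => ?_)
      · exact (hV.1.aemeasurable.real_toNNReal.aestronglyMeasurable).smul
          hexp.aestronglyMeasurable
      · rw [NNReal.smul_def, norm_smul, Complex.norm_exp_ofReal_mul_I, mul_one]
        exact (abs_of_nonneg (NNReal.coe_nonneg _)).le
    rw [charFunDual_apply, charFunDual_apply,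
      integral_map ((Finset.measurable_restrict I).comp hΦm).aemeasurable (by fun_prop),
      integral_map ((Finset.measurable_restrict I).comp hΦm).aemeasurable (by fun_prop)]
    simp only [Function.comp_apply]
    rw [hρ, hρ', integral_withDensity_eq_integral_smul₀ hV.1.aemeasurable.real_toNNReal,
      integral_withDensity_eq_integral_smul₀ hV'.1.aemeasurable.real_toNNReal, ← sub_eq_zero,
      ← integral_sub (hint hV) (hint hV')]
    have e : ∀ ω, (V ω).toNNReal • Complex.exp (L (I.restrict (Φ ω)) * Complex.I) -
        (-V ω).toNNReal • Complex.exp (L (I.restrict (Φ ω)) * Complex.I) =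
        ((Real.cos (L (I.restrict (Φ ω))) * V ω : ℝ) : ℂ) +
        ((Real.sin (L (I.restrict (Φ ω))) * V ω : ℝ) : ℂ) * Complex.I := fun ω => by
      rw [NNReal.smul_def, NNReal.smul_def, ← sub_smul, hsub, Complex.exp_mul_I]
      simp only [Complex.real_smul]
      push_cast
      ring
    simp_rw [e]
    have i1 : Integrable (fun ω => Real.cos (L (I.restrict (Φ ω))) * V ω) P :=
      hV.bdd_mul (c := 1) (Real.measurable_cos.comp hcm).aestronglyMeasurable
        (ae_of_all _ fun ω => Real.abs_cos_le_one _)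
    have i2 : Integrable (fun ω => Real.sin (L (I.restrict (Φ ω))) * V ω) P :=
      hV.bdd_mul (c := 1) (Real.measurable_sin.comp hcm).aestronglyMeasurable
        (ae_of_all _ fun ω => Real.abs_sin_le_one _)
    rw [integral_add i1.ofReal (i2.ofReal.mul_const _), integral_mul_const, integral_complex_ofReal,
      integral_complex_ofReal, h1, h2]
    simp
  refine ae_eq_zero_of_forall_setIntegral_eq_of_sigmaFinite (fun A _ _ => hV.integrableOn)
    fun A hA _ => ?_
  obtain ⟨A', hA', hAA'⟩ := hF A hA
  rw [setIntegral_congr_set hAA']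
  have hcomap : (⨆ t, MeasurableSpace.comap (Z t) inferInstance : MeasurableSpace Ω) =
      MeasurableSpace.comap Φ MeasurableSpace.pi := by
    simp only [MeasurableSpace.pi, MeasurableSpace.comap_iSup, MeasurableSpace.comap_comp]
    rfl
  rw [hcomap] at hA'
  obtain ⟨E, hE, rfl⟩ := hA'
  have hEm := hΦm hE
  have e1 := congrArg (fun m : Measure (ι → ℝ) => m.real E) hmap
  simp only [Measure.real, Measure.map_apply hΦm hE] at e1
  have e2 : ∀ {V : Ω → ℝ}, Integrable V P →
      ((P.withDensity fun ω => ((V ω).toNNReal : ℝ≥0∞)) (Φ ⁻¹' E)).toReal =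
      ∫ ω in Φ ⁻¹' E, ((V ω).toNNReal : ℝ) ∂P := fun {V} hV => by
    rw [withDensity_apply _ hEm, integral_eq_lintegral_of_nonneg_ae
      (ae_of_all _ fun ω => NNReal.coe_nonneg _) (hpos hV).1.restrict]
    congr with ω
    rw [ENNReal.ofReal_coe_nnreal]
  rw [hρ, hρ', e2 hV, e2 hV', ← sub_eq_zero,
    ← integral_sub (hpos hV).integrableOn (hpos hV').integrableOn] at e1
  simpa only [hsub] using e1

/-- Uniqueness of the Skorohod integral. -/
lemma IsSkorohodIntegral.ae_eq [IsProbabilityMeasure P] (hB : IsCovProcess P B μ)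
    (hBX : ∀ t ∈ Icc 0 T, B t =ᵐ[P] X t) (hX : ∀ t ∈ Icc 0 T, Measurable (X t))
    (hX0 : ∀ᵐ ω ∂P, X 0 ω = 0)
    (hF : ∀ A : Set Ω, MeasurableSet A → ∃ A' : Set Ω,
      MeasurableSet[⨆ t : Icc (0 : ℝ) T, MeasurableSpace.comap (X t) inferInstance] A' ∧
        A =ᵐ[P] A') {u : ℝ → Ω → ℝ} {S S' : Ω → ℝ}
    (hu : Integrable (fun q : Ω × ℝ × ℝ => u q.2.2 q.1) (P.prod μ.totalVariation))
    (hS : IsSkorohodIntegral T P X μ u S) (hS' : IsSkorohodIntegral T P X μ u S') : S =ᵐ[P] S' := by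
  have hV : Integrable (fun ω => S ω - S' ω) P :=
    (hS.memLp.integrable one_le_two).sub (hS'.memLp.integrable one_le_two)
  have key := ae_eq_zero_of_integral_trig (Z := fun t : Icc (0 : ℝ) T => X t)
    (fun t => hX t t.2) hF hV fun I c => ?_
  · filter_upwards [key] with ω hω
    exact sub_eq_zero.1 hω
  · have hc := (StepFun.ofFinset T I c).integral_cylVar_mul hB hBX hu hS hS'
      (isSmoothBounded_comp Real.contDiff_cos fun k x => (abs_iteratedDeriv_sin_cos_le k x).2)
    have hs := (StepFun.ofFinset T I c).integral_cylVar_mul hB hBX hu hS hS'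
      (isSmoothBounded_comp Real.contDiff_sin fun k x => (abs_iteratedDeriv_sin_cos_le k x).1)
    have he : ∀ᵐ ω ∂P, (StepFun.ofFinset T I c).integral X ω =
        ∑ t : I, c t * X (t : Icc (0 : ℝ) T) ω := by
      filter_upwards [hX0] with ω hω
      simp [StepFun.integral_ofFinset, hω]
    constructor
    · refine (integral_congr_ae ?_).trans hc
      filter_upwards [he] with ω hω
      rw [hω]
    · refine (integral_congr_ae ?_).trans hs
      filter_upwards [he] with ω hω
      rw [hω]

end Uniqueness

/-! ### A version with continuous paths on the whole line -/

section Regularize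

variable {Ω : Type*} [MeasurableSpace Ω] {T : ℝ} {P : Measure Ω} {X : ℝ → Ω → ℝ}
  {μ : SignedMeasure (ℝ × ℝ)}

/-- The projection of the line on `[0,T]`. -/
def clamp (T t : ℝ) : ℝ := max 0 (min T t)

lemma clamp_mem (hT : 0 < T) (t : ℝ) : clamp T t ∈ Icc 0 T :=
  ⟨le_max_left _ _, max_le hT.le (min_le_left _ _)⟩

lemma clamp_of_mem {t : ℝ} (ht : t ∈ Icc 0 T) : clamp T t = t := by
  rw [clamp, min_eq_right ht.2, max_eq_right ht.1]

lemma continuous_clamp : Continuous (clamp T) := by unfold clamp; fun_prop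

lemma IsCovarianceMeasure.apply_Ioc_prod [IsProbabilityMeasure P]
    (hμ : IsCovarianceMeasure T P X μ) (hT : 0 < T) (hX0 : ∀ᵐ ω ∂P, X 0 ω = 0)
    (hXz : ∀ t ∈ Icc 0 T, ∫ ω, X t ω ∂P = 0) (hX2 : ∀ t ∈ Icc 0 T, MemLp (X t) 2 P)
    {a b : ℝ} (ha : a ∈ Icc 0 T) (hb : b ∈ Icc 0 T) :
    μ (Ioc 0 a ×ˢ Ioc 0 b) = ∫ ω, X a ω * X b ω ∂P := by
  have h0 : X 0 =ᵐ[P] fun _ => 0 := hX0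
  have m0 : (0 : ℝ) ∈ Icc 0 T := ⟨le_rfl, hT.le⟩
  rw [hμ.rect 0 a 0 b le_rfl ha.1 ha.2 le_rfl hb.1 hb.2]
  have c1 : ∀ t ∈ Icc 0 T, cov[X 0, X t; P] = 0 := fun t ht => by
    rw [covariance_eq_sub (hX2 0 m0) (hX2 t ht), hXz 0 m0, zero_mul, sub_zero]
    refine integral_eq_zero_of_ae ?_
    filter_upwards [hX0] with ω hω
    simp [hω]
  have c2 : cov[X a, X 0; P] = 0 := by rw [covariance_comm]; exact c1 a ha
  rw [c1 0 m0, c1 b hb, c2, covariance_eq_sub (hX2 a ha) (hX2 b hb), hXz a ha]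
  simp

/-- Only the part inside ]0,T]² counts; clamping an end point is intersecting its half-line with
]0,T]. -/
lemma IsCovarianceMeasure.apply_Iic_prod (hμ : IsCovarianceMeasure T P X μ) (a b : ℝ) :
    μ (Iic a ×ˢ Iic b) = μ (Ioc 0 (clamp T a) ×ˢ Ioc 0 (clamp T b)) := by
  set C : Set (ℝ × ℝ) := Ioc 0 T ×ˢ Ioc 0 T with hC
  have hCm : MeasurableSet C := measurableSet_Ioc.prod measurableSet_Ioc
  have hm : MeasurableSet ((Iic a : Set ℝ) ×ˢ (Iic b : Set ℝ)) :=
    measurableSet_Iic.prod measurableSet_Iic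
  have e : (Iic a ×ˢ Iic b) ∩ C = Ioc 0 (clamp T a) ×ˢ Ioc 0 (clamp T b) := by
    have key : ∀ a x : ℝ, (x ≤ a ∧ 0 < x ∧ x ≤ T) ↔ (0 < x ∧ x ≤ clamp T a) := fun a x => by
      simp only [clamp, le_max_iff, le_min_iff]
      constructor
      · rintro ⟨h1, h2, h3⟩; exact ⟨h2, Or.inr ⟨h3, h1⟩⟩
      · rintro ⟨h1, h2 | ⟨h2, h3⟩⟩
        · linarith
        · exact ⟨h3, h1, h2⟩
    ext ⟨x, y⟩
    have k1 := key a x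
    have k2 := key b y
    simp only [hC, mem_inter_iff, mem_prod, mem_Iic, mem_Ioc]
    tauto
  have h1 := μ.of_sdiff (hm.inter hCm) hm inter_subset_left
  have h2 : μ ((Iic a ×ˢ Iic b) \ ((Iic a ×ˢ Iic b) ∩ C)) = 0 := by
    refine hμ.carried _ (hm.diff (hm.inter hCm)) ?_
    exact disjoint_left.2 fun x hx hx' => hx.2 ⟨hx.1, hx'⟩
  rw [h2] at h1
  rw [← e]; linarith

/-- A version of the process with continuous paths on the whole line. -/
lemma exists_isCovProcess [IsProbabilityMeasure P] (hT : 0 < T)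
    (hXm : ∀ t ∈ Icc 0 T, Measurable (X t))
    (hXc : ∀ᵐ ω ∂P, ContinuousOn (fun t => X t ω) (Icc 0 T))
    (hX0 : ∀ᵐ ω ∂P, X 0 ω = 0)
    (hXG : IsGaussianProcess (fun t : Icc (0 : ℝ) T => X t) P)
    (hXz : ∀ t ∈ Icc 0 T, ∫ ω, X t ω ∂P = 0) (hμ : IsCovarianceMeasure T P X μ) :
    ∃ B : ℝ → Ω → ℝ, IsCovProcess P B μ ∧ ∀ᵐ ω ∂P, ∀ t, B t ω = prolong T X t ω := by
  obtain ⟨N, hN, hNm, hN0⟩ := exists_measurable_superset_of_null (ae_iff.1 hXc)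
  classical
  -- Paths are constant outside [0,T], and zero on a measurable null set containing all
  -- discontinuous paths, so continuity holds for every ω.
  set B : ℝ → Ω → ℝ := fun t => Nᶜ.indicator (X (clamp T t)) with hB
  have hBX : ∀ᵐ ω ∂P, ∀ t, B t ω = X (clamp T t) ω := by
    filter_upwards [measure_eq_zero_iff_ae_notMem.1 hN0] with ω hω t
    exact indicator_of_mem (show ω ∈ Nᶜ from hω) _
  have hBX' : ∀ t, B t =ᵐ[P] X (clamp T t) := fun t => hBX.mono fun ω hω => hω t
  have hX2 : ∀ t ∈ Icc 0 T, MemLp (X t) 2 P := fun t ht =>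
    (hXG.hasGaussianLaw_eval ⟨t, ht⟩).memLp_two
  refine ⟨B, ⟨fun t => (hXm _ (clamp_mem hT t)).indicator hNm.compl, fun ω => ?_, ?_, fun t => ?_,
    fun a b => ?_⟩, hBX⟩
  · by_cases h : ω ∈ N
    · simp [hB, h, continuous_const]
    · have hc : ContinuousOn (fun t => X t ω) (Icc 0 T) := by
        by_contra hcon
        exact h (hN hcon)
      simp only [hB, mem_compl_iff, h, not_false_eq_true, indicator_of_mem]
      exact hc.comp_continuous continuous_clamp fun t => clamp_mem hT t
  · exact (hXG.comp_right fun t : ℝ => (⟨clamp T t, clamp_mem hT t⟩ : Icc (0 : ℝ) T)).congr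
      fun t => (hBX' t).symm
  · rw [integral_congr_ae (hBX' t)]
    exact hXz _ (clamp_mem hT t)
  · have e : (fun ω => B a ω * B b ω) =ᵐ[P] fun ω => X (clamp T a) ω * X (clamp T b) ω := by
      filter_upwards [hBX] with ω hω
      rw [hω, hω]
    rw [integral_congr_ae e, ← hμ.apply_Ioc_prod hT hX0 hXz hX2 (clamp_mem hT a) (clamp_mem hT b),
      ← hμ.apply_Iic_prod, apply_prod_eq_bil measurableSet_Iic measurableSet_Iic]
    rfl

end Regularize

/-! ### Cadlag functions -/

section Cadlag

variable {T : ℝ} {y : ℝ → ℝ}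

/-- Right-continuity extends the bound from rationals to [0,T[; the end point T is the clamp of any
larger rational. -/
lemma IsCadlag.abs_le (h : IsCadlag T y) {C : ℝ} (hC : ∀ q : ℚ, |y (clamp T q)| ≤ C) :
    ∀ t ∈ Icc 0 T, |y t| ≤ C := by
  intro t ht
  have hT : 0 ≤ T := ht.1.trans ht.2
  rcases eq_or_lt_of_le ht.2 with rfl | htT
  · obtain ⟨q, hq⟩ := exists_rat_gt t
    have := hC q
    rwa [clamp, min_eq_left hq.le, max_eq_right hT] at this
  · by_contra! hlt
    have h1 : ∀ᶠ x in 𝓝[>] t, C < |y x| := (h.1 t ⟨ht.1, htT⟩).abs.eventually (lt_mem_nhds hlt)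
    have h2 : ∀ᶠ x in 𝓝[>] t, x < T := mem_nhdsWithin_of_mem_nhds (Iio_mem_nhds htT)
    obtain ⟨u, hu, hsub⟩ := mem_nhdsGT_iff_exists_Ioo_subset.1 (h1.and h2)
    obtain ⟨q, hq1, hq2⟩ := exists_rat_btwn (show t < u from hu)
    obtain ⟨h3, h4⟩ := hsub ⟨hq1, hq2⟩
    have h5 := hC q
    rw [clamp_of_mem ⟨ht.1.trans hq1.le, le_of_lt h4⟩] at h5
    exact absurd h3 (not_lt.2 h5)

/-- A function with left limits that is right-continuous is continuous off a countable set. -/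
lemma IsCadlag.exists_countable (h : IsCadlag T y) :
    ∃ C : Set ℝ, C.Countable ∧ ∀ b ∈ Ioo 0 T, b ∉ C → ContinuousAt y b := by
  -- A jump at b is witnessed by a rational level separating y(b) from all values on ]a,b[ with a
  -- rational. For each direction of the jump, a pair of rationals witnesses at most one point.
  refine ⟨⋃ z : ℚ × ℚ, {b : ℝ | z.1 < b ∧ z.2 < y b ∧ ∀ x : ℝ, z.1 < x → x < b → y x < z.2} ∪
    {b : ℝ | z.1 < b ∧ y b < z.2 ∧ ∀ x : ℝ, z.1 < x → x < b → z.2 < y x}, ?_, ?_⟩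
  · refine countable_iUnion fun z => Countable.union ?_ ?_
    · refine Set.Subsingleton.countable fun b hb b' hb' => ?_
      rcases lt_trichotomy b b' with hlt | heq | hlt
      · exact absurd (hb'.2.2 b hb.1 hlt) (not_lt.2 hb.2.1.le)
      · exact heq
      · exact absurd (hb.2.2 b' hb'.1 hlt) (not_lt.2 hb'.2.1.le)
    · refine Set.Subsingleton.countable fun b hb b' hb' => ?_
      rcases lt_trichotomy b b' with hlt | heq | hlt
      · exact absurd (hb'.2.2 b hb.1 hlt) (not_lt.2 hb.2.1.le)
      · exact heq
      · exact absurd (hb.2.2 b' hb'.1 hlt) (not_lt.2 hb'.2.1.le)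
  · intro b hb hbC
    obtain ⟨l, hl⟩ := h.2 b ⟨hb.1, hb.2.le⟩
    have hlb : l = y b := by
      by_contra hne
      refine hbC (mem_iUnion.2 ?_)
      rcases lt_or_gt_of_ne hne with hlt | hlt
      · obtain ⟨q, hq1, hq2⟩ := exists_rat_btwn hlt
        obtain ⟨u, hu, hsub⟩ := mem_nhdsLT_iff_exists_Ioo_subset.1
          (hl.eventually (gt_mem_nhds hq1))
        obtain ⟨a, ha1, ha2⟩ := exists_rat_btwn (show u < b from hu)
        exact ⟨(a, q), Or.inl ⟨ha2, hq2, fun x hx1 hx2 => hsub ⟨ha1.trans hx1, hx2⟩⟩⟩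
      · obtain ⟨q, hq1, hq2⟩ := exists_rat_btwn hlt
        obtain ⟨u, hu, hsub⟩ := mem_nhdsLT_iff_exists_Ioo_subset.1
          (hl.eventually (lt_mem_nhds hq2))
        obtain ⟨a, ha1, ha2⟩ := exists_rat_btwn (show u < b from hu)
        exact ⟨(a, q), Or.inr ⟨ha2, hq1, fun x hx1 hx2 => hsub ⟨ha1.trans hx1, hx2⟩⟩⟩
    rw [continuousAt_iff_continuous_left'_right']
    exact ⟨show Tendsto y (𝓝[<] b) (𝓝 (y b)) from hlb ▸ hl, h.1 b ⟨hb.1.le, hb.2⟩⟩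

end Cadlag

/-! ### A common square integrable bound -/

section Domination

variable {Ω : Type*} [MeasurableSpace Ω] {T : ℝ} {P : Measure Ω} {Y : ℝ → Ω → ℝ} {Z : Ω → ℝ}

/-- A common square integrable bound for a cadlag process with square integrable supremum and for
a random variable. -/
lemma exists_dominating (hT : 0 < T) (hYm : Measurable fun q : ℝ × Ω => Y q.1 q.2)
    (hYc : ∀ᵐ ω ∂P, IsCadlag T fun t => Y t ω)
    (hY : ∫⁻ ω, (⨆ t ∈ Icc 0 T, ‖Y t ω‖ₑ) ^ 2 ∂P < ∞) (hZ : MemLp Z 2 P) :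
    ∃ R : Ω → ℝ, Measurable R ∧ MemLp R 2 P ∧ (∀ ω, 0 ≤ R ω) ∧
      (∀ᵐ ω ∂P, ∀ t ∈ Icc 0 T, |Y t ω| ≤ R ω) ∧ ∀ᵐ ω ∂P, Z ω ≤ R ω := by
  -- A countable supremum is measurable, and for cadlag paths it bounds the whole path.
  set g : Ω → ℝ≥0∞ := fun ω => ⨆ q : ℚ, ‖Y (clamp T q) ω‖ₑ with hg
  have hgm : Measurable g := Measurable.iSup fun q =>
    (hYm.comp (measurable_const.prodMk measurable_id)).enorm
  have hgle : ∀ ω, g ω ≤ ⨆ t ∈ Icc 0 T, ‖Y t ω‖ₑ := fun ω =>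
    iSup_le fun q => le_iSup₂ (f := fun t (_ : t ∈ Icc 0 T) => ‖Y t ω‖ₑ) _ (clamp_mem hT q)
  have hg2 : ∫⁻ ω, g ω ^ 2 ∂P < ∞ :=
    (lintegral_mono fun ω => pow_le_pow_left₀ bot_le (hgle ω) 2).trans_lt hY
  have hgfin : ∀ᵐ ω ∂P, g ω < ∞ := by
    filter_upwards [ae_lt_top (hgm.pow_const 2) hg2.ne] with ω hω
    exact (ENNReal.pow_lt_top_iff.1 hω).resolve_right (by norm_num)
  have hgL : MemLp (fun ω => (g ω).toReal) 2 P := by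
    refine ⟨hgm.ennreal_toReal.aestronglyMeasurable, ?_⟩
    rw [eLpNorm_lt_top_iff_lintegral_rpow_enorm_lt_top (by norm_num) (by norm_num)]
    refine (lintegral_mono fun ω => ?_).trans_lt hg2
    simp only [ENNReal.toReal_ofNat, ENNReal.rpow_ofNat]
    refine pow_le_pow_left₀ bot_le ?_ 2
    rw [Real.enorm_of_nonneg ENNReal.toReal_nonneg]
    exact ENNReal.ofReal_toReal_le
  set Z' := hZ.1.aemeasurable.mk Z
  have hZ' : Z =ᵐ[P] Z' := hZ.1.aemeasurable.ae_eq_mk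
  refine ⟨fun ω => (g ω).toReal + |Z' ω|, ?_, ?_, fun ω => by positivity, ?_, ?_⟩
  · exact hgm.ennreal_toReal.add (hZ.1.aemeasurable.measurable_mk.norm)
  · exact hgL.add ((memLp_congr_ae hZ').1 hZ).norm
  · filter_upwards [hYc, hgfin] with ω h1 h2
    refine h1.abs_le fun q => ?_
    refine le_add_of_le_of_nonneg ?_ (abs_nonneg _)
    rw [← Real.norm_eq_abs, ← toReal_enorm]
    exact ENNReal.toReal_mono h2.ne (le_iSup (fun q : ℚ => ‖Y (clamp T q) ω‖ₑ) q)
  · filter_upwards [hZ'] with ω hω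
    rw [hω]
    exact (le_abs_self _).trans (le_add_of_nonneg_left ENNReal.toReal_nonneg)

end Domination

/-! ### Limits of averages -/

section AvgLimits

variable {T : ℝ} {f g : ℝ → ℝ}

lemma tendsto_neg_nhdsNE_zero : Tendsto (fun ε : ℝ => -ε) (𝓝[≠] 0) (𝓝[≠] 0) := by
  refine tendsto_nhdsWithin_iff.2 ⟨?_, ?_⟩
  · refine Tendsto.mono_left ?_ nhdsWithin_le_nhds
    simpa using continuous_neg.tendsto (0 : ℝ)
  · filter_upwards [self_mem_nhdsWithin] with ε hε
    simpa using hε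

/-- Differentiability of the primitive at a point of continuity; the average at scale ε is its
difference quotient at -ε. -/
lemma tendsto_avg_of_continuousAt (hg : IsBM g) {b : ℝ} (hb : b ∈ Ioo 0 T)
    (hgb : ContinuousAt g b) : Tendsto (fun ε => avg T ε g b) (𝓝[≠] 0) (𝓝 (g b)) := by
  obtain ⟨hgm, C, hC⟩ := hg
  set h := (Icc 0 T).indicator g with hh
  have hm : Measurable h := hgm.indicator measurableSet_Icc
  have hhb : h =ᶠ[𝓝 b] g := by
    filter_upwards [Icc_mem_nhds hb.1 hb.2] with x hx
    exact indicator_of_mem hx g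
  have hd := intervalIntegral.integral_hasDerivAt_right (f := h) (a := b) (b := b) (by simp)
    (hm.stronglyMeasurable.stronglyMeasurableAtFilter) (hgb.congr hhb.symm)
  rw [hhb.eq_of_nhds] at hd
  refine (hd.tendsto_slope_zero.comp tendsto_neg_nhdsNE_zero).congr fun ε => ?_
  simp only [Function.comp, intervalIntegral.integral_same, sub_zero, smul_eq_mul]
  rw [avg_eq, intervalIntegral.integral_symm, ← sub_eq_add_neg, inv_neg, neg_mul, mul_neg, neg_neg]

variable {t b : ℝ}

lemma avg_eventuallyEq_leftAvg (hfg : ∀ᵐ s ∂volume.restrict (Icc 0 t), f s = g s)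
    (ht : t ≤ T) (hb : b ∈ Ioo 0 t) :
    (fun ε => avg T ε g b) =ᶠ[𝓝[>] 0] leftAvg f b := by
  rw [ae_restrict_iff' measurableSet_Icc] at hfg
  filter_upwards [Ioo_mem_nhdsGT hb.1] with ε hε
  rw [avg_eq, leftAvg]
  congr 1
  refine intervalIntegral.integral_congr_ae ?_
  filter_upwards [hfg] with s hs hs2
  rw [uIoc_of_le (by linarith [hε.1])] at hs2
  have h1 : 0 ≤ s := by linarith [hs2.1, hε.2]
  have h2 : s ≤ t := hs2.2.trans hb.2.le
  rw [indicator_of_mem (show s ∈ Icc 0 T from ⟨h1, h2.trans ht⟩), hs ⟨h1, h2⟩]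

/-- Negative scales look to the right of b: the sign of the inverse scale and that of the oriented
integral cancel. -/
lemma avg_neg_eventuallyEq_rightAvg (hfg : ∀ᵐ s ∂volume.restrict (Icc 0 t), f s = g s)
    (ht : t ≤ T) (hb : b ∈ Ioo 0 t) :
    (fun ε => avg T (-ε) g b) =ᶠ[𝓝[>] 0] rightAvg f b := by
  rw [ae_restrict_iff' measurableSet_Icc] at hfg
  filter_upwards [Ioo_mem_nhdsGT (sub_pos.2 hb.2)] with ε hε
  rw [avg_eq, rightAvg, intervalIntegral.integral_symm, sub_neg_eq_add, inv_neg, neg_mul_neg]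
  congr 1
  refine intervalIntegral.integral_congr_ae ?_
  filter_upwards [hfg] with s hs hs2
  rw [uIoc_of_le (by linarith [hε.1])] at hs2
  have h1 : 0 ≤ s := by linarith [hs2.1, hb.1]
  have h2 : s ≤ t := by linarith [hs2.2, hε.2]
  rw [indicator_of_mem (show s ∈ Icc 0 T from ⟨h1, h2.trans ht⟩), hs ⟨h1, h2⟩]

lemma tendsto_nhdsNE_zero_of_pos_neg {F : ℝ → ℝ} {l : ℝ} (h1 : Tendsto F (𝓝[>] 0) (𝓝 l))
    (h2 : Tendsto (fun ε => F (-ε)) (𝓝[>] 0) (𝓝 l)) : Tendsto F (𝓝[≠] 0) (𝓝 l) := by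
  rw [← Iio_union_Ioi, nhdsWithin_union]
  refine Tendsto.sup ?_ h1
  have h3 : Tendsto (fun ε : ℝ => -ε) (𝓝[<] 0) (𝓝[>] 0) := by
    simpa using tendsto_neg_nhdsLT (a := (0 : ℝ))
  exact (h2.comp h3).congr fun ε => by simp

/-- A function that is continuous on the positive half-line has the limit that it has along the
rationals. -/
lemma tendsto_of_tendsto_rat {F : ℝ → ℝ} (hF : ContinuousOn F (Ioi 0)) {l : ℝ}
    (h : Tendsto (fun q : ℚ => F q) (comap (fun q : ℚ => (q : ℝ)) (𝓝[>] 0)) (𝓝 l)) :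
    Tendsto F (𝓝[>] 0) (𝓝 l) := by
  refine (closed_nhds_basis l).tendsto_right_iff.2 fun V hV => ?_
  obtain ⟨s, hs, hsV⟩ := mem_comap.1 (h.eventually hV.1)
  obtain ⟨u, hu, hsub⟩ := mem_nhdsGT_iff_exists_Ioo_subset.1 hs
  filter_upwards [Ioo_mem_nhdsGT hu] with ε hε
  by_contra hεV
  -- Since V is closed, F leaves V on a whole neighbourhood of ε, hence at a rational, against the
  -- limit along rationals.
  have h1 : ∀ᶠ x in 𝓝 ε, F x ∈ Vᶜ :=
    (hF.continuousAt (Ioi_mem_nhds hε.1)).eventually (hV.2.isOpen_compl.mem_nhds hεV)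
  obtain ⟨q, hq⟩ := Rat.denseRange_cast (𝕜 := ℝ) |>.exists_mem_open
    (isOpen_interior (s := {x | F x ∈ Vᶜ} ∩ Ioo 0 u))
    ⟨ε, mem_interior_iff_mem_nhds.2 (h1.and (Ioo_mem_nhds hε.1 hε.2))⟩
  obtain ⟨hx1, hx2⟩ := interior_subset hq
  exact hx1 (hsV (hsub hx2))

lemma continuousOn_avg (hg : IsBM g) (b : ℝ) : ContinuousOn (fun ε => avg T ε g b) {0}ᶜ := by
  obtain ⟨hgm, C, hC⟩ := hg
  have hi : ∀ x y, IntervalIntegrable ((Icc 0 T).indicator g) volume x y := fun x y => by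
    refine (intervalIntegrable_const (c := C)).mono_fun
      (hgm.indicator measurableSet_Icc).aestronglyMeasurable (ae_of_all _ fun s => ?_)
    refine (norm_indicator_le_norm_self _ _).trans ((hC s).trans (le_abs_self _))
  have hc : Continuous fun ε => ∫ s in b..(b - ε), (Icc 0 T).indicator g s :=
    (intervalIntegral.continuous_primitive hi b).comp (continuous_const.sub continuous_id)
  simp_rw [avg_eq]
  refine ContinuousOn.mul (continuousOn_inv₀) ?_
  exact (hc.neg.congr fun ε => (intervalIntegral.integral_symm _ _).symm).continuousOn

end AvgLimits

/-! ### Truncation at a random level, and exchange of null sets -/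

section Truncation

/-- `x`, replaced by zero if its absolute value is larger than `R`. -/
def trunc (R x : ℝ) : ℝ := if |x| ≤ R then x else 0

lemma abs_trunc_le {R : ℝ} (hR : 0 ≤ R) (x : ℝ) : |trunc R x| ≤ R := by
  unfold trunc
  split_ifs with h
  · exact h
  · simpa using hR

lemma trunc_eq {R x : ℝ} (h : |x| ≤ R) : trunc R x = x := if_pos h

lemma _root_.Measurable.trunc {α : Type*} [MeasurableSpace α] {R x : α → ℝ} (hR : Measurable R)
    (hx : Measurable x) : Measurable fun a => trunc (R a) (x a) :=
  Measurable.ite (measurableSet_le hx.norm hR) hx measurable_const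

end Truncation

/-- Fubini for null sets. The bound on the derivative is given with time as the outermost variable,
whereas averages in time need it innermost. -/
lemma ae_rotate {α β γ : Type*} [MeasurableSpace α] [MeasurableSpace β] [MeasurableSpace γ]
    {ρ : Measure α} {σ : Measure β} {τ : Measure γ} [SFinite ρ] [SFinite σ] [SFinite τ]
    {p : α → β → γ → Prop} (hp : MeasurableSet {x : α × β × γ | p x.1 x.2.1 x.2.2})
    (h : ∀ᵐ a ∂ρ, ∀ᵐ b ∂σ, ∀ᵐ c ∂τ, p a b c) : ∀ᵐ b ∂σ, ∀ᵐ c ∂τ, ∀ᵐ a ∂ρ, p a b c := by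
  have h1 : ∀ᵐ a ∂ρ, ∀ᵐ z ∂σ.prod τ, p a z.1 z.2 := by
    filter_upwards [h] with a ha
    exact (Measure.ae_prod_iff_ae_ae (p := fun z : β × γ => p a z.1 z.2)
      (hp.preimage measurable_prodMk_left)).2 ha
  rw [Measure.ae_ae_comm hp] at h1
  exact Measure.ae_ae_of_ae_prod h1

/-! ### Averages near a cutoff -/

section Averages

variable {T t b : ℝ} {f g : ℝ → ℝ}

lemma avg_congr_of_eventuallyEq (h : f =ᶠ[𝓝 b] g) :
    ∀ᶠ ε in 𝓝 0, avg T ε f b = avg T ε g b := by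
  obtain ⟨δ, hδ, hsub⟩ := Metric.eventually_nhds_iff.1 h
  filter_upwards [Metric.ball_mem_nhds (0 : ℝ) hδ] with ε hε
  rw [mem_ball_zero_iff, Real.norm_eq_abs] at hε
  rw [avg_eq, avg_eq]
  congr 1
  refine intervalIntegral.integral_congr fun s hs => ?_
  have h1 : |s - b| ≤ |b - ε - b| := abs_sub_le_of_uIcc_subset_uIcc
    (uIcc_subset_uIcc_left (by rwa [uIcc_comm]))
  have h2 : f s = g s := hsub (by
    rw [Real.dist_eq]
    refine h1.trans_lt ?_
    rwa [sub_right_comm, sub_self, zero_sub, abs_neg])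
  by_cases hs' : s ∈ Icc 0 T
  · simp only [indicator_of_mem hs', h2]
  · simp only [indicator_of_notMem hs']

lemma avg_zero (ε : ℝ) : avg T ε (fun _ => 0) b = 0 := by simp [avg]

lemma tendsto_const_mul_nhdsGT {σ : ℝ} (hσ : σ ≠ 0) :
    Tendsto (fun ε => σ * ε) (𝓝[>] 0) (𝓝[≠] 0) := by
  refine tendsto_nhdsWithin_iff.2 ⟨?_, ?_⟩
  · refine Tendsto.mono_left ?_ nhdsWithin_le_nhds
    simpa using (continuous_const_mul σ).tendsto (0 : ℝ)
  · filter_upwards [self_mem_nhdsWithin] with ε hε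
    exact mul_ne_zero hσ (ne_of_gt hε)

lemma avg_indicator_eventuallyEq {σ : ℝ} (hσ : σ ≠ 0) (hb : 0 < b) (hbt : b < t) :
    ∀ᶠ ε in 𝓝[>] 0, avg T (σ * ε) ((Icc 0 t).indicator g) b = avg T (σ * ε) g b := by
  refine ((tendsto_const_mul_nhdsGT hσ).mono_right nhdsWithin_le_nhds).eventually
    (avg_congr_of_eventuallyEq ?_)
  filter_upwards [Icc_mem_nhds hb hbt] with x hx
  exact indicator_of_mem hx g

lemma avg_indicator_eventually_zero {σ : ℝ} (hσ : σ ≠ 0) (hbt : t < b) :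
    ∀ᶠ ε in 𝓝[>] 0, avg T (σ * ε) ((Icc 0 t).indicator g) b = 0 := by
  have h : (Icc 0 t).indicator g =ᶠ[𝓝 b] fun _ => 0 := by
    filter_upwards [Ioi_mem_nhds hbt] with x hx
    exact indicator_of_notMem (fun h => not_le.2 hx h.2) g
  filter_upwards [((tendsto_const_mul_nhdsGT hσ).mono_right nhdsWithin_le_nhds).eventually
    (avg_congr_of_eventuallyEq (T := T) h)] with ε hε
  rw [hε, avg_zero]

end Averages

/-! ### Where the covariance measure is carried -/

section Carrier

variable {Ω : Type*} [MeasurableSpace Ω] {T : ℝ} {P : Measure Ω} {X B : ℝ → Ω → ℝ}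
  {μ : SignedMeasure (ℝ × ℝ)}

/-- The sign density has integral zero over every measurable subset of the complement, so it
vanishes there almost everywhere. Its absolute value being 1, the complement is null for |μ| and not
only for μ. -/
lemma IsCovarianceMeasure.ae_mem (hμ : IsCovarianceMeasure T P X μ) :
    ∀ᵐ p ∂μ.totalVariation, p ∈ Ioc 0 T ×ˢ Ioc 0 T := by
  have hC : MeasurableSet (Ioc 0 T ×ˢ Ioc 0 T : Set (ℝ × ℝ)) :=
    measurableSet_Ioc.prod measurableSet_Ioc
  have hi : Integrable (sgn μ) μ.totalVariation :=
    (integrable_const (1 : ℝ)).mono' (measurable_sgn μ).aestronglyMeasurable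
      (ae_of_all _ fun p => (abs_sgn μ p).le)
  have h : sgn μ =ᵐ[μ.totalVariation.restrict (Ioc 0 T ×ˢ Ioc 0 T)ᶜ] 0 := by
    refine hi.integrableOn.ae_eq_zero_of_forall_setIntegral_eq_zero fun s hs _ => ?_
    rw [Measure.restrict_restrict hs, ← apply_eq_integral_sgn μ (hs.inter hC.compl)]
    exact hμ.carried _ (hs.inter hC.compl) (disjoint_compl_left.mono_left inter_subset_right)
  rw [Filter.EventuallyEq, ae_restrict_iff' hC.compl] at h
  filter_upwards [h] with p hp
  by_contra hn
  have := abs_sgn μ p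
  rw [hp hn] at this
  simp at this

lemma ae_marginal_of_ae_snd {p : ℝ → Prop} (hp : MeasurableSet {b | p b})
    (h : ∀ᵐ z ∂μ.totalVariation, p z.2) : ∀ᵐ b ∂marginal μ, p b :=
  (ae_map_iff measurable_snd.aemeasurable hp).2 h

lemma IsCovProcess.ae_ne (hB : IsCovProcess P B μ) (t : ℝ) : ∀ᵐ b ∂marginal μ, b ≠ t :=
  measure_eq_zero_iff_ae_notMem.1 (hB.marginal_singleton t)

lemma IsCovProcess.ae_mem_Ioo (hB : IsCovProcess P B μ) (hμ : IsCovarianceMeasure T P X μ) :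
    ∀ᵐ b ∂marginal μ, b ∈ Ioo 0 T := by
  have h : ∀ᵐ b ∂marginal μ, b ∈ Ioc 0 T := ae_marginal_of_ae_snd measurableSet_Ioc
    (hμ.ae_mem.mono fun p hp => hp.2)
  filter_upwards [h, hB.ae_ne T] with b h1 h2
  exact ⟨h1.1, lt_of_le_of_ne h1.2 h2⟩

end Carrier

/-! ### Directional derivatives: equal variables, zero -/

section DirDeriv

variable {Ω : Type*} [MeasurableSpace Ω] {T : ℝ} {P : Measure Ω} {X B : ℝ → Ω → ℝ}
  {μ : SignedMeasure (ℝ × ℝ)} {V V' : Ω → ℝ} {θ : ℝ → ℝ → Ω → ℝ}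

lemma HasDirDeriv.congr (h : HasDirDeriv T P X B μ V θ) (hV : V =ᵐ[P] V') :
    HasDirDeriv T P X B μ V' θ := by
  obtain ⟨h1, h2, G, h3, h4⟩ := h
  refine ⟨(memLp_congr_ae hV).1 h1, h2, G, h3.congr fun k => eLpNorm_congr_ae ?_, h4⟩
  filter_upwards [hV] with ω hω
  simp only [Pi.sub_apply, hω]

lemma HasDirDeriv.zero : HasDirDeriv T P X B μ (fun _ => 0) fun _ _ _ => 0 := by
  let F : CylVar T P X μ :=
    { n := 0
      f := fun _ => 0
      smooth := ⟨contDiff_const, fun k => ⟨0, fun x => by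
        simp⟩⟩
      φ := fun i => i.elim0
      memL := fun i => i.elim0
      W := fun i => i.elim0
      wiener := fun i => i.elim0 }
  refine ⟨MemLp.zero, fun _ _ => MemLp.zero, fun _ => F, ?_, fun p q => ?_⟩
  · have : ((fun _ => 0 : Ω → ℝ) - F.val) = 0 := by ext ω; simp [F, CylVar.val]
    simp [this]
  · have : ((fun _ => 0 : Ω → ℝ) - F.dirDeriv B p q) = 0 := by
      ext ω; simp [F, CylVar.dirDeriv]
    simp [this]

end DirDeriv

/-! ### The truncated process on [0,t] and the traces of its derivative -/

section Cut

variable {Ω : Type*} [MeasurableSpace Ω] {T : ℝ} {P : Measure Ω} [IsProbabilityMeasure P]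
  {X B : ℝ → Ω → ℝ} {μ : SignedMeasure (ℝ × ℝ)} {Y : ℝ → Ω → ℝ} {DY : Ω → ℝ → ℝ → ℝ} {R : Ω → ℝ}

/-- The process `Y 1_{[0,t]}`, truncated at the level `R`. -/
def cutProc (R : Ω → ℝ) (Y : ℝ → Ω → ℝ) (t s : ℝ) (ω : Ω) : ℝ :=
  (Icc 0 t).indicator (fun s => trunc (R ω) (Y s ω)) s

/-- The derivative, truncated at the level `R`. -/
def truncDeriv (R : Ω → ℝ) (DY : Ω → ℝ → ℝ → ℝ) (ω : Ω) (r s : ℝ) : ℝ := trunc (R ω) (DY ω r s)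

/-- The derivative of `Y 1_{[0,t]}`, truncated at the level `R`. -/
def cutDeriv (R : Ω → ℝ) (DY : Ω → ℝ → ℝ → ℝ) (t : ℝ) (ω : Ω) (r : ℝ) : ℝ → ℝ :=
  (Icc 0 t).indicator (truncDeriv R DY ω r)

lemma measurable_truncDeriv (hR : Measurable R)
    (hD : Measurable fun q : Ω × ℝ × ℝ => DY q.1 q.2.1 q.2.2) :
    Measurable fun q : Ω × ℝ × ℝ => truncDeriv R DY q.1 q.2.1 q.2.2 :=
  (hR.comp measurable_fst).trunc hD

lemma isBM_truncDeriv (hR : Measurable R) (hR0 : ∀ ω, 0 ≤ R ω)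
    (hD : Measurable fun q : Ω × ℝ × ℝ => DY q.1 q.2.1 q.2.2) (ω : Ω) (r : ℝ) :
    IsBM (truncDeriv R DY ω r) :=
  ⟨(measurable_truncDeriv hR hD).comp (measurable_prodMk_left.comp measurable_prodMk_left), R ω,
    fun _ => abs_trunc_le (hR0 ω) _⟩

lemma measurable_cutDeriv (hR : Measurable R)
    (hD : Measurable fun q : Ω × ℝ × ℝ => DY q.1 q.2.1 q.2.2) (t : ℝ) :
    Measurable fun q : Ω × ℝ × ℝ => cutDeriv R DY t q.1 q.2.1 q.2.2 :=
  (measurable_truncDeriv hR hD).indicator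
    (measurableSet_Icc.preimage (measurable_snd.comp measurable_snd))

omit [MeasurableSpace Ω] in
lemma abs_cutDeriv_le (hR0 : ∀ ω, 0 ≤ R ω) (t : ℝ) (ω : Ω) (r s : ℝ) :
    |cutDeriv R DY t ω r s| ≤ R ω :=
  (norm_indicator_le_norm_self (truncDeriv R DY ω r) s).trans (abs_trunc_le (hR0 ω) _)

lemma measurable_cutProc (hR : Measurable R) (hY : Measurable fun q : ℝ × Ω => Y q.1 q.2) (t : ℝ) :
    Measurable fun q : ℝ × Ω => cutProc R Y t q.1 q.2 :=
  ((hR.comp measurable_snd).trunc hY).indicator (measurableSet_Icc.preimage measurable_fst)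

omit [MeasurableSpace Ω] in
lemma abs_cutProc_le (hR0 : ∀ ω, 0 ≤ R ω) (t s : ℝ) (ω : Ω) : |cutProc R Y t s ω| ≤ R ω :=
  (norm_indicator_le_norm_self (fun s => trunc (R ω) (Y s ω)) s).trans (abs_trunc_le (hR0 ω) _)

omit [MeasurableSpace Ω] in
lemma cutProc_eq {t : ℝ} (ht : t ≤ T) {ω : Ω} (h : ∀ s ∈ Icc 0 T, |Y s ω| ≤ R ω) (s : ℝ) :
    cutProc R Y t s ω = (Icc 0 t).indicator (fun s => Y s ω) s := by
  by_cases hs : s ∈ Icc 0 t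
  · rw [cutProc, indicator_of_mem hs, indicator_of_mem hs, trunc_eq (h s ⟨hs.1, hs.2.trans ht⟩)]
  · rw [cutProc, indicator_of_notMem hs, indicator_of_notMem hs]

omit [IsProbabilityMeasure P] in
-- The only bad points are the countably many jumps, the cutoff t and the end points, and the
-- marginal has no atoms.
lemma ae_tendsto_avg_cutProc (hB : IsCovProcess P B μ) (hμ : IsCovarianceMeasure T P X μ)
    (hR : Measurable R) (hR0 : ∀ ω, 0 ≤ R ω) (hY : Measurable fun q : ℝ × Ω => Y q.1 q.2)
    {t : ℝ} (ht : t ≤ T) {ω : Ω} (hc : IsCadlag T fun s => Y s ω)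
    (hω : ∀ s ∈ Icc 0 T, |Y s ω| ≤ R ω) :
    ∀ᵐ b ∂marginal μ, Tendsto (fun ε => avg T ε (fun s => cutProc R Y t s ω) b) (𝓝[≠] 0)
      (𝓝 (cutProc R Y t b ω)) := by
  obtain ⟨C, hC, hcont⟩ := hc.exists_countable
  have hCn : ∀ᵐ b ∂marginal μ, b ∉ C := by
    refine measure_eq_zero_iff_ae_notMem.1 ?_
    rw [← biUnion_of_singleton C]
    exact (measure_biUnion_null_iff hC).2 fun b _ => hB.marginal_singleton b
  have hBM : IsBM fun s => cutProc R Y t s ω :=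
    ⟨(measurable_cutProc hR hY t).comp measurable_prodMk_right, R ω,
      fun s => abs_cutProc_le hR0 t s ω⟩
  filter_upwards [hCn, hB.ae_mem_Ioo hμ, hB.ae_ne t] with b h1 h2 h3
  refine tendsto_avg_of_continuousAt hBM h2 ?_
  rcases lt_or_gt_of_ne h3 with h | h
  · refine (hcont b h2 h1).congr ?_
    filter_upwards [Icc_mem_nhds h2.1 h] with s hs
    rw [cutProc_eq ht hω, indicator_of_mem hs]
  · refine (continuousAt_const (y := (0 : ℝ))).congr ?_
    filter_upwards [Ioi_mem_nhds h] with s hs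
    exact (indicator_of_notMem (fun hs' => not_le.2 hs hs'.2) _).symm

section Derivative

variable (hR : Measurable R) (hR0 : ∀ ω, 0 ≤ R ω)
  (hD : Measurable fun q : Ω × ℝ × ℝ => DY q.1 q.2.1 q.2.2)
  (hbound : ∀ᵐ s ∂(volume.restrict (Icc 0 T)), ∀ᵐ ω ∂P, ∀ᵐ r ∂marginal μ, |DY ω r s| ≤ R ω)
include hR hD hbound

omit [IsProbabilityMeasure P] in
lemma ae_eq_truncDeriv [SFinite P] : ∀ᵐ ω ∂P, ∀ᵐ r ∂marginal μ, ∀ᵐ s ∂volume.restrict (Icc 0 T),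
    DY ω r s = truncDeriv R DY ω r s := by
  have h := ae_rotate (p := fun s ω r => |DY ω r s| ≤ R ω) ?_ hbound
  · filter_upwards [h] with ω h1
    filter_upwards [h1] with r h2
    filter_upwards [h2] with s h3
    exact (trunc_eq h3).symm
  · have n : Measurable fun x : ℝ × Ω × ℝ => (x.2.1, x.2.2, x.1) := by fun_prop
    exact measurableSet_le (hD.comp n).norm (hR.comp (measurable_fst.comp measurable_snd))

omit [IsProbabilityMeasure P] in
-- The order of quantifiers that fits the hypotheses on traces, which hold almost surely for almost
-- every fixed point of the plane.
lemma ae_eq_truncDeriv_comm [SFinite P] : ∀ᵐ r ∂marginal μ, ∀ᵐ ω ∂P,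
    ∀ᵐ s ∂volume.restrict (Icc 0 T), DY ω r s = truncDeriv R DY ω r s := by
  have h0 : ∀ᵐ s ∂(volume.restrict (Icc 0 T)), ∀ᵐ r ∂marginal μ, ∀ᵐ ω ∂P, |DY ω r s| ≤ R ω := by
    filter_upwards [hbound] with s hs
    refine (Measure.ae_ae_comm (p := fun ω r => |DY ω r s| ≤ R ω) ?_).1 hs
    have n : Measurable fun x : Ω × ℝ => (x.1, x.2, s) := by fun_prop
    exact measurableSet_le (hD.comp n).norm (hR.comp measurable_fst)
  have h := ae_rotate (p := fun s r ω => |DY ω r s| ≤ R ω) ?_ h0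
  · filter_upwards [h] with ω h1
    filter_upwards [h1] with r h2
    filter_upwards [h2] with s h3
    exact (trunc_eq h3).symm
  · have n : Measurable fun x : ℝ × ℝ × Ω => (x.2.2, x.2.1, x.1) := by fun_prop
    exact measurableSet_le (hD.comp n).norm (hR.comp (measurable_snd.comp measurable_snd))

include hR0

/-- Before t, the left and right limits at the fixed time b combine into a two-sided one; after t,
everything vanishes near b. The point b = t has no mass. -/
lemma ae_tendsto_avg_cutDeriv (hB : IsCovProcess P B μ) (hμ : IsCovarianceMeasure T P X μ)
    (hl : ∀ s ∈ Ioc 0 T, ∀ᵐ ω ∂P, ∀ᵐ r ∂marginal μ,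
      Tendsto (leftAvg (DY ω r) s) (𝓝[>] 0) (𝓝 (DY ω r s)))
    (hr : ∀ s ∈ Ico 0 T, ∀ᵐ ω ∂P, ∀ᵐ r ∂marginal μ,
      Tendsto (rightAvg (DY ω r) s) (𝓝[>] 0) (𝓝 (DY ω r s))) (t : ℝ) :
    ∀ᵐ b ∂marginal μ, ∀ᵐ ω ∂P, ∀ᵐ r ∂marginal μ,
      Tendsto (fun ε => avg T ε (cutDeriv R DY t ω r) b) (𝓝[≠] 0) (𝓝 (cutDeriv R DY t ω r b)) := by
  filter_upwards [hB.ae_mem_Ioo hμ, hB.ae_ne t] with b hb hbt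
  filter_upwards [hl b ⟨hb.1, hb.2.le⟩, hr b ⟨hb.1.le, hb.2⟩,
    ae_eq_truncDeriv hR hD hbound] with ω h1 h2 h3
  filter_upwards [h1, h2, h3] with r k1 k2 k3
  rcases lt_or_gt_of_ne hbt with h | h
  · have l1 : Tendsto (fun ε => avg T ε (truncDeriv R DY ω r) b) (𝓝[>] 0) (𝓝 (DY ω r b)) :=
      k1.congr' (avg_eventuallyEq_leftAvg k3 le_rfl hb).symm
    have l2 : Tendsto (fun ε => avg T (-ε) (truncDeriv R DY ω r) b) (𝓝[>] 0) (𝓝 (DY ω r b)) :=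
      k2.congr' (avg_neg_eventuallyEq_rightAvg k3 le_rfl hb).symm
    -- The bound is assumed only for almost every time, but the value at b is a limit of averages of
    -- the truncation and inherits it. So truncation does not change this value.
    have hle : |DY ω r b| ≤ R ω := le_of_tendsto l1.abs
      (Eventually.of_forall fun ε => abs_avg_le T ε (fun s => abs_trunc_le (hR0 ω) _) b)
    have e : cutDeriv R DY t ω r b = DY ω r b := by
      rw [cutDeriv, indicator_of_mem (show b ∈ Icc 0 t from ⟨hb.1.le, h.le⟩), truncDeriv,
        trunc_eq hle]
    rw [e]
    refine (tendsto_nhdsNE_zero_of_pos_neg l1 l2).congr' ?_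
    have h4 : cutDeriv R DY t ω r =ᶠ[𝓝 b] truncDeriv R DY ω r := by
      filter_upwards [Icc_mem_nhds hb.1 h] with x hx
      exact indicator_of_mem hx _
    filter_upwards [nhdsWithin_le_nhds (avg_congr_of_eventuallyEq (T := T) h4)] with ε hε
    exact hε.symm
  · have h4 : cutDeriv R DY t ω r =ᶠ[𝓝 b] fun _ => 0 := by
      filter_upwards [Ioi_mem_nhds h] with x hx
      exact indicator_of_notMem (fun hx' => not_le.2 hx hx'.2) _
    rw [h4.eq_of_nhds]
    refine tendsto_const_nhds.congr' ?_
    filter_upwards [nhdsWithin_le_nhds (avg_congr_of_eventuallyEq (T := T) h4)] with ε hε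
    rw [hε, avg_zero]

/-- The truncations of `Y 1_{[0,t]}` and of its derivative form a regular process. -/
lemma isRegularProc_cut (hB : IsCovProcess P B μ) (hBX : ∀ t ∈ Icc 0 T, B t =ᵐ[P] X t)
    (hμ : IsCovarianceMeasure T P X μ)
    (hY : Measurable fun q : ℝ × Ω => Y q.1 q.2) (hYc : ∀ᵐ ω ∂P, IsCadlag T fun s => Y s ω)
    (hR2 : MemLp R 2 P) (hYR : ∀ᵐ ω ∂P, ∀ s ∈ Icc 0 T, |Y s ω| ≤ R ω)
    (hslice : ∀ᵐ s ∂volume.restrict (Icc 0 T), IsMalliavinDeriv T P X μ (Y s) fun ω r => DY ω r s)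
    (hl : ∀ s ∈ Ioc 0 T, ∀ᵐ ω ∂P, ∀ᵐ r ∂marginal μ,
      Tendsto (leftAvg (DY ω r) s) (𝓝[>] 0) (𝓝 (DY ω r s)))
    (hr : ∀ s ∈ Ico 0 T, ∀ᵐ ω ∂P, ∀ᵐ r ∂marginal μ,
      Tendsto (rightAvg (DY ω r) s) (𝓝[>] 0) (𝓝 (DY ω r s))) {t : ℝ} (ht : t ≤ T) :
    IsRegularProc T P X B μ (cutProc R Y t) (cutDeriv R DY t) R where
  measU := measurable_cutProc hR hY t
  measD := measurable_cutDeriv hR hD t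
  measR := hR
  memLpR := hR2
  leU := fun s ω => abs_cutProc_le hR0 t s ω
  leD := fun ω r s => abs_cutDeriv_le hR0 t ω r s
  hasDirDeriv := by
    filter_upwards [hslice, hbound, ae_restrict_mem measurableSet_Icc] with s h1 h2 h3
    by_cases hs : s ∈ Icc 0 t
    · have e : ∀ ω r, cutDeriv R DY t ω r s = truncDeriv R DY ω r s := fun ω r => by
        rw [cutDeriv, indicator_of_mem hs]
      have m : Measurable fun z : Ω × ℝ => truncDeriv R DY z.1 z.2 s :=
        (measurable_truncDeriv hR hD).comp
          (measurable_fst.prodMk (measurable_snd.prodMk measurable_const))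
      have h4 := h1.hasDirDeriv hB hBX (ζ := fun ω r => truncDeriv R DY ω r s) (R := R) ?_ hR2
        (fun ω => m.comp measurable_prodMk_left) (fun ω r => abs_trunc_le (hR0 ω) _) ?_
      · simp only [e]
        refine h4.congr ?_
        filter_upwards [hYR] with ω hω
        rw [cutProc_eq ht hω, indicator_of_mem hs]
      · intro p q
        refine (Measurable.integral_right (f := fun ω (z : ℝ × ℝ) => truncDeriv R DY ω z.1 s *
          incrFun p q z.2 * sgn μ z) ?_).aestronglyMeasurable
        exact ((m.comp (measurable_fst.prodMk (measurable_fst.comp measurable_snd))).mul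
          ((isBM_incrFun p q).1.comp (measurable_snd.comp measurable_snd))).mul
          ((measurable_sgn μ).comp measurable_snd)
      · filter_upwards [h2] with ω hω
        filter_upwards [hω] with r hr
        exact trunc_eq hr
    · have e1 : cutProc R Y t s = fun _ => 0 := by
        ext ω; rw [cutProc, indicator_of_notMem hs]
      have e2 : ∀ ω, (fun r => cutDeriv R DY t ω r s) = fun _ => 0 := fun ω => by
        ext r; rw [cutDeriv, indicator_of_notMem hs]
      simp only [e1, e2, bil_zero_left]
      exact HasDirDeriv.zero
  avgU := by
    filter_upwards [hYc, hYR] with ω h1 h2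
    exact ae_tendsto_avg_cutProc hB hμ hR hR0 hY ht h1 h2
  avgD := ae_tendsto_avg_cutDeriv hR hR0 hD hbound hB hμ hl hr t

/-- Traces of the derivative as limits of averages of its truncation, with the exceptional sets in
a convenient order. -/
lemma ae_tendsto_avg_trace (hB : IsCovProcess P B μ) (hμ : IsCovarianceMeasure T P X μ)
    {A : (ℝ → ℝ) → ℝ → ℝ → ℝ} {σ : ℝ} (hσ : σ ≠ 0)
    (hA : ∀ {f g : ℝ → ℝ} {b : ℝ}, (∀ᵐ s ∂volume.restrict (Icc 0 T), f s = g s) → b ∈ Ioo 0 T →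
      (fun ε => avg T (σ * ε) g b) =ᶠ[𝓝[>] 0] A f b)
    (hc : ∀ᵐ p ∂μ.totalVariation, ∀ᵐ ω ∂P, ∃ l : ℝ,
      Tendsto (A (DY ω p.1) p.2) (𝓝[>] 0) (𝓝 l)) :
    ∀ᵐ ω ∂P, ∀ᵐ p ∂μ.totalVariation,
      Tendsto (fun ε => avg T (σ * ε) (truncDeriv R DY ω p.1) p.2) (𝓝[>] 0)
        (𝓝 (limUnder (𝓝[>] 0) (A (DY ω p.1) p.2))) := by
  have hE := measurable_truncDeriv hR hD
  have hm : ∀ q : ℚ, Measurable fun x : (ℝ × ℝ) × Ω =>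
      avg T (σ * q) (truncDeriv R DY x.2 x.1.1) x.1.2 := fun q => by
    refine measurable_avg T (σ * q) (g := fun (x : (ℝ × ℝ) × Ω) s => truncDeriv R DY x.2 x.1.1 s)
      ?_ (measurable_snd.comp measurable_fst)
    have n : Measurable fun y : ((ℝ × ℝ) × Ω) × ℝ => (y.1.2, y.1.1.1, y.2) := by fun_prop
    exact hE.comp n
  -- With rational scales only, the existence of a limit is a measurable condition, so the point of
  -- the plane and ω may exchange their order.
  have hS := measurableSet_exists_tendsto (l := comap (fun q : ℚ => (q : ℝ)) (𝓝[>] 0)) hm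
  have h1 : ∀ᵐ p ∂μ.totalVariation, ∀ᵐ ω ∂P, ∃ l : ℝ,
      Tendsto (fun q : ℚ => avg T (σ * q) (truncDeriv R DY ω p.1) p.2)
        (comap (fun q : ℚ => (q : ℝ)) (𝓝[>] 0)) (𝓝 l) := by
    filter_upwards [hc, ae_snd_of_marginal (hB.ae_mem_Ioo hμ),
      hB.ae_fst (ae_eq_truncDeriv_comm hR hD hbound)] with p k1 k2 k3
    filter_upwards [k1, k3] with ω k4 k5
    obtain ⟨l, hl⟩ := k4
    exact ⟨l, (hl.congr' (hA k5 k2).symm).comp tendsto_comap⟩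
  rw [Measure.ae_ae_comm hS] at h1
  filter_upwards [h1, ae_eq_truncDeriv hR hD hbound] with ω k1 k2
  filter_upwards [k1, ae_snd_of_marginal (hB.ae_mem_Ioo hμ), hB.ae_fst k2] with p k3 k4 k5
  obtain ⟨l, hl⟩ := k3
  -- Continuity in the scale recovers the limit along all reals.
  have hcont : ContinuousOn (fun ε => avg T (σ * ε) (truncDeriv R DY ω p.1) p.2) (Ioi 0) :=
    (continuousOn_avg (isBM_truncDeriv hR hR0 hD ω p.1) p.2).comp
      (continuous_const_mul σ).continuousOn fun ε hε => mul_ne_zero hσ (ne_of_gt hε)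
  have hl' := tendsto_of_tendsto_rat hcont hl
  have hA' : Tendsto (A (DY ω p.1) p.2) (𝓝[>] 0) (𝓝 l) := hl'.congr' (hA k5 k4)
  rwa [hA'.limUnder_eq]

end Derivative

omit [IsProbabilityMeasure P] in
/-- Integrals of averages over shrinking intervals converge to the integral of the trace. -/
lemma tendsto_integral_avg_indicator (hB : IsCovProcess P B μ) (hμ : IsCovarianceMeasure T P X μ)
    {g : ℝ → ℝ → ℝ} (hg : Measurable (Function.uncurry g)) {C : ℝ} (hC : ∀ r s, |g r s| ≤ C)
    {σ : ℝ} (hσ : σ ≠ 0) {τ : ℝ × ℝ → ℝ}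
    (hτ : ∀ᵐ p ∂μ.totalVariation,
      Tendsto (fun ε => avg T (σ * ε) (g p.1) p.2) (𝓝[>] 0) (𝓝 (τ p))) :
    Integrable τ μ.totalVariation ∧ ∀ t ≤ T,
      Tendsto (fun ε => ∫ p, avg T (σ * ε) ((Icc 0 t).indicator (g p.1)) p.2 * sgn μ p
        ∂μ.totalVariation) (𝓝[>] 0) (𝓝 (∫ᵛ p in Icc (0 : ℝ) T ×ˢ Icc (0 : ℝ) t, τ p ∂•μ)) := by
  have hm : ∀ (ε : ℝ) (h : ℝ → ℝ → ℝ), Measurable (Function.uncurry h) →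
      Measurable fun p : ℝ × ℝ => avg T ε (h p.1) p.2 := fun ε h hh =>
    measurable_avg T ε (g := fun (p : ℝ × ℝ) s => h p.1 s)
      (hh.comp ((measurable_fst.comp measurable_fst).prodMk measurable_snd)) measurable_snd
  have hu : Tendsto (fun n : ℕ => 1 / ((n : ℝ) + 1)) atTop (𝓝[>] 0) :=
    tendsto_nhdsWithin_iff.2 ⟨tendsto_one_div_add_atTop_nhds_zero_nat,
      Eventually.of_forall fun n => by simp only [mem_Ioi]; positivity⟩
  have hτm : AEStronglyMeasurable τ μ.totalVariation := by
    refine aestronglyMeasurable_of_tendsto_ae atTop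
      (f := fun (n : ℕ) (p : ℝ × ℝ) => avg T (σ * (1 / ((n : ℝ) + 1))) (g p.1) p.2)
      (fun n => (hm _ g hg).aestronglyMeasurable) ?_
    filter_upwards [hτ] with p hp
    exact hp.comp hu
  have hi : Integrable τ μ.totalVariation := by
    refine (integrable_const C).mono' hτm ?_
    filter_upwards [hτ] with p hp
    exact le_of_tendsto hp.norm (Eventually.of_forall fun ε => abs_avg_le T _ (hC p.1) p.2)
  refine ⟨hi, fun t ht => ?_⟩
  rw [setVectorIntegral_eq μ hi (measurableSet_Icc.prod measurableSet_Icc),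
    ← integral_indicator (measurableSet_Icc.prod measurableSet_Icc)]
  refine tendsto_integral_filter_of_dominated_convergence (fun _ => C)
    (Eventually.of_forall fun ε => ?_) (Eventually.of_forall fun ε => ae_of_all _ fun p => ?_)
    (integrable_const C) ?_
  · refine ((hm _ (fun r => (Icc 0 t).indicator (g r)) ?_).mul
      (measurable_sgn μ)).aestronglyMeasurable
    exact hg.indicator (measurableSet_Icc.preimage measurable_snd)
  · rw [norm_mul, Real.norm_eq_abs, Real.norm_eq_abs, abs_sgn, mul_one]
    exact abs_avg_le T _ (fun s => (norm_indicator_le_norm_self (g p.1) s).trans (hC p.1 s)) _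
  -- The line of height t is null. Off it, small windows lie entirely before t, where the cutoff is
  -- invisible, or entirely after it.
  · filter_upwards [hτ, hμ.ae_mem, ae_snd_of_marginal (hB.ae_mem_Ioo hμ),
      ae_snd_of_marginal (hB.ae_ne t)] with p h1 h2 h3 h4
    rcases lt_or_gt_of_ne h4 with h | h
    · rw [indicator_of_mem (show p ∈ Icc (0 : ℝ) T ×ˢ Icc (0 : ℝ) t from
        ⟨⟨h2.1.1.le, h2.1.2⟩, h3.1.le, h.le⟩)]
      refine (h1.congr' ?_).mul_const _
      filter_upwards [avg_indicator_eventuallyEq (T := T) (g := g p.1) hσ h3.1 h] with ε hε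
      exact hε.symm
    · rw [indicator_of_notMem (fun hp => not_le.2 h hp.2.2)]
      refine tendsto_const_nhds.congr' ?_
      filter_upwards [avg_indicator_eventually_zero (T := T) (g := g p.1) hσ h] with ε hε
      rw [hε, zero_mul]

end Cut

/-! ### Convergence in probability -/

section InMeasure

variable {ι Ω : Type*} [MeasurableSpace Ω] {P : Measure Ω} {l : Filter ι} {f g : ι → Ω → ℝ}
  {f' g' : Ω → ℝ}

lemma _root_.MeasureTheory.TendstoInMeasure.add_fun (hf : TendstoInMeasure P f l f')
    (hg : TendstoInMeasure P g l g') :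
    TendstoInMeasure P (fun i ω => f i ω + g i ω) l fun ω => f' ω + g' ω := by
  intro ε hε
  have h2 : 0 < ε / 2 := ENNReal.half_pos hε.ne'
  refine tendsto_of_tendsto_of_tendsto_of_le_of_le tendsto_const_nhds
    (by simpa using (hf _ h2).add (hg _ h2)) (fun _ => bot_le) fun i => ?_
  refine (measure_mono fun ω hω => ?_).trans (measure_union_le _ _)
  by_contra hn
  rw [mem_union, not_or] at hn
  have h3 : edist (f i ω) (f' ω) < ε / 2 := not_le.1 hn.1
  have h4 : edist (g i ω) (g' ω) < ε / 2 := not_le.1 hn.2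
  have h5 := (edist_add_add_le (f i ω) (g i ω) (f' ω) (g' ω)).trans_lt (ENNReal.add_lt_add h3 h4)
  rw [ENNReal.add_halves] at h5
  exact absurd hω (not_le.2 h5)

lemma _root_.MeasureTheory.TendstoInMeasure.const_mul_fun (hf : TendstoInMeasure P f l f') (c : ℝ) :
    TendstoInMeasure P (fun i ω => c * f i ω) l fun ω => c * f' ω := by
  rcases eq_or_ne c 0 with rfl | hc
  · intro ε hε
    simp only [zero_mul, edist_self, not_le.2 hε, ofPred_false, measure_empty]
    exact tendsto_const_nhds
  · intro ε hε
    refine tendsto_of_tendsto_of_tendsto_of_le_of_le tendsto_const_nhds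
      (hf (ε / ‖c‖ₑ) (ENNReal.div_pos hε.ne' enorm_ne_top)) (fun _ => bot_le) fun i => ?_
    refine measure_mono fun ω hω => ENNReal.div_le_of_le_mul' ?_
    refine le_trans (show ε ≤ edist (c * f i ω) (c * f' ω) from hω) (le_of_eq ?_)
    rw [edist_eq_enorm_sub, edist_eq_enorm_sub, ← mul_sub, enorm_mul]

lemma tendstoInMeasure_of_ae [IsFiniteMeasure P] [l.IsCountablyGenerated]
    (hf : ∀ i, AEStronglyMeasurable (f i) P)
    (h : ∀ᵐ ω ∂P, Tendsto (fun i => f i ω) l (𝓝 (f' ω))) : TendstoInMeasure P f l f' := by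
  intro ε hε
  refine tendsto_of_seq_tendsto fun u hu => ?_
  refine tendstoInMeasure_of_tendsto_ae (f := fun n => f (u n)) (fun n => hf _) ?_ ε hε
  filter_upwards [h] with ω hω
  exact hω.comp hu

end InMeasure

/-! ### Covariation as a difference of regularized integrals -/

section Increments

variable {F y : ℝ → ℝ} {C : ℝ}

lemma intervalIntegrable_bounded_mul (hy : Measurable y) (hC : ∀ s, |y s| ≤ C) {c : ℝ → ℝ}
    (hc : Continuous c) (a b : ℝ) : IntervalIntegrable (fun s => y s * c s) volume a b := by
  have h : Continuous fun s => C * |c s| := continuous_const.mul hc.abs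
  refine (h.intervalIntegrable a b).mono_fun (hy.mul hc.measurable).aestronglyMeasurable
    (ae_of_all _ fun s => ?_)
  have hC0 : 0 ≤ C := (abs_nonneg _).trans (hC 0)
  beta_reduce
  rw [norm_mul, norm_mul, Real.norm_of_nonneg hC0, Real.norm_eq_abs, Real.norm_eq_abs,
    Real.norm_eq_abs, abs_abs]
  gcongr
  exact hC s

/-- Expand the increment of y and shift time by ε in the term containing y(s + ε): it becomes a
backward integral over [ε, t + ε], whence the two boundary terms. -/
lemma integral_incr_mul_incr (hF : Continuous F) (hy : Measurable y) (hC : ∀ s, |y s| ≤ C)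
    (t ε : ℝ) :
    ∫ s in (0 : ℝ)..t, (F (s + ε) - F s) * (y (s + ε) - y s) =
      (∫ s in (0 : ℝ)..t, y s * (F s - F (s - ε))) - (∫ s in (0 : ℝ)..t, y s * (F (s + ε) - F s)) +
      ((∫ s in t..(t + ε), y s * (F s - F (s - ε))) -
        ∫ s in (0 : ℝ)..(0 + ε), y s * (F s - F (s - ε))) := by
  have c1 : Continuous fun s => F s - F (s - ε) :=
    hF.sub (hF.comp (continuous_id.sub continuous_const))
  have c2 : Continuous fun s => F (s + ε) - F s :=
    (hF.comp (continuous_id.add continuous_const)).sub hF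
  have i1 := fun a b => intervalIntegrable_bounded_mul hy hC c1 a b
  have i2 := fun a b => intervalIntegrable_bounded_mul hy hC c2 a b
  have i3 := fun a b => intervalIntegrable_bounded_mul (hy.comp (measurable_add_const ε))
    (fun s => hC (s + ε)) c2 a b
  have e : ∀ s, (F (s + ε) - F s) * (y (s + ε) - y s) =
      y (s + ε) * (F (s + ε) - F s) - y s * (F (s + ε) - F s) := fun s => by ring
  have e2 : ∫ s in (0 : ℝ)..t, y (s + ε) * (F (s + ε) - F s) =
      ∫ s in (0 + ε)..(t + ε), y s * (F s - F (s - ε)) := by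
    rw [← intervalIntegral.integral_comp_add_right (fun s => y s * (F s - F (s - ε))) ε]
    simp only [add_sub_cancel_right]
  have e3 := intervalIntegral.integral_add_adjacent_intervals (i1 0 t) (i1 t (t + ε))
  have e4 := intervalIntegral.integral_add_adjacent_intervals (i1 0 (0 + ε)) (i1 (0 + ε) (t + ε))
  simp_rw [e]
  have e5 : ∫ s in (0 : ℝ)..t, (y (s + ε) * (F (s + ε) - F s) - y s * (F (s + ε) - F s)) =
      (∫ s in (0 : ℝ)..t, y (s + ε) * (F (s + ε) - F s)) -
        ∫ s in (0 : ℝ)..t, y s * (F (s + ε) - F s) :=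
    intervalIntegral.integral_sub (i3 0 t) (i2 0 t)
  rw [e5, e2]
  linarith

/-- The window has length ε, which the normalization absorbs; y is bounded and the increments of F
near a are small. -/
lemma tendsto_boundary_zero (hF : Continuous F) (hC : ∀ s, |y s| ≤ C) (a : ℝ) :
    Tendsto (fun ε => ε⁻¹ * ∫ s in a..(a + ε), y s * (F s - F (s - ε))) (𝓝[>] 0) (𝓝 0) := by
  have hC0 : 0 ≤ C := (abs_nonneg _).trans (hC 0)
  refine Metric.tendsto_nhds.2 fun δ hδ => ?_
  have hδ' : 0 < δ / (2 * (C + 1)) := by positivity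
  obtain ⟨η, hη, hsub⟩ := Metric.continuousAt_iff.1 (hF.continuousAt (x := a)) _ hδ'
  filter_upwards [Ioo_mem_nhdsGT hη] with ε hε
  have h := intervalIntegral.norm_integral_le_of_norm_le_const (a := a) (b := a + ε)
    (f := fun s => y s * (F s - F (s - ε))) (C := C * (δ / (C + 1))) fun s hs => ?_
  · rw [add_sub_cancel_left, abs_of_pos hε.1] at h
    rw [Real.dist_eq, sub_zero, abs_mul, abs_inv, abs_of_pos hε.1, inv_mul_lt_iff₀ hε.1]
    refine h.trans_lt ?_
    rw [mul_comm]
    refine mul_lt_mul_of_pos_left ?_ hε.1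
    rw [← mul_div_assoc, div_lt_iff₀ (by positivity)]
    nlinarith
  · rw [uIoc_of_le (by linarith [hε.1])] at hs
    have h1 : |F s - F a| < δ / (2 * (C + 1)) := hsub (by
      rw [Real.dist_eq, abs_lt]; constructor <;> linarith [hs.1, hs.2, hε.1, hε.2])
    have h2 : |F (s - ε) - F a| < δ / (2 * (C + 1)) := hsub (by
      rw [Real.dist_eq, abs_lt]; constructor <;> linarith [hs.1, hs.2, hε.1, hε.2])
    rw [norm_mul, Real.norm_eq_abs, Real.norm_eq_abs]
    have h3 : |F s - F (s - ε)| ≤ δ / (C + 1) := by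
      have e : δ / (C + 1) = δ / (2 * (C + 1)) + δ / (2 * (C + 1)) := by field_simp; ring
      rw [e]
      rw [abs_sub_comm] at h2
      exact (abs_sub_le _ (F a) _).trans (add_le_add h1.le h2.le)
    exact mul_le_mul (hC s) h3 (abs_nonneg _) hC0

end Increments

/-! ### Assembly of the limits -/

section Assembly

variable {Ω : Type*} [MeasurableSpace Ω] {T : ℝ} {P : Measure Ω} [IsProbabilityMeasure P]
  {X B : ℝ → Ω → ℝ} {μ : SignedMeasure (ℝ × ℝ)}

omit [IsProbabilityMeasure P] in
lemma IsSkorohodIntegral.congr {u u' : ℝ → Ω → ℝ} {S : Ω → ℝ}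
    (h : IsSkorohodIntegral T P X μ u S) (hu' : Measurable fun q : ℝ × Ω => u' q.1 q.2)
    (huu' : ∀ᵐ ω ∂P, ∀ s, u s ω = u' s ω) : IsSkorohodIntegral T P X μ u' S where
  measurable := hu'
  sq_lt_top := by
    refine (lintegral_congr_ae ?_).trans_lt h.sq_lt_top
    filter_upwards [huu'] with ω hω
    simp only [hω]
  memLp := h.memLp
  zero_mean := h.zero_mean
  duality := fun F hF => by
    refine (h.duality F (hF.congr ?_)).trans (integral_congr_ae ?_)
    · filter_upwards [(Measure.quasiMeasurePreserving_fst (μ := P)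
        (ν := μ.totalVariation)).ae huu'] with q hq
      rw [hq]
    · filter_upwards [huu'] with ω hω
      simp only [hω]

/-- The regularized forward and backward integrals converge in probability. -/
lemma IsRegularProc.tendstoInMeasure_regularized {U : ℝ → Ω → ℝ} {D : Ω → ℝ → ℝ → ℝ} {R : Ω → ℝ}
    (h : IsRegularProc T P X B μ U D R) (hB : IsCovProcess P B μ)
    (hBX : ∀ t ∈ Icc 0 T, B t =ᵐ[P] X t) {S : Ω → ℝ} (hS : MemLp S 2 P)
    (hlim : Tendsto (fun ε => eLpNorm (S - approxDiv T B μ U D ε) 2 P) (𝓝[≠] 0) (𝓝 0))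
    {σ : ℝ} (hσ : σ ≠ 0) {τ : Ω → ℝ}
    (hτ : ∀ᵐ ω ∂P, Tendsto (fun ε => ∫ p, avg T (σ * ε) (D ω p.1) p.2 * sgn μ p
      ∂μ.totalVariation) (𝓝[>] 0) (𝓝 (τ ω))) :
    TendstoInMeasure P
      (fun (ε : ℝ) ω => (σ * ε)⁻¹ * ∫ s in Icc 0 T, U s ω * (B (s + σ * ε) ω - B s ω))
      (𝓝[>] 0) fun ω => S ω + τ ω := by
  have h1 : TendstoInMeasure P (fun ε => approxDiv T B μ U D (σ * ε)) (𝓝[>] 0) S := by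
    refine tendstoInMeasure_of_tendsto_eLpNorm (p := 2) (by norm_num)
      (fun ε => (h.memLp_approxDiv hB hBX _).1) hS.1 ?_
    simp_rw [eLpNorm_sub_comm _ S]
    exact hlim.comp (tendsto_const_mul_nhdsGT hσ)
  have h2 := tendstoInMeasure_of_ae (fun ε => Measurable.aestronglyMeasurable
    (Measurable.integral_right (f := fun ω (p : ℝ × ℝ) =>
      avg T (σ * ε) (D ω p.1) p.2 * sgn μ p) ?_)) hτ
  · simp_rw [h.regularized_eq hB]
    exact h1.add_fun h2
  · refine Measurable.mul ?_ ((measurable_sgn μ).comp measurable_snd)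
    refine measurable_avg T (σ * ε) (g := fun (x : Ω × ℝ × ℝ) s => D x.1 x.2.1 s) ?_
      (measurable_snd.comp measurable_snd)
    have n : Measurable fun y : (Ω × ℝ × ℝ) × ℝ => (y.1.1, y.1.2.1, y.2) := by fun_prop
    exact h.measD.comp n

omit [MeasurableSpace Ω] in
lemma setIntegral_cutProc {R : Ω → ℝ} {Y : ℝ → Ω → ℝ} {t : ℝ} (ht : t ∈ Icc 0 T) {ω : Ω}
    (h : ∀ s ∈ Icc 0 T, |Y s ω| ≤ R ω) (c : ℝ → ℝ) :
    ∫ s in Icc 0 T, cutProc R Y t s ω * c s = ∫ s in (0 : ℝ)..t, prolong T Y s ω * c s := by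
  have e : ∀ s, cutProc R Y t s ω * c s =
      (Icc 0 t).indicator (fun s => prolong T Y s ω * c s) s := fun s => by
    rw [cutProc_eq ht.2 h]
    by_cases hs : s ∈ Icc 0 t
    · rw [indicator_of_mem hs, indicator_of_mem hs,
        show prolong T Y s ω = Y (clamp T s) ω from rfl, clamp_of_mem ⟨hs.1, hs.2.trans ht.2⟩]
    · rw [indicator_of_notMem hs, indicator_of_notMem hs, zero_mul]
  simp_rw [e]
  rw [setIntegral_indicator measurableSet_Icc, inter_eq_right.2 (Icc_subset_Icc_right ht.2),
    integral_Icc_eq_integral_Ioc, intervalIntegral.integral_of_le ht.1]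

end Assembly

end CovMeasure

end

theorem corollaryc5p11
    {Ω : Type*} [MeasurableSpace Ω] (P : Measure Ω) [IsProbabilityMeasure P]
    (T : ℝ) (hT : 0 < T)
    -- `X` is a continuous centred Gaussian process on `[0,T]`, null at `0`
    (X : ℝ → Ω → ℝ)
    (hXm : ∀ t ∈ Icc 0 T, Measurable (X t))
    (hXc : ∀ᵐ ω ∂P, ContinuousOn (fun t => X t ω) (Icc 0 T))
    (hX0 : ∀ᵐ ω ∂P, X 0 ω = 0)
    (hXG : IsGaussianProcess (fun t : Icc (0 : ℝ) T => X t) P)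
    (hXz : ∀ t ∈ Icc 0 T, ∫ ω, X t ω ∂P = 0)
    -- the law of `X` has full support in the continuous functions null at `0`
    (hXs : ∀ f : ℝ → ℝ, ContinuousOn f (Icc 0 T) → f 0 = 0 → ∀ δ : ℝ, 0 < δ →
      0 < P {ω | ∀ t ∈ Icc 0 T, |X t ω - f t| < δ})
    -- the underlying sigma-algebra is generated by `X`, up to null sets
    (hF : ∀ A : Set Ω, MeasurableSet A → ∃ B : Set Ω,
      MeasurableSet[⨆ t : Icc (0 : ℝ) T, MeasurableSpace.comap (X t) inferInstance] B ∧
        A =ᵐ[P] B)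
    -- `X` has the covariance measure `μ`
    (μ : SignedMeasure (ℝ × ℝ)) (hμ : CovMeasure.IsCovarianceMeasure T P X μ)
    -- `Y` is a cadlag process on `[0,T]`
    (Y : ℝ → Ω → ℝ)
    (hYm : Measurable (fun q : ℝ × Ω => Y q.1 q.2))
    (hYc : ∀ᵐ ω ∂P, CovMeasure.IsCadlag T (fun t => Y t ω))
    -- the supremum of `|Y|` is square integrable
    (ha : ∫⁻ ω, (⨆ t ∈ Icc 0 T, ‖Y t ω‖ₑ) ^ 2 ∂P < ∞)
    -- `Y` is Malliavin differentiable, with a derivative bounded by a square integrable variable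
    (DY : Ω → ℝ → ℝ → ℝ) (hb : CovMeasure.IsMalliavinDerivProc T P X μ Y DY)
    (Z₂ : Ω → ℝ) (hZ₂ : MemLp Z₂ 2 P)
    (hbound : ∀ᵐ s ∂(volume.restrict (Icc 0 T)), ∀ᵐ ω ∂P, ∀ᵐ r ∂(CovMeasure.marginal μ),
      |DY ω r s| ≤ Z₂ ω)
    -- the left traces of the derivative exist, and off the relevant null sets change nothing
    (hc : ∀ᵐ p ∂μ.totalVariation, ∀ᵐ ω ∂P, ∃ l : ℝ,
      Tendsto (CovMeasure.leftAvg (DY ω p.1) p.2) (𝓝[>] 0) (𝓝 l))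
    (hc_eq : ∀ s ∈ Ioc 0 T, ∀ᵐ ω ∂P, ∀ᵐ r ∂(CovMeasure.marginal μ),
      Tendsto (CovMeasure.leftAvg (DY ω r) s) (𝓝[>] 0) (𝓝 (DY ω r s)))
    -- the same for the right traces
    (hc' : ∀ᵐ p ∂μ.totalVariation, ∀ᵐ ω ∂P, ∃ l : ℝ,
      Tendsto (CovMeasure.rightAvg (DY ω p.1) p.2) (𝓝[>] 0) (𝓝 l))
    (hc'_eq : ∀ s ∈ Ico 0 T, ∀ᵐ ω ∂P, ∀ᵐ r ∂(CovMeasure.marginal μ),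
      Tendsto (CovMeasure.rightAvg (DY ω r) s) (𝓝[>] 0) (𝓝 (DY ω r s))) :
    -- the two traces are integrable with respect to `|μ|`
    (∀ᵐ ω ∂P,
      Integrable (fun p : ℝ × ℝ => CovMeasure.leftTrace (DY ω p.1) p.2) μ.totalVariation ∧
      Integrable (fun p : ℝ × ℝ => CovMeasure.rightTrace (DY ω p.1) p.2) μ.totalVariation) ∧
    ∀ t ∈ Icc 0 T,
      -- the Skorohod integral of `Y 1_{[0,t]}` exists
      (∃ S : Ω → ℝ, CovMeasure.IsSkorohodIntegral T P X μ
        (fun s ω => (Icc 0 t).indicator (fun s => Y s ω) s) S) ∧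
      -- the symmetric integral exists and is given by the announced formula
      (∀ S : Ω → ℝ, CovMeasure.IsSkorohodIntegral T P X μ
        (fun s ω => (Icc 0 t).indicator (fun s => Y s ω) s) S →
        CovMeasure.IsSymmetricIntegral T P Y X t (fun ω => S ω + 1 / 2 *
          ∫ᵛ p in Icc (0 : ℝ) T ×ˢ Icc (0 : ℝ) t,
            (CovMeasure.rightTrace (DY ω p.1) p.2 + CovMeasure.leftTrace (DY ω p.1) p.2) ∂•μ)) ∧
      -- the covariation exists and is given by the announced formula
      CovMeasure.IsCovariation T P X Y t (fun ω =>
        ∫ᵛ p in Icc (0 : ℝ) T ×ˢ Icc (0 : ℝ) t,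
          (CovMeasure.rightTrace (DY ω p.1) p.2 - CovMeasure.leftTrace (DY ω p.1) p.2) ∂•μ) := by
  obtain ⟨B, hB, hBp⟩ := CovMeasure.exists_isCovProcess hT hXm hXc hX0 hXG hXz hμ
  have hBX : ∀ t ∈ Icc 0 T, B t =ᵐ[P] X t := fun t ht => by
    filter_upwards [hBp] with ω hω
    rw [hω t, show CovMeasure.prolong T X t ω = X (CovMeasure.clamp T t) ω from rfl,
      CovMeasure.clamp_of_mem ht]
  obtain ⟨R, hR, hR2, hR0, hYR, hZR⟩ := CovMeasure.exists_dominating hT hYm hYc ha hZ₂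
  have hD := hb.measurable
  have hbR : ∀ᵐ s ∂(volume.restrict (Icc 0 T)), ∀ᵐ ω ∂P, ∀ᵐ r ∂(CovMeasure.marginal μ),
      |DY ω r s| ≤ R ω := by
    filter_upwards [hbound] with s hs
    filter_upwards [hs, hZR] with ω h1 h2
    filter_upwards [h1] with r hr
    exact hr.trans h2
  -- The sign σ of the scale selects the side: 1 for left traces, -1 for right traces.
  have hL := CovMeasure.ae_tendsto_avg_trace hR hR0 hD hbR hB hμ (σ := 1) one_ne_zero
    (A := CovMeasure.leftAvg) (fun hfg hb => by
      simpa only [one_mul] using CovMeasure.avg_eventuallyEq_leftAvg hfg le_rfl hb) hc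
  have hL' := CovMeasure.ae_tendsto_avg_trace hR hR0 hD hbR hB hμ (σ := -1) (by norm_num)
    (A := CovMeasure.rightAvg) (fun hfg hb => by
      simpa only [neg_one_mul] using CovMeasure.avg_neg_eventuallyEq_rightAvg hfg le_rfl hb) hc'
  have hE : ∀ ω, Measurable (Function.uncurry (CovMeasure.truncDeriv R DY ω)) := fun ω =>
    (CovMeasure.measurable_truncDeriv hR hD).comp measurable_prodMk_left
  have hleft := hL.mono fun ω h => CovMeasure.tendsto_integral_avg_indicator hB hμ (hE ω)
    (fun r s => CovMeasure.abs_trunc_le (hR0 ω) _) one_ne_zero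
    (τ := fun p => CovMeasure.leftTrace (DY ω p.1) p.2) h
  have hright := hL'.mono fun ω h => CovMeasure.tendsto_integral_avg_indicator hB hμ (hE ω)
    (fun r s => CovMeasure.abs_trunc_le (hR0 ω) _) (by norm_num : (-1 : ℝ) ≠ 0)
    (τ := fun p => CovMeasure.rightTrace (DY ω p.1) p.2) h
  refine ⟨?_, fun t ht => ?_⟩
  · filter_upwards [hleft, hright] with ω h1 h2
    exact ⟨h1.1, h2.1⟩
  have hreg := CovMeasure.isRegularProc_cut hR hR0 hD hbR hB hBX hμ hYm hYc hR2 hYR hb.slice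
    hc_eq hc'_eq ht.2
  obtain ⟨S₀, hS₀, hlim⟩ := hreg.exists_tendsto_approxDiv hB hBX
  have hu : Measurable fun q : ℝ × Ω => (Icc 0 t).indicator (fun s => Y s q.2) q.1 :=
    hYm.indicator (measurableSet_Icc.preimage measurable_fst)
  have hcut : ∀ᵐ ω ∂P, ∀ s,
      CovMeasure.cutProc R Y t s ω = (Icc 0 t).indicator (fun s => Y s ω) s := by
    filter_upwards [hYR] with ω hω s
    exact CovMeasure.cutProc_eq ht.2 hω s
  have hSk := hreg.isSkorohodIntegral hB hBX hS₀ hlim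
  have hui : Integrable (fun q : Ω × ℝ × ℝ => CovMeasure.cutProc R Y t q.2.2 q.1)
      (P.prod μ.totalVariation) := by
    refine ((hR2.integrable one_le_two).comp_fst μ.totalVariation).mono'
      (hreg.measU.comp ((measurable_snd.comp measurable_snd).prodMk
        measurable_fst)).aestronglyMeasurable (ae_of_all _ fun q => hreg.leU _ _)
  have hy : ∀ ω, Measurable fun s => CovMeasure.prolong T Y s ω := fun ω =>
    hYm.comp ((CovMeasure.continuous_clamp (T := T)).measurable.prodMk measurable_const)
  have hyR : ∀ᵐ ω ∂P, ∀ s, |CovMeasure.prolong T Y s ω| ≤ R ω := by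
    filter_upwards [hYR] with ω hω s
    exact hω _ (CovMeasure.clamp_mem hT s)
  have hsame : ∀ (Z : ℝ → Ω → ℝ) (ω : Ω), ∀ s ∈ uIcc 0 t, CovMeasure.prolong T Z s ω = Z s ω := by
    intro Z ω s hs
    rw [uIcc_of_le ht.1] at hs
    rw [show CovMeasure.prolong T Z s ω = Z (CovMeasure.clamp T s) ω from rfl,
      CovMeasure.clamp_of_mem ⟨hs.1, hs.2.trans ht.2⟩]
  -- Forward and backward integrals share the limit `S₀` and differ only in their trace terms.
  have hfwd := hreg.tendstoInMeasure_regularized hB hBX hS₀ hlim one_ne_zero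
    (hleft.mono fun ω h => h.2 t ht.2)
  have hbwd := hreg.tendstoInMeasure_regularized hB hBX hS₀ hlim (by norm_num : (-1 : ℝ) ≠ 0)
    (hright.mono fun ω h => h.2 t ht.2)
  have efwd : ∀ᵐ ω ∂P, ∀ ε : ℝ, (1 * ε)⁻¹ * ∫ s in Icc 0 T, CovMeasure.cutProc R Y t s ω *
      (B (s + 1 * ε) ω - B s ω) =
      ε⁻¹ * ∫ s in (0 : ℝ)..t, CovMeasure.prolong T Y s ω * (B (s + ε) ω - B s ω) := by
    filter_upwards [hYR] with ω hω ε
    rw [CovMeasure.setIntegral_cutProc ht hω fun s => B (s + 1 * ε) ω - B s ω]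
    simp only [one_mul]
  have ebwd : ∀ᵐ ω ∂P, ∀ ε : ℝ, (-1 * ε)⁻¹ * ∫ s in Icc 0 T, CovMeasure.cutProc R Y t s ω *
      (B (s + -1 * ε) ω - B s ω) =
      ε⁻¹ * ∫ s in (0 : ℝ)..t, CovMeasure.prolong T Y s ω * (B s ω - B (s - ε) ω) := by
    filter_upwards [hYR] with ω hω ε
    rw [CovMeasure.setIntegral_cutProc ht hω fun s => B (s + -1 * ε) ω - B s ω]
    simp only [neg_one_mul, ← sub_eq_add_neg]
    rw [inv_neg, neg_mul, ← mul_neg, ← intervalIntegral.integral_neg]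
    simp only [← mul_neg, neg_sub]
  have hsplit : ∀ᵐ ω ∂P, ∀ c : ℝ, (∫ᵛ p in Icc (0 : ℝ) T ×ˢ Icc (0 : ℝ) t,
      (CovMeasure.rightTrace (DY ω p.1) p.2 + c * CovMeasure.leftTrace (DY ω p.1) p.2) ∂•μ) =
      (∫ᵛ p in Icc (0 : ℝ) T ×ˢ Icc (0 : ℝ) t, CovMeasure.rightTrace (DY ω p.1) p.2 ∂•μ) +
      c * ∫ᵛ p in Icc (0 : ℝ) T ×ˢ Icc (0 : ℝ) t, CovMeasure.leftTrace (DY ω p.1) p.2 ∂•μ := by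
    filter_upwards [hleft, hright] with ω h1 h2 c
    have hm : MeasurableSet (Icc (0 : ℝ) T ×ˢ Icc (0 : ℝ) t) :=
      measurableSet_Icc.prod measurableSet_Icc
    rw [CovMeasure.setVectorIntegral_eq μ h1.1 hm, CovMeasure.setVectorIntegral_eq μ h2.1 hm,
      CovMeasure.setVectorIntegral_eq μ (f := fun p => CovMeasure.rightTrace (DY ω p.1) p.2 +
        c * CovMeasure.leftTrace (DY ω p.1) p.2) (h2.1.add (h1.1.const_mul c)) hm,
      ← integral_const_mul, ← integral_add h2.1.mul_sgn.integrableOn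
        (h1.1.mul_sgn.integrableOn.const_mul c)]
    congr with p
    ring
  refine ⟨⟨S₀, hSk.congr hu hcut⟩, fun S hS => ?_, ?_⟩
  -- The formula concerns an arbitrary version of the Skorohod integral; by uniqueness it is the one
  -- constructed.
  · have hSS : S =ᵐ[P] S₀ := CovMeasure.IsSkorohodIntegral.ae_eq hB hBX hXm hX0 hF hui
      (hS.congr hreg.measU (hcut.mono fun ω h s => (h s).symm)) hSk
    -- The symmetric difference quotient is the half sum of the forward and backward ones.
    refine ((hfwd.add_fun hbwd).const_mul_fun (1 / 2)).congr (fun ε => ?_) ?_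
    · filter_upwards [efwd, ebwd, hyR, hBp] with ω h1 h2 h3 h4
      have i1 := CovMeasure.intervalIntegrable_bounded_mul (hy ω) h3
        (c := fun s => B (s + ε) ω - B s ω)
        (((hB.cont ω).comp (continuous_add_const ε)).sub (hB.cont ω)) 0 t
      have i2 := CovMeasure.intervalIntegrable_bounded_mul (hy ω) h3
        (c := fun s => B s ω - B (s - ε) ω)
        ((hB.cont ω).sub ((hB.cont ω).comp (continuous_id.sub continuous_const))) 0 t
      rw [h1, h2, ← mul_add, ← intervalIntegral.integral_add i1 i2, ← mul_assoc,
        ← intervalIntegral.integral_const_mul]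
      refine intervalIntegral.integral_congr fun s hs => ?_
      simp only [hsame Y ω s hs, ← h4]
      rw [div_eq_mul_inv (B (s + ε) ω - B (s - ε) ω), mul_inv]
      ring
    · filter_upwards [hSS, hsplit] with ω h1 h2
      have h3 := h2 1
      simp only [one_mul] at h3
      rw [h1, h3]
      ring
  · have hbdry : TendstoInMeasure P (fun (ε : ℝ) ω =>
        (ε⁻¹ * ∫ s in t..(t + ε), CovMeasure.prolong T Y s ω * (B s ω - B (s - ε) ω)) -
        ε⁻¹ * ∫ s in (0 : ℝ)..(0 + ε), CovMeasure.prolong T Y s ω * (B s ω - B (s - ε) ω))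
        (𝓝[>] 0) fun _ => 0 := by
      refine CovMeasure.tendstoInMeasure_of_ae (fun ε => Measurable.aestronglyMeasurable ?_) ?_
      · have hBm : Measurable (Function.uncurry B) :=
          measurable_uncurry_of_continuous_of_measurable hB.cont hB.meas
        have hjm : Measurable fun q : Ω × ℝ =>
            CovMeasure.prolong T Y q.2 q.1 * (B q.2 q.1 - B (q.2 - ε) q.1) :=
          (hYm.comp (((CovMeasure.continuous_clamp (T := T)).measurable.comp
            measurable_snd).prodMk measurable_fst)).mul
          ((hBm.comp (measurable_snd.prodMk measurable_fst)).sub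
            (hBm.comp ((measurable_snd.sub_const ε).prodMk measurable_fst)))
        have hij : ∀ a b : ℝ, Measurable fun ω =>
            ∫ s in a..b, CovMeasure.prolong T Y s ω * (B s ω - B (s - ε) ω) := fun a b =>
          (Measurable.integral_right hjm).sub (Measurable.integral_right hjm)
        exact ((hij _ _).const_mul _).sub ((hij _ _).const_mul _)
      · filter_upwards [hyR] with ω h1
        simpa using (CovMeasure.tendsto_boundary_zero (hB.cont ω) h1 t).sub
          (CovMeasure.tendsto_boundary_zero (hB.cont ω) h1 0)
    -- Backward minus forward: `S₀` cancels and the difference of the traces remains, the boundary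
    -- terms being negligible.
    refine ((hbwd.add_fun (hfwd.const_mul_fun (-1))).add_fun hbdry).congr (fun ε => ?_) ?_
    · filter_upwards [efwd, ebwd, hyR, hBp] with ω h1 h2 h3 h4
      rw [h1, h2, neg_one_mul, ← sub_eq_add_neg, ← mul_sub, ← mul_sub, ← mul_add,
        ← CovMeasure.integral_incr_mul_incr (hB.cont ω) (hy ω) h3]
      congr 1
      refine intervalIntegral.integral_congr fun s hs => ?_
      simp only [hsame Y ω s hs, h4, hsame X ω s hs]
    · filter_upwards [hsplit] with ω h2
      have h3 := h2 (-1)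
      simp only [neg_one_mul, ← sub_eq_add_neg] at h3
      rw [h3]
      ring
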